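/- **Setting.** Let $p,q\ge 0$ be integers with $n=p+q\ge 1$. Let $C_p$ be the real Clifford algebra of $v_1^2+\dots+v_p^2$ (so $e_i^2=1$, $e_ie_j=-e_je_i$ for $i\neq j$), let $R_{p,q}=C_p\otimes_{\mathbb R} C_q$ (ordinary tensor product of algebras) with generators $e_1,\dots,e_p$ of $C_p$ and $e_{p+1},\dots,e_{p+q}$ of $C_q$, and let $R^+_{p,q}$ be the subalgebra generated by the products $e_ie_j$ $(i\ne j)$. Put $\varepsilon_i=1$ for $i\le p$ and $\varepsilon_i=-1$ for $i>p$, and $\mathfrak{so}(p,q)=\{X\in M(p+q;\mathbb R): {}^tX1_{p,q}+1_{p,q}X=0\}$, where $1_{k_1,k_2}=\mathrm{diag}(1,\dots,1,-1,\dots,-1)$. We identify $\mathfrak{so}(p,q)$ with the Lie algebra $\mathfrak k_{p,q}\subset R^+_{p,q}$ spanned by the $e_ie_j$ $(i<j)$, by $2E_{ij}-2\varepsilon_i\varepsilon_jE_{ji}\leftrightarrow e_ie_j$. Let $\rho:R_{p,q}\to M(m;\mathbb R)$ be a representation on $W=\mathbb R^m$ such that all $S_i=\rho(e_i)$ are symmetric,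 let $\mathfrak h_{p,q}(\rho)=\{X\in\mathfrak{gl}(W): {}^tXS_i+S_iX=0\ (1\le i\le p+q)\}$ and $\mathfrak g'_{p,q}(\rho)=\mathfrak{so}(p,q)\oplus\mathfrak h_{p,q}(\rho)$. This Lie algebra acts on $W$: $\mathfrak{so}(p,q)\cong\mathfrak k_{p,q}$ through $\rho$, and $\mathfrak h_{p,q}(\rho)$ as a subalgebra of $\mathfrak{gl}(W)$. **Notation.** Let $\Lambda_1$ be the standard representation of $\mathfrak{gl}(k,\mathbb K)$ on $\mathbb K^k$ ($\mathbb K=\mathbb R,\mathbb C,\mathbb H$), $\Lambda_1^*$ its dual ($X\mapsto -{}^t\bar X$ for $\mathbb K=\mathbb R,\mathbb H$), and let $\Lambda_1$ also denote its restriction to $\mathfrak{so}(k_1,k_2)\subset\mathfrak{gl}(k_1+k_2,\mathbb R)$, $\mathfrak{so}(k,\mathbb C)\subset\mathfrak{gl}(k,\mathbb C)$, $\mathfrak{so}^*(2k)=\{X: {}^t\bar Xj+jX=0\}\subset\mathfrak{gl}(k,\mathbb H)$, $\mathfrak{sp}(k_1,k_2)=\{X:{}^t\bar X1_{k_1,k_2}+1_{k_1,k_2}X=0\}\subset\mathfrak{gl}(k_1+k_2,\mathbb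 H)$, $\mathfrak{sp}(k,\mathbb R)\subset\mathfrak{gl}(2k,\mathbb R)$, $\mathfrak{sp}(k,\mathbb C)\subset\mathfrak{gl}(2k,\mathbb C)$, $\mathfrak u(k_1,k_2)\subset\mathfrak{gl}(k_1+k_2,\mathbb C)$; all are regarded as real Lie algebras. **Theorem.** According to the unordered pair $\{p \bmod 8,\,q\bmod 8\}$, the algebras $R_{p,q}$ and $R^+_{p,q}$ are isomorphic to $T$, $2T$ or $4T$ with $T=M(\ell;\mathbb K)$, and to $T'$ or $2T'$ with $T'=M(r;\mathbb K')$, as listed below ($dT$ is the direct sum of $d$ copies of $T$). If $R^+_{p,q}\cong T'$, let $\Lambda$ be the (spin) representation of $\mathfrak{so}(p,q)$ on $\mathbb K'^r$ induced by the irreducible representation of $R^+_{p,q}$; if $R^+_{p,q}\cong 2T'$, let $\Lambda_e,\Lambda_o$ be the two (half-spin) representations of $\mathfrak{so}(p,q)$ on $\mathbb K'^r$ induced by the two irreducible representations of $R^+_{p,q}$. Let $k$ (resp. $k_1,k_2$; $k_1,\dots,k_4$) be the multiplicities in $\rho$ of the irreducible representation $\rho_1$ (resp. $\rho_1,\rho_2$;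 $\rho_1,\dots,\rho_4$) of $R_{p,q}$, which acts on $\mathbb K^\ell$; they are numbered, in the case $(2T,2T')$, so that $\rho_1|_{R^+_{p,q}}$ and $\rho_2|_{R^+_{p,q}}$ are, as real representations, direct sums of copies of $\Lambda_e$ and of $\Lambda_o$ respectively (two copies if $\mathbb K'=\mathbb R$, one if $\mathbb K'=\mathbb H$), and, in the case $(4T,2T')$, so that $\rho_1,\rho_2$ restrict to $\Lambda_e$ and $\rho_3,\rho_4$ to $\Lambda_o$. Then $\mathfrak h_{p,q}(\rho)$ is isomorphic to the Lie algebra $\mathfrak s$ in the table, by an isomorphism under which the representation of $\mathfrak g'_{p,q}(\rho)$ on $W$ is equivalent, over $\mathbb R$, to the representation of $\mathfrak{so}(p,q)\oplus\mathfrak s$ in the last column, the isomorphism being the identity on $\mathfrak{so}(p,q)$ and the tensor products of spin representations with $\Lambda_1,\Lambda_1^*$ being taken over $\mathbb K'$. $$\begin{array}{|c|c|c|c|c|c|c|}\hline (R_{p,q},R^+_{p,q})&(\mathbb K,\mathbb K')&\{p,q\}\bmod 8&\ell&r&\mathfrak s&\text{representation}\\\hline (T,T')&(\mathbb R,\mathbb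 C)&\{0,2\},\{4,6\}&2^{n/2}&2^{n/2-1}&\mathfrak{so}(k,\mathbb C)&\Lambda\otimes\Lambda_1\\ (T,T')&(\mathbb C,\mathbb R)&\{0,7\},\{2,3\},\{3,4\},\{6,7\}&2^{(n-1)/2}&2^{(n-1)/2}&\mathfrak{sp}(k,\mathbb R)&\Lambda\otimes\Lambda_1\\ (T,T')&(\mathbb C,\mathbb H)&\{0,3\},\{2,7\},\{3,6\},\{4,7\}&2^{(n-1)/2}&2^{(n-1)/2-1}&\mathfrak{so}^*(2k)&\Lambda\otimes\Lambda_1\\ (T,T')&(\mathbb H,\mathbb C)&\{0,6\},\{2,4\}&2^{n/2-1}&2^{n/2-1}&\mathfrak{sp}(k,\mathbb C)&\Lambda\otimes\Lambda_1\\\hline (T,2T')&(\mathbb R,\mathbb R)&\{0,0\},\{2,2\},\{4,4\},\{6,6\}&2^{n/2}&2^{n/2-1}&\mathfrak{gl}(k,\mathbb R)&\Lambda_e\otimes\Lambda_1+\Lambda_o\otimes\Lambda_1^*\\ (T,2T')&(\mathbb H,\mathbb H)&\{0,4\},\{2,6\}&2^{n/2-1}&2^{n/2-2}&\mathfrak{gl}(k,\mathbb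 H)&\Lambda_e\otimes\Lambda_1+\Lambda_o\otimes\Lambda_1^*\\\hline (2T,T')&(\mathbb R,\mathbb R)&\{0,1\},\{1,2\},\{4,5\},\{5,6\}&2^{(n-1)/2}&2^{(n-1)/2}&\mathfrak{so}(k_1,k_2)&\Lambda\otimes\Lambda_1\\ (2T,T')&(\mathbb C,\mathbb C)&\{1,3\},\{1,7\},\{3,5\},\{5,7\}&2^{n/2-1}&2^{n/2-1}&\mathfrak u(k_1,k_2)&\Lambda\otimes\Lambda_1\\ (2T,T')&(\mathbb H,\mathbb H)&\{0,5\},\{1,4\},\{1,6\},\{2,5\}&2^{(n-3)/2}&2^{(n-3)/2}&\mathfrak{sp}(k_1,k_2)&\Lambda\otimes\Lambda_1\\\hline (2T,2T')&(\mathbb C,\mathbb R)&\{3,3\},\{7,7\}&2^{n/2-1}&2^{n/2-1}&\mathfrak{sp}(k_1,\mathbb R)\oplus\mathfrak{sp}(k_2,\mathbb R)&\Lambda_e\otimes\Lambda_1\otimes1+\Lambda_o\otimes1\otimes\Lambda_1\\ (2T,2T')&(\mathbb C,\mathbb H)&\{3,7\}&2^{n/2-1}&2^{n/2-2}&\mathfrak{so}^*(2k_1)\oplus\mathfrak{so}^*(2k_2)&\Lambda_e\otimes\Lambda_1\otimes1+\Lambda_o\otimes1\otimes\Lambda_1\\\hline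 (4T,2T')&(\mathbb R,\mathbb R)&\{1,1\},\{5,5\}&2^{n/2-1}&2^{n/2-1}&\mathfrak{so}(k_1,k_2)\oplus\mathfrak{so}(k_3,k_4)&\Lambda_e\otimes\Lambda_1\otimes1+\Lambda_o\otimes1\otimes\Lambda_1\\ (4T,2T')&(\mathbb H,\mathbb H)&\{1,5\}&2^{n/2-2}&2^{n/2-2}&\mathfrak{sp}(k_1,k_2)\oplus\mathfrak{sp}(k_3,k_4)&\Lambda_e\otimes\Lambda_1\otimes1+\Lambda_o\otimes1\otimes\Lambda_1\\\hline \end{array}$$ -/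

import Mathlib

open scoped TensorProduct Matrix Quaternion

attribute [local instance] LieRing.ofAssociativeRing

noncomputable section

namespace CliffordQuartic

/-! ### The algebra `R_{p,q} = C_p ⊗ C_q` and its even part -/

/-- The positive definite quadratic form `v₁² + ⋯ + v_p²` on `ℝ^p`. -/
abbrev sqForm (p : ℕ) : QuadraticForm ℝ (Fin p → ℝ) :=
  QuadraticMap.weightedSumSquares ℝ (fun _ : Fin p => (1 : ℝ))

/-- `R_{p,q} = C_p ⊗ C_q` (the ordinary, ungraded tensor product of algebras). -/
abbrev R (p q : ℕ) : Type :=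
  CliffordAlgebra (sqForm p) ⊗[ℝ] CliffordAlgebra (sqForm q)

/-- The standard generators: `e_i ⊗ 1` for an index of the first kind (`1 ≤ i ≤ p`), `1 ⊗ e_j`
for an index of the second kind (`p + 1 ≤ j ≤ p + q`). -/
def gen (p q : ℕ) : Fin p ⊕ Fin q → R p q :=
  Sum.elim
    (fun i => CliffordAlgebra.ι (sqForm p) (Pi.single i 1) ⊗ₜ[ℝ] 1)
    (fun j => 1 ⊗ₜ[ℝ] CliffordAlgebra.ι (sqForm q) (Pi.single j 1))

/-- The signs `ε_i`: `1` on the first `p` indices, `-1` on the last `q`. -/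
def sgn (p q : ℕ) : Fin p ⊕ Fin q → ℝ := Sum.elim (fun _ => 1) (fun _ => -1)

/-- The even subalgebra of `R_{p,q}`, generated by the products `e_i e_j` (`i ≠ j`). -/
def REven (p q : ℕ) : Subalgebra ℝ (R p q) :=
  Algebra.adjoin ℝ {x | ∃ i j, i ≠ j ∧ x = gen p q i * gen p q j}

theorem ι_single_sq (p : ℕ) (i : Fin p) :
    CliffordAlgebra.ι (sqForm p) (Pi.single i 1) * CliffordAlgebra.ι (sqForm p) (Pi.single i 1)
      = 1 := by
  rw [CliffordAlgebra.ι_sq_scalar, QuadraticMap.weightedSumSquares_apply]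
  simp [Pi.single_apply]

theorem ι_single_anti (p : ℕ) {i j : Fin p} (h : i ≠ j) :
    CliffordAlgebra.ι (sqForm p) (Pi.single i 1) * CliffordAlgebra.ι (sqForm p) (Pi.single j 1)
      = - (CliffordAlgebra.ι (sqForm p) (Pi.single j 1) *
          CliffordAlgebra.ι (sqForm p) (Pi.single i 1)) := by
  apply CliffordAlgebra.ι_mul_ι_comm_of_isOrtho
  rw [QuadraticMap.isOrtho_def]
  simp only [QuadraticMap.weightedSumSquares_apply, ← Finset.sum_add_distrib]
  refine Finset.sum_congr rfl fun k _ => ?_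
  rcases eq_or_ne k i with rfl | hk
  · simp [h]
  · simp [hk]

theorem gen_sq (p q : ℕ) (i : Fin p ⊕ Fin q) : gen p q i * gen p q i = 1 := by
  rcases i with i | i <;>
    simp only [gen, Sum.elim_inl, Sum.elim_inr, Algebra.TensorProduct.tmul_mul_tmul, ι_single_sq,
      Algebra.TensorProduct.one_def, mul_one]

theorem gen_comm (p q : ℕ) {i j : Fin p ⊕ Fin q} (h : i ≠ j) :
    gen p q i * gen p q j = -(sgn p q i * sgn p q j) • (gen p q j * gen p q i) := by
  rcases i with i | i <;> rcases j with j | j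
  · have h' : i ≠ j := fun e => h (e ▸ rfl)
    simp [gen, sgn, Algebra.TensorProduct.tmul_mul_tmul, ι_single_anti p h',
      TensorProduct.neg_tmul]
  · simp [gen, sgn, Algebra.TensorProduct.tmul_mul_tmul]
  · simp [gen, sgn, Algebra.TensorProduct.tmul_mul_tmul]
  · have h' : i ≠ j := fun e => h (e ▸ rfl)
    simp [gen, sgn, Algebra.TensorProduct.tmul_mul_tmul, ι_single_anti q h',
      TensorProduct.tmul_neg]

theorem gen_mul_gen_mem (p q : ℕ) (i j : Fin p ⊕ Fin q) :
    gen p q i * gen p q j ∈ REven p q := by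
  rcases eq_or_ne i j with rfl | h
  · rw [gen_sq]; exact one_mem _
  · exact Algebra.subset_adjoin ⟨i, j, h, rfl⟩

/-! ### `𝔰𝔬(p,q)` inside the even part -/

/-- `𝔰𝔬(p,q) = {X ∈ M(p+q; ℝ) | ᵗX 1_{p,q} + 1_{p,q} X = 0}`. -/
abbrev soPQ (p q : ℕ) : LieSubalgebra ℝ (Matrix (Fin p ⊕ Fin q) (Fin p ⊕ Fin q) ℝ) :=
  LieAlgebra.Orthogonal.so' (Fin p) (Fin q) ℝ

theorem sgn_sq (p q : ℕ) (i : Fin p ⊕ Fin q) : sgn p q i * sgn p q i = 1 := by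
  rcases i with i | i <;> simp [sgn]

theorem soPQ_entry (p q : ℕ) (A : soPQ p q) (i j : Fin p ⊕ Fin q) :
    sgn p q i * sgn p q j * A.1 i j = - A.1 j i := by
  have h : (A.1)ᵀ * LieAlgebra.Orthogonal.indefiniteDiagonal (Fin p) (Fin q) ℝ
      = LieAlgebra.Orthogonal.indefiniteDiagonal (Fin p) (Fin q) ℝ * (-A.1) :=
    (mem_skewAdjointMatricesSubmodule _ _).1
      ((mem_skewAdjointMatricesLieSubalgebra _ _).1 A.2)
  have h' := congrFun (congrFun h j) i
  have hd : LieAlgebra.Orthogonal.indefiniteDiagonal (Fin p) (Fin q) ℝ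
      = Matrix.diagonal (sgn p q) := rfl
  rw [hd, Matrix.mul_diagonal, Matrix.diagonal_mul, Matrix.transpose_apply, Matrix.neg_apply] at h'
  have hj := sgn_sq p q j
  calc sgn p q i * sgn p q j * A.1 i j = sgn p q j * (A.1 i j * sgn p q i) := by ring
    _ = (sgn p q j * sgn p q j) * (-A.1 j i) := by rw [h']; ring
    _ = - A.1 j i := by rw [hj, one_mul]

/-- The element `¼ ∑ A_{ij} e_i e_j` of `R_{p,q}`. -/
def spinElt (p q : ℕ) (A : Matrix (Fin p ⊕ Fin q) (Fin p ⊕ Fin q) ℝ) : R p q :=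
  (1 / 4 : ℝ) • ∑ i, ∑ j, A i j • (gen p q i * gen p q j)

theorem spinElt_mem (p q : ℕ) (A : Matrix (Fin p ⊕ Fin q) (Fin p ⊕ Fin q) ℝ) :
    spinElt p q A ∈ REven p q :=
  Subalgebra.smul_mem _ (Subalgebra.sum_mem _ fun i _ => Subalgebra.sum_mem _ fun j _ =>
    Subalgebra.smul_mem _ (gen_mul_gen_mem p q i j) _) _

theorem gen_swap (p q : ℕ) (i j : Fin p ⊕ Fin q) :
    gen p q i * gen p q j = (if i = j then (2 : ℝ) else 0) • (1 : R p q)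
      - (sgn p q i * sgn p q j) • (gen p q j * gen p q i) := by
  split_ifs with h
  · subst h
    rw [gen_sq, sgn_sq, ← sub_smul]; norm_num
  · rw [gen_comm p q h]; simp

theorem quad_bracket (p q : ℕ) (i j k l : Fin p ⊕ Fin q) :
    gen p q i * gen p q j * (gen p q k * gen p q l)
        - gen p q k * gen p q l * (gen p q i * gen p q j)
      = (if j = k then (2 : ℝ) else 0) • (gen p q i * gen p q l)
        - (sgn p q i * sgn p q j * if i = k then (2 : ℝ) else 0) • (gen p q j * gen p q l)
        + (sgn p q i * sgn p q j * if j = l then (2 : ℝ) else 0) • (gen p q k * gen p q i)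
        - (if i = l then (2 : ℝ) else 0) • (gen p q k * gen p q j) := by
  have t1 : gen p q i * gen p q j * (gen p q k * gen p q l)
      = (if j = k then (2 : ℝ) else 0) • (gen p q i * gen p q l)
        - (sgn p q j * sgn p q k) • (gen p q i * gen p q k * (gen p q j * gen p q l)) := by
    rw [show gen p q i * gen p q j * (gen p q k * gen p q l)
      = gen p q i * (gen p q j * gen p q k) * gen p q l by noncomm_ring, gen_swap p q j k]
    simp [mul_sub, sub_mul, mul_assoc]
  have t2 : gen p q i * gen p q k * (gen p q j * gen p q l)
      = (if i = k then (2 : ℝ) else 0) • (gen p q j * gen p q l)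
        - (sgn p q i * sgn p q k) • (gen p q k * gen p q i * (gen p q j * gen p q l)) := by
    rw [gen_swap p q i k]
    simp [sub_mul]
  have t3 : gen p q k * gen p q i * (gen p q j * gen p q l)
      = (if j = l then (2 : ℝ) else 0) • (gen p q k * gen p q i)
        - (sgn p q j * sgn p q l) • (gen p q k * (gen p q i * gen p q l) * gen p q j) := by
    rw [gen_swap p q j l]
    simp [mul_sub, mul_assoc]
  have t4 : gen p q k * (gen p q i * gen p q l) * gen p q j
      = (if i = l then (2 : ℝ) else 0) • (gen p q k * gen p q j)
        - (sgn p q i * sgn p q l) • (gen p q k * gen p q l * (gen p q i * gen p q j)) := by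
    rw [gen_swap p q i l]
    simp [mul_sub, sub_mul, mul_assoc]
  have hi := sgn_sq p q i
  have hj := sgn_sq p q j
  have hk := sgn_sq p q k
  have hl := sgn_sq p q l
  have c2 : sgn p q j * sgn p q k * (if i = k then (2 : ℝ) else 0)
      = sgn p q i * sgn p q j * (if i = k then (2 : ℝ) else 0) := by
    split_ifs with h
    · rw [h]; ring
    · simp
  have c3 : sgn p q j * sgn p q k * (sgn p q i * sgn p q k) = sgn p q i * sgn p q j := by
    linear_combination (sgn p q i * sgn p q j) * hk
  have c4 : sgn p q j * sgn p q k * (sgn p q i * sgn p q k) * (sgn p q j * sgn p q l)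
      * (if i = l then (2 : ℝ) else 0) = (if i = l then (2 : ℝ) else 0) := by
    rw [c3]
    split_ifs with h
    · rw [h]; linear_combination (2 * sgn p q l * sgn p q l) * hj + 2 * hl
    · simp
  have c5 : sgn p q j * sgn p q k * (sgn p q i * sgn p q k) * (sgn p q j * sgn p q l)
      * (sgn p q i * sgn p q l) = 1 := by
    rw [c3]
    linear_combination (sgn p q i * sgn p q i * sgn p q l * sgn p q l) * hj
      + (sgn p q l * sgn p q l) * hi + hl
  rw [t1, t2, t3, t4]
  have c3' : sgn p q j * sgn p q k * (sgn p q i * sgn p q k) * (if j = l then (2 : ℝ) else 0)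
      = sgn p q i * sgn p q j * (if j = l then (2 : ℝ) else 0) := by rw [c3]
  rw [← c2, ← c3', ← c4]
  have c5' : gen p q k * gen p q l * (gen p q i * gen p q j)
      = (sgn p q j * sgn p q k * (sgn p q i * sgn p q k) * (sgn p q j * sgn p q l)
      * (sgn p q i * sgn p q l)) • (gen p q k * gen p q l * (gen p q i * gen p q j)) := by
    rw [c5, one_smul]
  rw [sub_eq_iff_eq_add]
  conv_rhs => rw [c5']
  rw [c4]
  conv_rhs => rw [← c4]
  module

theorem spinElt_bracket_gen (p q : ℕ) (A : soPQ p q) (k l : Fin p ⊕ Fin q) :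
    spinElt p q A.1 * (gen p q k * gen p q l) - gen p q k * gen p q l * spinElt p q A.1
      = ∑ i, A.1 i k • (gen p q i * gen p q l) - ∑ i, A.1 l i • (gen p q k * gen p q i) := by
  have h1 : spinElt p q A.1 * (gen p q k * gen p q l)
        - gen p q k * gen p q l * spinElt p q A.1
      = (1 / 4 : ℝ) • ∑ i, ∑ j, A.1 i j • (gen p q i * gen p q j * (gen p q k * gen p q l)
        - gen p q k * gen p q l * (gen p q i * gen p q j)) := by
    simp only [spinElt, smul_mul_assoc, mul_smul_comm, Finset.sum_mul, Finset.mul_sum, smul_sub,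
      Finset.sum_sub_distrib]
  have e1 : ∀ i j (x : ℝ), A.1 i j * (sgn p q i * sgn p q j * x) = - A.1 j i * x :=
    fun i j x => by rw [← soPQ_entry p q A i j]; ring
  rw [h1]
  simp only [quad_bracket]
  simp only [smul_sub, smul_add, smul_smul, e1, Finset.sum_sub_distrib, Finset.sum_add_distrib]
  simp only [mul_ite, mul_zero, ite_smul, zero_smul, Finset.sum_ite_eq',
    Finset.mem_univ, if_true]
  rw [Finset.sum_comm (f := fun i j => if i = k then _ else _),
    Finset.sum_comm (f := fun i j => if i = l then _ else _)]
  simp only [Finset.sum_ite_eq', Finset.mem_univ, if_true]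
  simp only [← Finset.sum_sub_distrib, ← Finset.sum_add_distrib, Finset.smul_sum]
  refine Finset.sum_congr rfl fun i _ => ?_
  module

theorem spinElt_lie (p q : ℕ) (A B : soPQ p q) :
    spinElt p q ⁅A.1, B.1⁆ = ⁅spinElt p q A.1, spinElt p q B.1⁆ := by
  have h1 : ⁅spinElt p q A.1, spinElt p q B.1⁆
      = (1 / 4 : ℝ) • ∑ k, ∑ l, B.1 k l •
        (spinElt p q A.1 * (gen p q k * gen p q l) - gen p q k * gen p q l * spinElt p q A.1) := by
    rw [LieRing.of_associative_ring_bracket]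
    conv_lhs => rw [spinElt.eq_1 p q B.1]
    simp only [smul_mul_assoc, mul_smul_comm, Finset.sum_mul, Finset.mul_sum, smul_sub,
      Finset.sum_sub_distrib]
  rw [h1]
  simp only [spinElt_bracket_gen]
  rw [spinElt, LieRing.of_associative_ring_bracket]
  congr 1
  simp only [Matrix.sub_apply, Matrix.mul_apply, sub_smul, smul_sub, Finset.sum_sub_distrib,
    Finset.sum_smul, Finset.smul_sum, smul_smul]
  congr 1
  · calc _ = ∑ i, ∑ k, ∑ l, (A.1 i k * B.1 k l) • (gen p q i * gen p q l) :=
          Finset.sum_congr rfl fun i _ => Finset.sum_comm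
      _ = ∑ k, ∑ i, ∑ l, (A.1 i k * B.1 k l) • (gen p q i * gen p q l) := Finset.sum_comm
      _ = _ := Finset.sum_congr rfl fun k _ => by
          rw [Finset.sum_comm]
          refine Finset.sum_congr rfl fun l _ => Finset.sum_congr rfl fun i _ => ?_
          rw [mul_comm]
  · exact Finset.sum_congr rfl fun k _ => Finset.sum_comm

/-- The embedding of `𝔰𝔬(p,q)` onto the Lie subalgebra `𝔨_{p,q} = ⟨e_i e_j (i < j)⟩` of the even
algebra, `A ↦ ¼ ∑_{i,j} A_{ij} e_i e_j`. It is the inverse of the isomorphism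
`𝔨_{p,q} → 𝔰𝔬(p,q)`, `e_i e_j ↦ 2 E_{ij} - 2 ε_i ε_j E_{ji}`. -/
def spin (p q : ℕ) : soPQ p q →ₗ⁅ℝ⁆ REven p q where
  toFun A := ⟨spinElt p q A.1, spinElt_mem p q A.1⟩
  map_add' A B := Subtype.ext <| by
    simp [spinElt, add_smul, Finset.sum_add_distrib]
  map_smul' c A := Subtype.ext <| by
    simp [spinElt, smul_smul, Finset.smul_sum, mul_left_comm]
  map_lie' {A B} := Subtype.ext <| spinElt_lie p q A B

/-! ### Representations of `R_{p,q}` and the Lie algebra `𝔤'_{p,q}(ρ)` -/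

/-- A representation of `R_{p,q}` on `W = ℝ^m` whose basis matrices `S_i = ρ(e_i)` are
symmetric. -/
structure SymRep (p q m : ℕ) where
  /-- the underlying algebra homomorphism -/
  toAlgHom : R p q →ₐ[ℝ] Matrix (Fin m) (Fin m) ℝ
  symm : ∀ i, (toAlgHom (gen p q i)).IsSymm

namespace SymRep

variable {p q m : ℕ} (ρ : SymRep p q m)

/-- The basis matrices `S_i = ρ(e_i)`. -/
def S (i : Fin p ⊕ Fin q) : Matrix (Fin m) (Fin m) ℝ := ρ.toAlgHom (gen p q i)

/-- `𝔥_{p,q}(ρ) = {X ∈ 𝔤𝔩(W) | ᵗX S_i + S_i X = 0 for all i}`. -/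
def h : LieSubalgebra ℝ (Matrix (Fin m) (Fin m) ℝ) where
  carrier := {X | ∀ i, Xᵀ * ρ.S i + ρ.S i * X = 0}
  zero_mem' i := by simp
  add_mem' {X Y} hX hY i := by
    have e : (X + Y)ᵀ * ρ.S i + ρ.S i * (X + Y)
        = (Xᵀ * ρ.S i + ρ.S i * X) + (Yᵀ * ρ.S i + ρ.S i * Y) := by
      rw [Matrix.transpose_add]; noncomm_ring
    rw [e, hX i, hY i, add_zero]
  smul_mem' c X hX i := by
    have e : (c • X)ᵀ * ρ.S i + ρ.S i * (c • X) = c • (Xᵀ * ρ.S i + ρ.S i * X) := by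
      simp [Matrix.transpose_smul]
    rw [e, hX i, smul_zero]
  lie_mem' {X Y} hX hY i := by
    have h1 : Xᵀ * ρ.S i = -(ρ.S i * X) := eq_neg_of_add_eq_zero_left (hX i)
    have h2 : Yᵀ * ρ.S i = -(ρ.S i * Y) := eq_neg_of_add_eq_zero_left (hY i)
    rw [LieRing.of_associative_ring_bracket, Matrix.transpose_sub, Matrix.transpose_mul,
      Matrix.transpose_mul, sub_mul, mul_assoc, mul_assoc, h1, h2, mul_neg, mul_neg, ← mul_assoc,
      ← mul_assoc, h1, h2]
    noncomm_ring

/-- Elements of `𝔥_{p,q}(ρ)` commute with the image of `𝔰𝔬(p,q)`. -/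
theorem commute_spin (A : soPQ p q) (X : ρ.h) : Commute (ρ.toAlgHom (spin p q A)) X.1 := by
  have key : ∀ i, X.1ᵀ * ρ.S i = -(ρ.S i * X.1) := fun i =>
    eq_neg_of_add_eq_zero_left (X.2 i)
  have sq : ∀ i, ρ.S i * ρ.S i = 1 := fun i => by
    rw [S, ← map_mul, gen_sq, map_one]
  have key2 : ∀ i, ρ.S i * X.1ᵀ = -(X.1 * ρ.S i) := fun i => by
    have h1 := congrArg (fun M => ρ.S i * M * ρ.S i) (key i)
    simp only [mul_neg, neg_mul] at h1
    rw [← mul_assoc (ρ.S i) (ρ.S i), sq, one_mul, mul_assoc, mul_assoc, sq, mul_one] at h1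
    exact h1
  have hij : ∀ i j, Commute (ρ.S i * ρ.S j) X.1 := fun i j => by
    rw [Commute, SemiconjBy, mul_assoc, eq_neg_of_add_eq_zero_right (X.2 j), mul_neg, ← mul_assoc,
      key2, neg_mul, neg_neg, mul_assoc]
  change Commute (ρ.toAlgHom (spinElt p q A.1)) X.1
  rw [spinElt, map_smul, map_sum]
  refine Commute.smul_left (Commute.sum_left _ _ _ fun i _ => ?_) _
  rw [map_sum]
  refine Commute.sum_left _ _ _ fun j _ => ?_
  rw [map_smul, map_mul]
  exact (hij i j).smul_left _

/-- `𝔤'_{p,q}(ρ) = 𝔰𝔬(p,q) ⊕ 𝔥_{p,q}(ρ)`. -/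
abbrev gPrime : Type := soPQ p q × ρ.h

/-- The action of `𝔤'_{p,q}(ρ)` on `W`: `𝔰𝔬(p,q) ≅ 𝔨_{p,q}` acts through `ρ`, and `𝔥_{p,q}(ρ)`
acts as a subalgebra of `𝔤𝔩(W)`. -/
def action : ρ.gPrime →ₗ⁅ℝ⁆ Matrix (Fin m) (Fin m) ℝ where
  toFun x := ρ.toAlgHom (spin p q x.1) + x.2.1
  map_add' x y := by
    have e : (x.2 + y.2).1 = x.2.1 + y.2.1 := rfl
    simp only [Prod.fst_add, Prod.snd_add, map_add, Subalgebra.coe_add, e]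
    abel
  map_smul' c x := by
    simp
  map_lie' {x y} := by
    have h1 := (ρ.commute_spin x.1 y.2).eq
    have h2 := (ρ.commute_spin y.1 x.2).eq
    have h3 : ρ.toAlgHom (spin p q ⁅x.1, y.1⁆)
        = ⁅ρ.toAlgHom (spin p q x.1), ρ.toAlgHom (spin p q y.1)⁆ := by
      rw [LieHom.map_lie, LieRing.of_associative_ring_bracket, LieRing.of_associative_ring_bracket]
      simp
    change ρ.toAlgHom (spin p q ⁅x.1, y.1⁆) + ⁅x.2.1, y.2.1⁆ = _
    rw [h3, add_lie, lie_add, lie_add]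
    have h4 : ⁅ρ.toAlgHom (spin p q x.1), y.2.1⁆ = 0 := by
      rw [LieRing.of_associative_ring_bracket, h1, sub_self]
    have h5 : ⁅x.2.1, ρ.toAlgHom (spin p q y.1)⁆ = 0 := by
      rw [LieRing.of_associative_ring_bracket, h2, sub_self]
    rw [h4, h5, add_zero, zero_add]

/-- `𝔤'_{p,q}(ρ)` acts on `W` as the representation `π` of `𝔰𝔬(p,q) ⊕ 𝔰`: there are an isomorphism
`θ : 𝔥_{p,q}(ρ) ≅ 𝔰` of Lie algebras and a linear isomorphism `Φ` of `W` onto the space of `π` that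
is equivariant with respect to `id ⊕ θ`. -/
def ActsAs {𝔰 : Type*} [LieRing 𝔰] [LieAlgebra ℝ 𝔰] {U : Type*} [AddCommGroup U] [Module ℝ U]
    (π : soPQ p q × 𝔰 →ₗ⁅ℝ⁆ Module.End ℝ U) : Prop :=
  ∃ (θ : ρ.h ≃ₗ⁅ℝ⁆ 𝔰) (Φ : (Fin m → ℝ) ≃ₗ[ℝ] U),
    ∀ (A : soPQ p q) (X : ρ.h) (w : Fin m → ℝ),
      Φ (ρ.action (A, X) *ᵥ w) = π (A, θ X) (Φ w)

/-- If `E` identifies `R_{p,q}` with a direct sum of `d` copies of `M(ℓ; 𝕂)`, so that the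
irreducible representations of `R_{p,q}` are `ρ_i : R_{p,q} → M(ℓ; 𝕂)`, `i = 1, …, d`, acting on
`𝕂^ℓ`, this says that `ρ_i` has multiplicity `k_i` in `ρ`: `W` is isomorphic to the direct sum of
`k_i` copies of `𝕂^ℓ` with the action `ρ_i` (written as the columns of an `ℓ × k_i` matrix). -/
def HasMultiplicities {𝕂 : Type*} [Ring 𝕂] [Algebra ℝ 𝕂] {d ℓ : ℕ}
    (E : R p q ≃ₐ[ℝ] (Fin d → Matrix (Fin ℓ) (Fin ℓ) 𝕂)) (k : Fin d → ℕ) : Prop :=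
  ∃ Ψ : (Fin m → ℝ) ≃ₗ[ℝ] ((i : Fin d) → Matrix (Fin ℓ) (Fin (k i)) 𝕂),
    ∀ (a : R p q) (w : Fin m → ℝ) (i : Fin d), Ψ (ρ.toAlgHom a *ᵥ w) i = E a i * Ψ w i

end SymRep

/-! ### (Half-)spin representations -/

/-- If `E'` identifies the even algebra with a direct sum of `d'` copies of `M(r; 𝕂')`, this is the
representation of `𝔰𝔬(p,q)` on `𝕂'^r` induced by the `i`-th irreducible representation of the even
algebra: the spin representation `Λ` if `d' = 1`, the half-spin representations `Λ_e` (`i = 0`) and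
`Λ_o` (`i = 1`) if `d' = 2`. -/
def spinRep {p q : ℕ} {𝕂' : Type*} [Ring 𝕂'] [Algebra ℝ 𝕂'] {d' r : ℕ}
    (E' : REven p q ≃ₐ[ℝ] (Fin d' → Matrix (Fin r) (Fin r) 𝕂')) (i : Fin d') :
    soPQ p q →ₗ⁅ℝ⁆ Matrix (Fin r) (Fin r) 𝕂' :=
  (((Pi.evalAlgHom ℝ (fun _ : Fin d' => Matrix (Fin r) (Fin r) 𝕂') i).comp
    (E' : REven p q →ₐ[ℝ] (Fin d' → Matrix (Fin r) (Fin r) 𝕂'))).toLieHom).comp (spin p q)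

/-- The restriction to the even algebra of the `i`-th irreducible representation of `R_{p,q}` is
isomorphic, as a real representation, to `c` copies of the `j`-th irreducible representation of the
even algebra. -/
def RestrictsTo {p q : ℕ} {𝕂 𝕂' : Type*} [Ring 𝕂] [Algebra ℝ 𝕂] [Ring 𝕂'] [Algebra ℝ 𝕂']
    {d ℓ d' r : ℕ} (E : R p q ≃ₐ[ℝ] (Fin d → Matrix (Fin ℓ) (Fin ℓ) 𝕂))
    (E' : REven p q ≃ₐ[ℝ] (Fin d' → Matrix (Fin r) (Fin r) 𝕂'))
    (i : Fin d) (c : ℕ) (j : Fin d') : Prop :=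
  ∃ Ψ : (Fin ℓ → 𝕂) ≃ₗ[ℝ] Matrix (Fin r) (Fin c) 𝕂',
    ∀ (a : REven p q) (v : Fin ℓ → 𝕂), Ψ (E a i *ᵥ v) = E' a j * Ψ v

instance : StarModule ℝ ℍ[ℝ] where
  star_smul c x := by ext <;> simp

/-! ### Tensor products, sums and duals of representations -/

section Reps

variable {L L₁ L₂ : Type*} [LieRing L] [LieAlgebra ℝ L] [LieRing L₁] [LieAlgebra ℝ L₁]
  [LieRing L₂] [LieAlgebra ℝ L₂] {n k : Type*} [Fintype n] [Fintype k] [DecidableEq n]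
  [DecidableEq k]

/-- The tensor product over a field `𝕂` of a representation `a` of `L₁` on `𝕂^n` and a
representation `b` of `L₂` on `𝕂^k`, a representation of `L₁ ⊕ L₂` on
`𝕂^n ⊗ 𝕂^k = M(n, k; 𝕂)` (`u ⊗ v = u ᵗv`): `(x, y) · w = a(x) w + w ᵗb(y)`. -/
def tensor {𝕂 : Type*} [Field 𝕂] [Algebra ℝ 𝕂] (a : L₁ →ₗ⁅ℝ⁆ Matrix n n 𝕂)
    (b : L₂ →ₗ⁅ℝ⁆ Matrix k k 𝕂) : L₁ × L₂ →ₗ⁅ℝ⁆ Module.End ℝ (Matrix n k 𝕂) where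
  toFun x :=
    { toFun := fun w => a x.1 * w + w * (b x.2)ᵀ
      map_add' := fun v w => by rw [Matrix.mul_add, Matrix.add_mul]; abel
      map_smul' := fun c w => by simp }
  map_add' x y := by
    ext1 w
    simp only [Prod.fst_add, Prod.snd_add, map_add, Matrix.transpose_add, Matrix.add_mul,
      Matrix.mul_add, LinearMap.coe_mk, AddHom.coe_mk, LinearMap.add_apply]
    abel
  map_smul' c x := by
    ext1 w
    simp
  map_lie' {x y} := by
    ext1 w
    rw [LieRing.of_associative_ring_bracket]
    simp only [LieAlgebra.Prod.bracket_apply, LieHom.map_lie, LieRing.of_associative_ring_bracket,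
      Matrix.transpose_sub, Matrix.transpose_mul, Matrix.sub_mul, Matrix.mul_sub, Matrix.mul_add,
      Matrix.add_mul, LinearMap.coe_mk, AddHom.coe_mk, LinearMap.sub_apply, Module.End.mul_apply,
      Matrix.mul_assoc]
    abel

/-- The tensor product over `ℍ` of a representation `a` of `L₁` on the right `ℍ`-space `ℍ^n` and a
representation `b` of `L₂` on the right `ℍ`-space `ℍ^k`, the latter made a left `ℍ`-space by
`λ v := v λ̄`; it is the representation of `L₁ ⊕ L₂` on `ℍ^n ⊗_ℍ ℍ^k = M(n, k; ℍ)`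
(`u ⊗ v = u ᵗv̄`) given by `(x, y) · w = a(x) w + w b(y)^*` with `b(y)^*` the conjugate transpose. -/
def tensorH (a : L₁ →ₗ⁅ℝ⁆ Matrix n n ℍ[ℝ]) (b : L₂ →ₗ⁅ℝ⁆ Matrix k k ℍ[ℝ]) :
    L₁ × L₂ →ₗ⁅ℝ⁆ Module.End ℝ (Matrix n k ℍ[ℝ]) where
  toFun x :=
    { toFun := fun w => a x.1 * w + w * (b x.2)ᴴ
      map_add' := fun v w => by rw [Matrix.mul_add, Matrix.add_mul]; abel
      map_smul' := fun c w => by simp }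
  map_add' x y := by
    ext1 w
    simp only [Prod.fst_add, Prod.snd_add, map_add, Matrix.conjTranspose_add, Matrix.add_mul,
      Matrix.mul_add, LinearMap.coe_mk, AddHom.coe_mk, LinearMap.add_apply]
    abel
  map_smul' c x := by
    ext1 w
    simp [Matrix.conjTranspose_smul, smul_add]
  map_lie' {x y} := by
    ext1 w
    rw [LieRing.of_associative_ring_bracket]
    simp only [LieAlgebra.Prod.bracket_apply, LieHom.map_lie, LieRing.of_associative_ring_bracket,
      Matrix.conjTranspose_sub, Matrix.conjTranspose_mul, Matrix.sub_mul, Matrix.mul_sub,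
      Matrix.mul_add, Matrix.add_mul, LinearMap.coe_mk, AddHom.coe_mk, LinearMap.sub_apply,
      Module.End.mul_apply, Matrix.mul_assoc]
    abel

/-- The direct sum of two representations of the same Lie algebra. -/
def dsum {U V : Type*} [AddCommGroup U] [Module ℝ U] [AddCommGroup V] [Module ℝ V]
    (π₁ : L →ₗ⁅ℝ⁆ Module.End ℝ U) (π₂ : L →ₗ⁅ℝ⁆ Module.End ℝ V) :
    L →ₗ⁅ℝ⁆ Module.End ℝ (U × V) where
  toFun x := (π₁ x).prodMap (π₂ x)
  map_add' x y := by ext <;> simp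
  map_smul' c x := by ext <;> simp
  map_lie' {x y} := by
    rw [LieHom.map_lie, LieHom.map_lie]
    ext <;> simp [LieRing.of_associative_ring_bracket]

/-- The dual `Λ_1^*` of the standard representation of `𝔤𝔩(k, 𝕂)` (`𝕂 = ℝ` or `ℍ`) on `𝕂^k`:
`X ↦ -X^*`, where `X^*` is the (conjugate) transpose. -/
def dualStd (k : ℕ) (𝕂 : Type*) [Ring 𝕂] [StarRing 𝕂] [Algebra ℝ 𝕂] [StarModule ℝ 𝕂] :
    Matrix (Fin k) (Fin k) 𝕂 →ₗ⁅ℝ⁆ Matrix (Fin k) (Fin k) 𝕂 where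
  toFun X := -Xᴴ
  map_add' X Y := by rw [Matrix.conjTranspose_add, neg_add]
  map_smul' c X := by simp [Matrix.conjTranspose_smul]
  map_lie' {X Y} := by
    simp only [LieRing.of_associative_ring_bracket, Matrix.conjTranspose_sub,
      Matrix.conjTranspose_mul]
    noncomm_ring

end Reps

/-! ### The classical real Lie algebras -/

/-- `{X | ᵗX G + G X = 0}` as a real Lie algebra of complex matrices. -/
def bilinearLie {n : Type*} [Fintype n] [DecidableEq n] (G : Matrix n n ℂ) :
    LieSubalgebra ℝ (Matrix n n ℂ) where
  carrier := {X | Xᵀ * G + G * X = 0}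
  zero_mem' := by simp
  add_mem' {X Y} hX hY := by
    have e : (X + Y)ᵀ * G + G * (X + Y) = (Xᵀ * G + G * X) + (Yᵀ * G + G * Y) := by
      rw [Matrix.transpose_add]; noncomm_ring
    exact e.trans (by rw [hX, hY, add_zero])
  smul_mem' c X hX := by
    have e : (c • X)ᵀ * G + G * (c • X) = c • (Xᵀ * G + G * X) := by
      simp [Matrix.transpose_smul]
    exact e.trans (by rw [hX, smul_zero])
  lie_mem' {X Y} hX hY := by
    have h1 : Xᵀ * G = -(G * X) := eq_neg_of_add_eq_zero_left hX
    have h2 : Yᵀ * G = -(G * Y) := eq_neg_of_add_eq_zero_left hY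
    change ⁅X, Y⁆ᵀ * G + G * ⁅X, Y⁆ = 0
    rw [LieRing.of_associative_ring_bracket, Matrix.transpose_sub, Matrix.transpose_mul,
      Matrix.transpose_mul, sub_mul, mul_assoc, mul_assoc, h1, h2, mul_neg, mul_neg, ← mul_assoc,
      ← mul_assoc, h1, h2]
    noncomm_ring

/-- `{X | X^* G + G X = 0}` with `X^*` the conjugate transpose, as a real Lie algebra. -/
def sesquilinearLie {n : Type*} [Fintype n] [DecidableEq n] {𝕂 : Type*} [Ring 𝕂] [StarRing 𝕂]
    [Algebra ℝ 𝕂] [StarModule ℝ 𝕂] (G : Matrix n n 𝕂) : LieSubalgebra ℝ (Matrix n n 𝕂) where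
  carrier := {X | Xᴴ * G + G * X = 0}
  zero_mem' := by simp
  add_mem' {X Y} hX hY := by
    have e : (X + Y)ᴴ * G + G * (X + Y) = (Xᴴ * G + G * X) + (Yᴴ * G + G * Y) := by
      rw [Matrix.conjTranspose_add]; noncomm_ring
    exact e.trans (by rw [hX, hY, add_zero])
  smul_mem' c X hX := by
    have e : (c • X)ᴴ * G + G * (c • X) = c • (Xᴴ * G + G * X) := by
      simp [Matrix.conjTranspose_smul]
    exact e.trans (by rw [hX, smul_zero])
  lie_mem' {X Y} hX hY := by
    have h1 : Xᴴ * G = -(G * X) := eq_neg_of_add_eq_zero_left hX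
    have h2 : Yᴴ * G = -(G * Y) := eq_neg_of_add_eq_zero_left hY
    change ⁅X, Y⁆ᴴ * G + G * ⁅X, Y⁆ = 0
    rw [LieRing.of_associative_ring_bracket, Matrix.conjTranspose_sub, Matrix.conjTranspose_mul,
      Matrix.conjTranspose_mul, sub_mul, mul_assoc, mul_assoc, h1, h2, mul_neg, mul_neg,
      ← mul_assoc, ← mul_assoc, h1, h2]
    noncomm_ring

/-- `1_{k₁,k₂} = diag(1, …, 1, -1, …, -1)`. -/
def diagPM (k₁ k₂ : ℕ) (𝕂 : Type*) [Ring 𝕂] : Matrix (Fin k₁ ⊕ Fin k₂) (Fin k₁ ⊕ Fin k₂) 𝕂 :=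
  Matrix.diagonal (Sum.elim (fun _ => 1) (fun _ => -1))

/-- `𝔰𝔭(k, ℝ) ⊂ 𝔤𝔩(2k, ℝ)`. -/
abbrev spR (k : ℕ) : LieSubalgebra ℝ (Matrix (Fin k ⊕ Fin k) (Fin k ⊕ Fin k) ℝ) :=
  LieAlgebra.Symplectic.sp (Fin k) ℝ

/-- `𝔰𝔬(k, ℂ) ⊂ 𝔤𝔩(k, ℂ)`, as a real Lie algebra. -/
def soC (k : ℕ) : LieSubalgebra ℝ (Matrix (Fin k) (Fin k) ℂ) := bilinearLie 1

/-- `𝔰𝔭(k, ℂ) ⊂ 𝔤𝔩(2k, ℂ)`, as a real Lie algebra. -/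
def spC (k : ℕ) : LieSubalgebra ℝ (Matrix (Fin k ⊕ Fin k) (Fin k ⊕ Fin k) ℂ) :=
  bilinearLie (Matrix.J (Fin k) ℂ)

/-- `𝔲(k₁, k₂) ⊂ 𝔤𝔩(k₁ + k₂, ℂ)`. -/
def uPQ (k₁ k₂ : ℕ) : LieSubalgebra ℝ (Matrix (Fin k₁ ⊕ Fin k₂) (Fin k₁ ⊕ Fin k₂) ℂ) :=
  sesquilinearLie (diagPM k₁ k₂ ℂ)

/-- `𝔰𝔭(k₁, k₂) ⊂ 𝔤𝔩(k₁ + k₂, ℍ)`. -/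
def spPQ (k₁ k₂ : ℕ) : LieSubalgebra ℝ (Matrix (Fin k₁ ⊕ Fin k₂) (Fin k₁ ⊕ Fin k₂) ℍ[ℝ]) :=
  sesquilinearLie (diagPM k₁ k₂ ℍ[ℝ])

/-- `𝔰𝔬^*(2k) ⊂ 𝔤𝔩(k, ℍ)`: the matrices with `X^* j + j X = 0`. Writing `X = Z₁ + Z₂ j` with complex
`Z₁, Z₂`, the condition says that `Z₁` is skew-symmetric and `Z₂` Hermitian. -/
def soStar (k : ℕ) : LieSubalgebra ℝ (Matrix (Fin k) (Fin k) ℍ[ℝ]) :=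
  sesquilinearLie (Matrix.diagonal fun _ => (⟨0, 0, 1, 0⟩ : ℍ[ℝ]))

/-- The standard representation `Λ_1` of a Lie algebra of matrices. -/
abbrev std {n : Type*} [Fintype n] [DecidableEq n] {𝕂 : Type*} [Ring 𝕂] [Algebra ℝ 𝕂]
    (𝔰 : LieSubalgebra ℝ (Matrix n n 𝕂)) : 𝔰 →ₗ⁅ℝ⁆ Matrix n n 𝕂 := 𝔰.incl

end CliffordQuartic

end

open CliffordQuartic

noncomputable section

namespace CliffordQuartic

set_option linter.unusedSectionVars false

/-! ### Algebras generated by families that commute up to scalars -/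

section Span

variable {B : Type*} [Ring B] [Algebra ℝ B]

/-! Everything is read off from the even algebra R⁺ and one odd element y.

Fix a generator, say e_1 of the first kind. The products e_1 e_j generate R⁺ and anticommute, with
square 1 for j of the second kind and -1 for j of the first, so R⁺ is the Clifford algebra of
signature (q, p - 1). The anti-involution `rev` that fixes the e_i multiplies e_1 e_j by the sign of
its square. Hence a matrix model in which generators of square 1 are Hermitian and generators of
square -1 are skew-Hermitian turns `rev` into the conjugate transpose. Such models exist in all
signatures, by Cl(s+1, t+1) = M(2; Cl(s, t)), Cl(s+4, t) = Cl(s, t+4) and eight base cases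
(`HasCliffordModel.of_base`).

Next, R = R⁺ + R⁺ y for an odd y with y² = σ = ±1, and an isomorphism of R⁺ extends to R as soon as
an image of y is found (`IsRSystem.exists_equiv_of_even`). If p or q is odd, y is the product of the
generators of that kind. It is central, with σ = 1 for an odd number ≡ 1 mod 4 and σ = -1 for one ≡
3, so R is R⁺ doubled, or R⁺ with a central square root of -1 adjoined. If p and q are even, y is a
generator or a product of three. Conjugation by y interchanges the two summands of R⁺ when n ≡ 0 mod
4, and is complex conjugation when n ≡ 2 mod 4.

Finally, W is realised by matrices over 𝕂' with r rows, or by pairs of such, with the form Re tr(u^*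
v). R⁺ acts by left multiplication, and y by u ↦ φ(u) c or by interchanging the pair. A positive
square root makes the identification isometric (`SymRep.exists_isometry`). The elements of 𝔥 are
then the operators that commute with R⁺ and are skew for the form B(u, y v)
(`SymRep.actsAs_of_model`). The commutant of R⁺ consists of right multiplications by matrices b, and
skewness reads c b^* + φ(b) c = 0, the equation of a classical Lie algebra. For an interchanged pair
the second matrix is -b^*, and 𝔤𝔩 results. -/

/-- The span of the ordered products of sublists of `l`. -/
def monomialSpan : List B → Submodule ℝ B
  | [] => Submodule.span ℝ {1}
  | x :: l => monomialSpan l ⊔ (monomialSpan l).map (LinearMap.mulLeft ℝ x)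

theorem one_mem_monomialSpan (l : List B) : (1 : B) ∈ monomialSpan l := by
  induction l with
  | nil => exact Submodule.mem_span_singleton_self _
  | cons x l ih => exact Submodule.mem_sup_left ih

/-- Each further generator at most doubles the span. -/
theorem monomialSpan_finite (l : List B) :
    Module.Finite ℝ (monomialSpan l) ∧ Module.finrank ℝ (monomialSpan l) ≤ 2 ^ l.length := by
  induction l with
  | nil =>
    refine ⟨inferInstanceAs (Module.Finite ℝ (Submodule.span ℝ {(1 : B)})), ?_⟩
    exact (finrank_span_le_card ({1} : Set B)).trans (by simp)
  | cons x l ih =>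
    obtain ⟨h1, h2⟩ := ih
    refine ⟨inferInstanceAs (Module.Finite ℝ
      (monomialSpan l ⊔ (monomialSpan l).map (LinearMap.mulLeft ℝ x) : Submodule ℝ B)), ?_⟩
    have h3 := Submodule.finrank_add_le_finrank_add_finrank (monomialSpan l)
      ((monomialSpan l).map (LinearMap.mulLeft ℝ x))
    have h4 := Submodule.finrank_map_le (LinearMap.mulLeft ℝ x) (monomialSpan l)
    rw [List.length_cons, pow_succ]
    change Module.finrank ℝ (monomialSpan l ⊔ (monomialSpan l).map (LinearMap.mulLeft ℝ x) :
      Submodule ℝ B) ≤ _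
    omega

/-- A generator can be moved to its place in an ordered product at the cost of a scalar, and is
absorbed there if it already occurs. -/
theorem mul_mem_monomialSpan (l : List B) (hsq : ∀ x ∈ l, ∃ c : ℝ, x * x = c • 1)
    (hc : l.Pairwise fun x y => ∃ c : ℝ, y * x = c • (x * y)) :
    ∀ y ∈ l, ∀ m ∈ monomialSpan l, y * m ∈ monomialSpan l := by
  induction l with
  | nil => simp
  | cons x l ih =>
    intro y hy m hm
    rw [List.pairwise_cons] at hc
    have ih' := ih (fun z hz => hsq z (List.mem_cons_of_mem _ hz)) hc.2
    obtain ⟨a, ha, b', hb', rfl⟩ := Submodule.mem_sup.1 hm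
    obtain ⟨b, hb, rfl⟩ := Submodule.mem_map.1 hb'
    rw [mul_add]
    rcases List.mem_cons.1 hy with rfl | hy
    · obtain ⟨c, hc'⟩ := hsq y List.mem_cons_self
      refine add_mem (Submodule.mem_sup_right (Submodule.mem_map_of_mem ha))
        (Submodule.mem_sup_left ?_)
      rw [LinearMap.mulLeft_apply, ← mul_assoc, hc', smul_mul_assoc, one_mul]
      exact Submodule.smul_mem _ _ hb
    · obtain ⟨c, hc'⟩ := hc.1 y hy
      refine add_mem (Submodule.mem_sup_left (ih' y hy a ha)) (Submodule.mem_sup_right ?_)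
      rw [LinearMap.mulLeft_apply, ← mul_assoc, hc', smul_mul_assoc, mul_assoc]
      exact Submodule.smul_mem _ _ (Submodule.mem_map_of_mem (ih' y hy b hb))

/-- An algebra generated by `N` elements that commute up to scalars and have scalar squares has
dimension at most `2 ^ N`. -/
theorem finite_of_adjoin_eq_top {ι : Type*} [Fintype ι] (f : ι → B)
    (hsq : ∀ i, ∃ c : ℝ, f i * f i = c • 1) (hc : ∀ i j, ∃ c : ℝ, f i * f j = c • (f j * f i))
    (hf : Algebra.adjoin ℝ (Set.range f) = ⊤) :
    Module.Finite ℝ B ∧ Module.finrank ℝ B ≤ 2 ^ Fintype.card ι := by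
  set l : List B := (Finset.univ : Finset ι).toList.map f with hl
  have hmem : ∀ x, x ∈ l ↔ x ∈ Set.range f := fun x => by simp [hl]
  have key := mul_mem_monomialSpan l
    (fun x hx => by obtain ⟨i, rfl⟩ := (hmem x).1 hx; exact hsq i)
    (List.pairwise_of_forall_mem_list fun x hx y hy => by
      obtain ⟨i, rfl⟩ := (hmem x).1 hx
      obtain ⟨j, rfl⟩ := (hmem y).1 hy
      exact hc j i)
  have htop : monomialSpan l = ⊤ := by
    rw [eq_top_iff]
    intro b _
    have hb : b ∈ Algebra.adjoin ℝ (Set.range f) := by rw [hf]; trivial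
    -- Stability under left multiplication is preserved by sums and products; applied to 1 it puts b
    -- itself into the span.
    suffices h : ∀ m ∈ monomialSpan l, b * m ∈ monomialSpan l by
      simpa using h 1 (one_mem_monomialSpan l)
    induction hb using Algebra.adjoin_induction with
    | mem x hx => exact key x ((hmem x).2 hx)
    | algebraMap r =>
      intro m hm
      rw [← Algebra.smul_def]
      exact Submodule.smul_mem _ _ hm
    | add x y _ _ hx hy =>
      intro m hm
      rw [add_mul]
      exact add_mem (hx trivial m hm) (hy trivial m hm)
    | mul x y _ _ hx hy =>
      intro m hm
      rw [mul_assoc]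
      exact hx trivial _ (hy trivial m hm)
  obtain ⟨h1, h2⟩ := monomialSpan_finite l
  rw [htop] at h1 h2
  rw [finrank_top, hl, List.length_map, Finset.length_toList, Finset.card_univ] at h2
  exact ⟨Module.finite_def.2 (Module.Finite.iff_fg.1 h1), h2⟩

end Span

/-! ### Clifford families -/

/-- A family of anticommuting elements with prescribed squares. -/
structure IsCliffordFamily {ι B : Type*} [Ring B] [Algebra ℝ B] (ε : ι → ℝ) (f : ι → B) :
    Prop where
  sq : ∀ i, f i * f i = ε i • (1 : B)
  anti : ∀ i j, i ≠ j → f i * f j = -(f j * f i)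

section Lift

variable {ι : Type*} [Fintype ι] [DecidableEq ι] {B : Type*} [Ring B] [Algebra ℝ B]
  {ε : ι → ℝ}

/-- Twice the square is a double sum of the symmetrised products f_i f_j + f_j f_i, whose
off-diagonal terms vanish. -/
theorem IsCliffordFamily.sum_sq {f : ι → B} (h : IsCliffordFamily ε f) (v : ι → ℝ) :
    (∑ i, v i • f i) * (∑ i, v i • f i) = (∑ i, ε i * (v i * v i)) • (1 : B) := by
  have h1 : (∑ i, v i • f i) * (∑ i, v i • f i) = ∑ i, ∑ j, (v i * v j) • (f i * f j) := by
    simp only [Finset.sum_mul, Finset.mul_sum, smul_mul_smul_comm]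
    exact Finset.sum_comm
  have h2 : (2 : ℝ) • ((∑ i, v i • f i) * (∑ i, v i • f i))
      = ∑ i, ∑ j, (v i * v j) • (f i * f j + f j * f i) := by
    rw [two_smul]
    conv_lhs => rw [h1]; arg 2; rw [Finset.sum_comm]
    rw [← Finset.sum_add_distrib]
    refine Finset.sum_congr rfl fun i _ => ?_
    rw [← Finset.sum_add_distrib]
    refine Finset.sum_congr rfl fun j _ => ?_
    rw [mul_comm (v j), smul_add]
  have h3 : ∀ i, ∑ j, (v i * v j) • (f i * f j + f j * f i) = (2 * (ε i * (v i * v i))) • (1 : B) := by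
    intro i
    rw [Finset.sum_eq_single i]
    · rw [h.sq, ← add_smul, smul_smul]
      congr 1; ring
    · intro j _ hj
      rw [h.anti i j hj.symm, neg_add_cancel, smul_zero]
    · simp
  rw [Finset.sum_congr rfl fun i _ => h3 i, ← Finset.sum_smul, ← Finset.mul_sum, mul_smul] at h2
  exact smul_right_injective B (two_ne_zero' ℝ) h2

/-- The algebra homomorphism from the Clifford algebra of a diagonal form defined by a Clifford
family. -/
def cliffLift (f : ι → B) (h : IsCliffordFamily ε f) :
    CliffordAlgebra (QuadraticMap.weightedSumSquares ℝ ε) →ₐ[ℝ] B :=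
  CliffordAlgebra.lift _ ⟨Fintype.linearCombination ℝ f, fun v => by
    rw [Fintype.linearCombination_apply, h.sum_sq, QuadraticMap.weightedSumSquares_apply,
      Algebra.algebraMap_eq_smul_one]
    simp⟩

theorem cliffLift_ι (f : ι → B) (h : IsCliffordFamily ε f) (i : ι) :
    cliffLift f h (CliffordAlgebra.ι _ (Pi.single i 1)) = f i := by
  rw [cliffLift, CliffordAlgebra.lift_ι_apply, Fintype.linearCombination_apply_single, one_smul]

variable (ε) in
theorem adjoin_ι_single : Algebra.adjoin ℝ (Set.range fun i : ι =>
    CliffordAlgebra.ι (QuadraticMap.weightedSumSquares ℝ ε) (Pi.single i 1)) = ⊤ := by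
  rw [eq_top_iff, ← CliffordAlgebra.adjoin_range_ι]
  refine Algebra.adjoin_le ?_
  rintro _ ⟨v, rfl⟩
  rw [← Finset.univ_sum_single v, map_sum]
  refine Subalgebra.sum_mem _ fun i _ => ?_
  rw [show Pi.single i (v i) = v i • (Pi.single i 1 : ι → ℝ) by
    rw [← Pi.single_smul, smul_eq_mul, mul_one], map_smul]
  exact Subalgebra.smul_mem _ (Algebra.subset_adjoin (Set.mem_range_self i)) _

variable (ε) in
theorem isCliffordFamily_ι : IsCliffordFamily ε fun i : ι =>
    CliffordAlgebra.ι (QuadraticMap.weightedSumSquares ℝ ε) (Pi.single i 1) where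
  sq i := by
    rw [CliffordAlgebra.ι_sq_scalar, QuadraticMap.weightedSumSquares_apply,
      Algebra.algebraMap_eq_smul_one]
    simp [Pi.single_apply]
  anti i j hij := by
    apply CliffordAlgebra.ι_mul_ι_comm_of_isOrtho
    rw [QuadraticMap.isOrtho_def]
    simp only [QuadraticMap.weightedSumSquares_apply, ← Finset.sum_add_distrib]
    refine Finset.sum_congr rfl fun k _ => ?_
    rcases eq_or_ne k i with rfl | hk
    · simp [hij]
    · simp [hk]

theorem IsCliffordFamily.finite {f : ι → B} (h : IsCliffordFamily ε f)
    (hf : Algebra.adjoin ℝ (Set.range f) = ⊤) :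
    Module.Finite ℝ B ∧ Module.finrank ℝ B ≤ 2 ^ Fintype.card ι := by
  refine finite_of_adjoin_eq_top f (fun i => ⟨_, h.sq i⟩) (fun i j => ?_) hf
  rcases eq_or_ne i j with rfl | hij
  · exact ⟨1, (one_smul _ _).symm⟩
  · exact ⟨-1, by rw [h.anti i j hij, neg_one_smul]⟩

/-- An algebra of full dimension generated by a Clifford family is the Clifford algebra. -/
theorem IsCliffordFamily.exists_equiv {D : Type*} [Ring D] [Algebra ℝ D] {F : ι → D}
    (hF : IsCliffordFamily ε F) (hgen : Algebra.adjoin ℝ (Set.range F) = ⊤)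
    (hdim : 2 ^ Fintype.card ι ≤ Module.finrank ℝ D) :
    ∃ e : CliffordAlgebra (QuadraticMap.weightedSumSquares ℝ ε) ≃ₐ[ℝ] D,
      ∀ i, e (CliffordAlgebra.ι _ (Pi.single i 1)) = F i := by
  have hs : Function.Surjective (cliffLift F hF) := by
    rw [← AlgHom.range_eq_top, eq_top_iff, ← hgen]
    refine Algebra.adjoin_le ?_
    rintro _ ⟨i, rfl⟩
    exact ⟨_, cliffLift_ι F hF i⟩
  -- Generation bounds the dimension of the Clifford algebra by that of D, so the surjection is
  -- bijective.
  obtain ⟨h1, h2⟩ := (isCliffordFamily_ι ε).finite (adjoin_ι_single ε)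
  have : Module.Finite ℝ D := Module.Finite.of_surjective (cliffLift F hF).toLinearMap hs
  have h3 := LinearMap.finrank_le_finrank_of_surjective (f := (cliffLift F hF).toLinearMap) hs
  have hi : Function.Injective (cliffLift F hF).toLinearMap :=
    (LinearMap.injective_iff_surjective_of_finrank_eq_finrank (by omega)).2 hs
  exact ⟨AlgEquiv.ofBijective (cliffLift F hF) ⟨hi, hs⟩, fun i => cliffLift_ι F hF i⟩

/-- A model of full dimension inherits the universal property of the Clifford algebra. -/
theorem IsCliffordFamily.exists_hom {D : Type*} [Ring D] [Algebra ℝ D] {F : ι → D}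
    (hF : IsCliffordFamily ε F) (hgen : Algebra.adjoin ℝ (Set.range F) = ⊤)
    (hdim : 2 ^ Fintype.card ι ≤ Module.finrank ℝ D) {g : ι → B} (hg : IsCliffordFamily ε g) :
    ∃ φ : D →ₐ[ℝ] B, ∀ i, φ (F i) = g i := by
  obtain ⟨e, he⟩ := hF.exists_equiv hgen hdim
  refine ⟨(cliffLift g hg).comp (e.symm : D →ₐ[ℝ] _), fun i => ?_⟩
  rw [AlgHom.comp_apply, ← he i]
  simp [cliffLift_ι]

end Lift

/-! ### Homomorphisms out of `R_{p,q}` -/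

section LiftR

variable {p q : ℕ} {D : Type*} [Ring D] [Algebra ℝ D]

theorem commute_of_adjoin {B C : Type*} [Ring B] [Algebra ℝ B] {s : Set B}
    (hs : Algebra.adjoin ℝ s = ⊤) [Ring C] [Algebra ℝ C]
    (φ : B →ₐ[ℝ] C) (c : C) (h : ∀ x ∈ s, Commute (φ x) c) (b : B) : Commute (φ b) c := by
  have hb : b ∈ Algebra.adjoin ℝ s := by rw [hs]; trivial
  induction hb using Algebra.adjoin_induction with
  | mem x hx => exact h x hx
  | algebraMap r => rw [AlgHom.commutes]; exact Algebra.commutes r c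
  | add x y _ _ hx hy => rw [map_add]; exact hx.add_left hy
  | mul x y _ _ hx hy => rw [map_mul]; exact hx.mul_left hy

/-- The relations satisfied by the generators of `R_{p,q}`. -/
structure IsRFamily (g : Fin p ⊕ Fin q → D) : Prop where
  sq : ∀ i, g i * g i = 1
  comm : ∀ i j, i ≠ j → g i * g j = -(sgn p q i * sgn p q j) • (g j * g i)

theorem IsRFamily.left {g : Fin p ⊕ Fin q → D} (h : IsRFamily g) :
    IsCliffordFamily (fun _ => 1) (fun i : Fin p => g (.inl i)) where
  sq i := by rw [h.sq, one_smul]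
  anti i j hij := by rw [h.comm _ _ (by simpa using hij)]; simp [sgn]

theorem IsRFamily.right {g : Fin p ⊕ Fin q → D} (h : IsRFamily g) :
    IsCliffordFamily (fun _ => 1) (fun i : Fin q => g (.inr i)) where
  sq i := by rw [h.sq, one_smul]
  anti i j hij := by rw [h.comm _ _ (by simpa using hij)]; simp [sgn]

/-- The universal property of `R_{p,q}`. -/
def liftR (g : Fin p ⊕ Fin q → D) (h : IsRFamily g) : R p q →ₐ[ℝ] D :=
  Algebra.TensorProduct.lift (cliffLift _ h.left) (cliffLift _ h.right) fun x y => by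
    refine commute_of_adjoin (adjoin_ι_single _) _ _ ?_ x
    rintro _ ⟨i, rfl⟩
    refine (commute_of_adjoin (adjoin_ι_single _) _ _ ?_ y).symm
    rintro _ ⟨j, rfl⟩
    rw [cliffLift_ι, cliffLift_ι, Commute, SemiconjBy, h.comm _ _ (by simp)]
    simp [sgn]

theorem liftR_gen (g : Fin p ⊕ Fin q → D) (h : IsRFamily g) (i : Fin p ⊕ Fin q) :
    liftR g h (gen p q i) = g i := by
  rcases i with i | i
  · simp only [gen, liftR, Sum.elim_inl, Algebra.TensorProduct.lift_tmul, map_one, mul_one]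
    exact cliffLift_ι _ h.left i
  · simp only [gen, liftR, Sum.elim_inr, Algebra.TensorProduct.lift_tmul, map_one, one_mul]
    exact cliffLift_ι _ h.right i

theorem isRFamily_gen (p q : ℕ) : IsRFamily (gen p q) := ⟨gen_sq p q, fun _ _ h => gen_comm p q h⟩

theorem adjoin_gen (p q : ℕ) : Algebra.adjoin ℝ (Set.range (gen p q)) = ⊤ := by
  rw [eq_top_iff]
  rintro x -
  induction x using TensorProduct.induction_on with
  | zero => exact zero_mem _
  | add x y hx hy => exact add_mem hx hy
  | tmul a b =>
    rw [show a ⊗ₜ[ℝ] b = (a ⊗ₜ[ℝ] 1) * (1 ⊗ₜ[ℝ] b) by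
      rw [Algebra.TensorProduct.tmul_mul_tmul, one_mul, mul_one]]
    refine mul_mem ?_ ?_
    · have : (Algebra.adjoin ℝ (Set.range fun i : Fin p =>
          CliffordAlgebra.ι (sqForm p) (Pi.single i 1))).map Algebra.TensorProduct.includeLeft
          ≤ Algebra.adjoin ℝ (Set.range (gen p q)) := by
        rw [AlgHom.map_adjoin]
        refine Algebra.adjoin_mono ?_
        rintro _ ⟨_, ⟨i, rfl⟩, rfl⟩
        exact ⟨.inl i, rfl⟩
      refine this ⟨a, ?_, rfl⟩
      rw [adjoin_ι_single]; trivial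
    · have : (Algebra.adjoin ℝ (Set.range fun i : Fin q =>
          CliffordAlgebra.ι (sqForm q) (Pi.single i 1))).map Algebra.TensorProduct.includeRight
          ≤ Algebra.adjoin ℝ (Set.range (gen p q)) := by
        rw [AlgHom.map_adjoin]
        refine Algebra.adjoin_mono ?_
        rintro _ ⟨_, ⟨i, rfl⟩, rfl⟩
        exact ⟨.inr i, rfl⟩
      refine this ⟨b, ?_, rfl⟩
      rw [adjoin_ι_single]; trivial

end LiftR

/-! ### Matrix models of real Clifford algebras -/

section Models

variable {D D' : Type*} [Ring D] [StarRing D] [Algebra ℝ D] [Ring D'] [StarRing D'] [Algebra ℝ D']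

/-- A Clifford family whose members are self-adjoint or skew-adjoint according to the sign of
their squares, and which generates an algebra of full dimension. -/
structure IsCliffordModel {ι : Type*} [Fintype ι] (ε : ι → ℝ) (F : ι → D) : Prop
    extends IsCliffordFamily ε F where
  star_eq : ∀ i, star (F i) = ε i • F i
  adjoin_eq : Algebra.adjoin ℝ (Set.range F) = ⊤
  finrank_eq : Module.finrank ℝ D = 2 ^ Fintype.card ι

theorem IsCliffordModel.reindex {ι κ : Type*} [Fintype ι] [Fintype κ] {ε : ι → ℝ} {F : ι → D}
    (h : IsCliffordModel ε F) (e : κ ≃ ι) {δ : κ → ℝ} (hδ : ∀ k, ε (e k) = δ k) :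
    IsCliffordModel δ (F ∘ e) where
  sq k := by rw [← hδ]; exact h.sq (e k)
  anti k l hkl := h.anti _ _ (e.injective.ne hkl)
  star_eq k := by rw [← hδ]; exact h.star_eq (e k)
  adjoin_eq := by rw [e.surjective.range_comp, h.adjoin_eq]
  finrank_eq := by rw [h.finrank_eq, Fintype.card_congr e]

/-- `D`, with its involution, is the Clifford algebra of a form of signature `(s, t)`. -/
def HasCliffordModel (s t : ℕ) (D : Type*) [Ring D] [StarRing D] [Algebra ℝ D] : Prop :=
  ∃ F : Fin s ⊕ Fin t → D, IsCliffordModel (sgn s t) F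

theorem HasCliffordModel.congr {s t : ℕ} (h : HasCliffordModel s t D) (e : D ≃ₐ[ℝ] D')
    (he : ∀ x, e (star x) = star (e x)) : HasCliffordModel s t D' := by
  obtain ⟨F, hF⟩ := h
  refine ⟨fun i => e (F i), ⟨⟨fun i => ?_, fun i j hij => ?_⟩, fun i => ?_, ?_, ?_⟩⟩
  · rw [← map_mul, hF.sq, map_smul, map_one]
  · rw [← map_mul, hF.anti i j hij, map_neg, map_mul]
  · rw [← he, hF.star_eq, map_smul]
  · have := congrArg (Subalgebra.map (e : D →ₐ[ℝ] D')) hF.adjoin_eq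
    rw [AlgHom.map_adjoin, ← Set.range_comp, Algebra.map_top, (AlgHom.range_eq_top _).2 e.surjective]
      at this
    exact this
  · rw [← hF.finrank_eq]
    exact e.toLinearEquiv.finrank_eq.symm

theorem adjoin_mem_range {B ι : Type*} [Ring B] [Algebra ℝ B] (F : ι → B) (i : ι) :
    F i ∈ Algebra.adjoin ℝ (Set.range F) := Algebra.subset_adjoin (Set.mem_range_self i)

/-- Half the sum of the first two matrices is a matrix unit; the other units follow, and with the
scalar matrices they span. -/
theorem matrix_two_subalgebra_eq_top (S : Subalgebra ℝ (Matrix (Fin 2) (Fin 2) D))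
    (hX : !![0, 1; 1, 0] ∈ S) (hY : !![0, 1; -1, 0] ∈ S) (hs : ∀ d : D, !![d, 0; 0, d] ∈ S) :
    S = ⊤ := by
  rw [eq_top_iff]
  rintro M -
  have h12 : !![0, 1; 0, 0] ∈ S := by
    have h := S.smul_mem (add_mem hX hY) (1 / 2 : ℝ)
    convert h using 1
    ext i j
    fin_cases i <;> fin_cases j <;> simp [← two_smul ℝ (1 : D), smul_smul]
  have h21 : !![0, 0; 1, 0] ∈ S := by
    have h := sub_mem hX h12
    convert h using 1
    ext i j
    fin_cases i <;> fin_cases j <;> simp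
  have h11 : !![1, 0; 0, 0] ∈ S := by
    have h := mul_mem h12 h21
    convert h using 1
    ext i j
    fin_cases i <;> fin_cases j <;> simp
  have h22 : !![0, 0; 0, 1] ∈ S := by
    have h := mul_mem h21 h12
    convert h using 1
    ext i j
    fin_cases i <;> fin_cases j <;> simp
  have h := add_mem (add_mem (mul_mem (hs (M 0 0)) h11) (mul_mem (hs (M 0 1)) h12))
    (add_mem (mul_mem (hs (M 1 0)) h21) (mul_mem (hs (M 1 1)) h22))
  convert h using 1
  ext i j
  fin_cases i <;> fin_cases j <;> simp

/-- The old generators are multiplied by Z = diag(1, -1), which anticommutes with the two new ones X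
= (0, 1; 1, 0) and Y = (0, 1; -1, 0). X is symmetric of square 1 and Y skew of square -1. -/
theorem HasCliffordModel.matrix_two {s t : ℕ} (h : HasCliffordModel s t D) :
    HasCliffordModel (s + 1) (t + 1) (Matrix (Fin 2) (Fin 2) D) := by
  obtain ⟨F, hF⟩ := h
  set G : (Fin s ⊕ Fin t) ⊕ (Fin 1 ⊕ Fin 1) → Matrix (Fin 2) (Fin 2) D :=
    Sum.elim (fun i => !![F i, 0; 0, -F i])
      (Sum.elim (fun _ => !![0, 1; 1, 0]) (fun _ => !![0, 1; -1, 0])) with hG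
  have key : IsCliffordModel (Sum.elim (sgn s t) (sgn 1 1)) G := by
    refine ⟨⟨?_, ?_⟩, ?_, ?_, ?_⟩
    · rintro (i | i | i)
      · ext a b
        fin_cases a <;> fin_cases b <;> simp [hG, hF.sq, Matrix.mul_apply]
      · ext a b
        fin_cases a <;> fin_cases b <;> simp [hG, sgn, Matrix.mul_apply]
      · ext a b
        fin_cases a <;> fin_cases b <;> simp [hG, sgn, Matrix.mul_apply]
    · rintro (i | i | i) (j | j | j) hij
      · have hij' : i ≠ j := fun h => hij (h ▸ rfl)
        ext a b
        fin_cases a <;> fin_cases b <;> simp [hG, hF.anti i j hij', Matrix.mul_apply]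
      all_goals try exact absurd (congrArg _ (congrArg _ (Subsingleton.elim i j))) hij
      all_goals
        ext a b
        fin_cases a <;> fin_cases b <;> simp [hG, Matrix.mul_apply]
    · rintro (i | i | i)
      · ext a b
        fin_cases a <;> fin_cases b <;> simp [hG, hF.star_eq]
      · ext a b
        fin_cases a <;> fin_cases b <;> simp [hG, sgn]
      · ext a b
        fin_cases a <;> fin_cases b <;> simp [hG, sgn]
    · set S := Algebra.adjoin ℝ (Set.range G)
      have hX : !![0, 1; 1, 0] ∈ S := adjoin_mem_range G (.inr (.inl 0))
      have hY : !![0, 1; -1, 0] ∈ S := adjoin_mem_range G (.inr (.inr 0))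
      -- Multiplying by Z = Y X removes the sign in diag(F i, -F i) and leaves the scalar matrices.
      have hZ : !![1, 0; 0, -1] ∈ S := by
        have h := mul_mem hY hX
        convert h using 1
        ext i j
        fin_cases i <;> fin_cases j <;> simp
      refine matrix_two_subalgebra_eq_top S hX hY fun d => ?_
      have hd : d ∈ Algebra.adjoin ℝ (Set.range F) := by rw [hF.adjoin_eq]; trivial
      induction hd using Algebra.adjoin_induction with
      | mem x hx =>
        obtain ⟨i, rfl⟩ := hx
        have h := mul_mem (adjoin_mem_range G (.inl i)) hZ
        convert h using 1
        ext i j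
        fin_cases i <;> fin_cases j <;> simp [hG]
      | algebraMap r =>
        have h := S.algebraMap_mem r
        convert h using 1
        ext i j
        fin_cases i <;> fin_cases j <;> simp [Matrix.algebraMap_matrix_apply]
      | add x y _ _ hx hy =>
        have h := add_mem hx hy
        convert h using 1
        ext i j
        fin_cases i <;> fin_cases j <;> simp
      | mul x y _ _ hx hy =>
        have h := mul_mem hx hy
        convert h using 1
        ext i j
        fin_cases i <;> fin_cases j <;> simp
    · rw [Module.finrank_matrix, hF.finrank_eq]
      simp [pow_add, pow_succ]
      ring
  refine ⟨_, key.reindex ((Equiv.sumSumSumComm _ _ _ _).trans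
    (Equiv.sumCongr finSumFinEquiv finSumFinEquiv)).symm fun k => ?_⟩
  obtain ⟨k, rfl⟩ := ((Equiv.sumSumSumComm _ _ _ _).trans
    (Equiv.sumCongr finSumFinEquiv finSumFinEquiv)).surjective k
  rw [Equiv.symm_apply_apply]
  rcases k with (k | k) | (k | k) <;> simp [sgn]

/-- Let η be the product of the four special generators. It is self-adjoint of square 1,
anticommutes with each of the four and commutes with all others. Multiplying the four by η therefore
reverses the sign of their squares and of their adjoints and keeps all the anticommutation
relations. -/
theorem IsCliffordModel.twist {ι : Type*} [Fintype ι] {ε : ι → ℝ} {c : ℝ} (hc : c * c = 1)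
    {F : ι ⊕ Fin 4 → D} (hF : IsCliffordModel (Sum.elim ε fun _ => c) F) :
    ∃ G : ι ⊕ Fin 4 → D, IsCliffordModel (Sum.elim ε fun _ => -c) G := by
  set η := F (.inr 0) * F (.inr 1) * F (.inr 2) * F (.inr 3) with hη
  have hc' : ∀ x : D, c • c • x = x := fun x => by rw [smul_smul, hc, one_smul]
  have sq : ∀ i : Fin 4, F (.inr i) * F (.inr i) = c • 1 := fun i => hF.sq (.inr i)
  have sq' : ∀ (i : Fin 4) x, F (.inr i) * (F (.inr i) * x) = c • x := fun i x => by
    rw [← mul_assoc, sq]; simp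
  have an : ∀ i j : Fin 4, j < i → F (.inr i) * F (.inr j) = -(F (.inr j) * F (.inr i)) :=
    fun i j hij => hF.anti _ _ (by simpa using hij.ne')
  have an' : ∀ i j : Fin 4, j < i → ∀ x,
      F (.inr i) * (F (.inr j) * x) = -(F (.inr j) * (F (.inr i) * x)) :=
    fun i j hij x => by rw [← mul_assoc, an i j hij]; noncomm_ring
  have a10 := an 1 0 (by decide)
  have a20 := an 2 0 (by decide)
  have a30 := an 3 0 (by decide)
  have a21 := an 2 1 (by decide)
  have a31 := an 3 1 (by decide)
  have a32 := an 3 2 (by decide)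
  have b10 := an' 1 0 (by decide)
  have b20 := an' 2 0 (by decide)
  have b30 := an' 3 0 (by decide)
  have b21 := an' 2 1 (by decide)
  have b31 := an' 3 1 (by decide)
  have b32 := an' 3 2 (by decide)
  have hηη : η * η = 1 := by
    simp only [hη, mul_assoc, a10, a20, a30, a21, a31, a32, b10, b20, b30, b21, b31, b32, sq, sq',
      mul_neg, neg_neg, mul_smul_comm, hc', mul_one]
  have hfη : ∀ i : Fin 4, F (.inr i) * η = -(η * F (.inr i)) := by
    intro i
    fin_cases i <;>
    simp only [Fin.zero_eta, Fin.mk_one, Fin.reduceFinMk, hη, mul_assoc, a10, a20, a30, a21, a31, a32, b10, b20, b30, b21, b31, b32, sq, sq',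
      mul_neg, neg_neg, mul_smul_comm, hc', mul_one, smul_neg]
  have hkη : ∀ k : ι, F (.inl k) * η = η * F (.inl k) := by
    intro k
    have e : ∀ i : Fin 4, F (.inl k) * F (.inr i) = -(F (.inr i) * F (.inl k)) :=
      fun i => hF.anti _ _ (by simp)
    have e' : ∀ (i : Fin 4) x, F (.inl k) * (F (.inr i) * x) = -(F (.inr i) * (F (.inl k) * x)) :=
      fun i x => by rw [← mul_assoc, e]; noncomm_ring
    simp only [hη, mul_assoc, e, e', mul_neg, neg_neg]
  have hsη : star η = η := by
    have st : ∀ i : Fin 4, star (F (.inr i)) = c • F (.inr i) := fun i => hF.star_eq (.inr i)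
    simp only [hη, star_mul, st, mul_assoc, a10, a20, a30, a21, a31, a32, b10, b20, b30, b21, b31,
      b32, mul_neg, neg_mul, neg_neg, mul_smul_comm, smul_mul_assoc, hc', smul_neg]
  set G : ι ⊕ Fin 4 → D := Sum.elim (fun k => F (.inl k)) (fun i => F (.inr i) * η) with hG
  -- Moving one η past a generator changes the sign, and η² = 1.
  have hGG : ∀ i j : Fin 4, G (.inr i) * G (.inr j) = -(F (.inr i) * F (.inr j)) := by
    intro i j
    simp only [hG, Sum.elim_inr]
    rw [mul_assoc, ← mul_assoc η, ← neg_eq_iff_eq_neg.2 (hfη j), neg_mul, mul_assoc, hηη, mul_one,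
      mul_neg]
  clear_value η
  refine ⟨G, ⟨⟨?_, ?_⟩, ?_, ?_, hF.finrank_eq⟩⟩
  · rintro (k | i)
    · exact hF.sq (.inl k)
    · rw [hGG, sq]; simp
  · rintro (k | i) (l | j) hij
    · exact hF.anti _ _ (by simpa using hij)
    · simp only [hG, Sum.elim_inr, Sum.elim_inl]
      rw [← mul_assoc, hF.anti _ _ (by simp), mul_assoc, ← hkη]; noncomm_ring
    · simp only [hG, Sum.elim_inr, Sum.elim_inl]
      rw [mul_assoc, ← hkη, ← mul_assoc, ← mul_assoc (F (.inl l)), hF.anti (.inr i) _ (by simp),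
        neg_mul]
    · rw [hGG, hGG, hF.anti _ _ (by simpa using hij)]
  · rintro (k | i)
    · exact hF.star_eq (.inl k)
    · have := hF.star_eq (.inr i)
      simp only [hG, Sum.elim_inr] at this ⊢
      rw [star_mul, hsη, this, mul_smul_comm, ← neg_eq_iff_eq_neg.2 (hfη i)]; simp
  · set S := Algebra.adjoin ℝ (Set.range G)
    -- The two signs cancel, so the product of the four new generators is again η, and the old ones
    -- are recovered by multiplying by it.
    have hηS : η ∈ S := by
      have h := mul_mem (mul_mem (adjoin_mem_range G (.inr 0)) (adjoin_mem_range G (.inr 1)))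
        (mul_mem (adjoin_mem_range G (.inr 2)) (adjoin_mem_range G (.inr 3)))
      rw [hGG, hGG] at h
      convert h using 1
      rw [hη]; noncomm_ring
    rw [eq_top_iff, ← hF.adjoin_eq]
    refine Algebra.adjoin_le ?_
    rintro _ ⟨k | i, rfl⟩
    · exact adjoin_mem_range G (.inl k)
    · have h := mul_mem (adjoin_mem_range G (.inr i)) hηS
      rwa [show G (.inr i) = F (.inr i) * η from rfl, mul_assoc, hηη, mul_one] at h

theorem HasCliffordModel.add_four {s t : ℕ} :
    HasCliffordModel (s + 4) t D ↔ HasCliffordModel s (t + 4) D := by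
  set e : Fin (s + 4) ⊕ Fin t ≃ (Fin s ⊕ Fin t) ⊕ Fin 4 :=
    ((Equiv.sumCongr finSumFinEquiv.symm (Equiv.refl _)).trans (Equiv.sumAssoc _ _ _)).trans
      ((Equiv.sumCongr (Equiv.refl _) (Equiv.sumComm _ _)).trans (Equiv.sumAssoc _ _ _).symm)
  set e' : Fin s ⊕ Fin (t + 4) ≃ (Fin s ⊕ Fin t) ⊕ Fin 4 :=
    (Equiv.sumCongr (Equiv.refl _) finSumFinEquiv.symm).trans (Equiv.sumAssoc _ _ _).symm
  have he : ∀ k, sgn (s + 4) t k = (Sum.elim (sgn s t) (fun _ => 1) : _ → ℝ) (e k) := by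
    intro k
    obtain ⟨k, rfl⟩ := e.symm.surjective k
    rcases k with (k | k) | k <;> simp [e, sgn]
  have he' : ∀ k, sgn s (t + 4) k = (Sum.elim (sgn s t) (fun _ => -1) : _ → ℝ) (e' k) := by
    intro k
    obtain ⟨k, rfl⟩ := e'.symm.surjective k
    rcases k with (k | k) | k <;> simp [e', sgn]
  constructor
  · rintro ⟨F, hF⟩
    obtain ⟨G, hG⟩ := (hF.reindex e.symm (δ := Sum.elim (sgn s t) fun _ => 1) fun k => by
      rw [he, e.apply_symm_apply]).twist (by norm_num)
    exact ⟨_, hG.reindex e' fun k => (he' k).symm⟩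
  · rintro ⟨F, hF⟩
    obtain ⟨G, hG⟩ := (hF.reindex e'.symm (δ := Sum.elim (sgn s t) fun _ => -1) fun k => by
      rw [he', e'.apply_symm_apply]).twist (by norm_num)
    exact ⟨_, hG.reindex e fun k => by rw [he, neg_neg]⟩

end Models

/-! ### Periodicity modulo 8 of the matrix models. -/

section Periodicity

variable {K : Type*} [Ring K] [StarRing K] [Algebra ℝ K] {d r : ℕ}

/-- `M(2; M(r; 𝕂)^d) ≅ M(2 r; 𝕂)^d`. -/
def matrixTwoPi (d r : ℕ) (K : Type*) [Ring K] [Algebra ℝ K] :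
    Matrix (Fin 2) (Fin 2) (Fin d → Matrix (Fin r) (Fin r) K) ≃ₐ[ℝ]
      (Fin d → Matrix (Fin (2 * r)) (Fin (2 * r)) K) :=
  AlgEquiv.trans
    ({ toFun := fun M i => Matrix.of fun a b => M a b i
       invFun := fun N => Matrix.of fun a b => fun i => N i a b
       left_inv := fun _ => rfl
       right_inv := fun _ => rfl
       map_add' := fun _ _ => rfl
       map_mul' := fun x y => by
         ext i a b : 3
         simp [Matrix.mul_apply]
       commutes' := fun c => by
         ext i a b : 3
         by_cases h : a = b <;> simp [Matrix.algebraMap_matrix_apply, h] } :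
      Matrix (Fin 2) (Fin 2) (Fin d → Matrix (Fin r) (Fin r) K) ≃ₐ[ℝ]
        (Fin d → Matrix (Fin 2) (Fin 2) (Matrix (Fin r) (Fin r) K)))
    (AlgEquiv.piCongrRight fun _ => (Matrix.compAlgEquiv (Fin 2) (Fin r) K ℝ).trans
      (Matrix.reindexAlgEquiv ℝ K finProdFinEquiv))

theorem matrixTwoPi_star (M : Matrix (Fin 2) (Fin 2) (Fin d → Matrix (Fin r) (Fin r) K)) :
    matrixTwoPi d r K (star M) = star (matrixTwoPi d r K M) := by
  ext i a b
  rfl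

theorem HasCliffordModel.add_diag {s t : ℕ}
    (h : HasCliffordModel s t (Fin d → Matrix (Fin r) (Fin r) K)) (m : ℕ) :
    HasCliffordModel (s + m) (t + m) (Fin d → Matrix (Fin (2 ^ m * r)) (Fin (2 ^ m * r)) K) := by
  induction m with
  | zero => rw [pow_zero, one_mul]; exact h
  | succ m ih =>
    rw [show 2 ^ (m + 1) * r = 2 * (2 ^ m * r) by ring]
    exact ih.matrix_two.congr (matrixTwoPi d _ K) matrixTwoPi_star

theorem HasCliffordModel.add_four_mul {D : Type*} [Ring D] [StarRing D] [Algebra ℝ D] (c : ℕ) :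
    ∀ {s t : ℕ}, HasCliffordModel (s + 4 * c) t D ↔ HasCliffordModel s (t + 4 * c) D := by
  induction c with
  | zero => simp
  | succ c ih =>
    intro s t
    rw [show s + 4 * (c + 1) = (s + 4 * c) + 4 by ring, HasCliffordModel.add_four, ih,
      show t + 4 + 4 * c = t + 4 * (c + 1) by ring]

/-- Signatures with the same difference modulo 8 have models over the same algebra `𝕂^d`. -/
theorem HasCliffordModel.of_base {s₀ t₀ : ℕ}
    (h : HasCliffordModel s₀ t₀ (Fin d → Matrix (Fin r) (Fin r) K)) (h0 : s₀ = 0 ∨ t₀ = 0)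
    (hs : s₀ ≤ 4) (ht : t₀ ≤ 3) {s t : ℕ} (m : ℕ) (hm : s + t = s₀ + t₀ + 2 * m)
    (hmod : (s + t₀) % 8 = (t + s₀) % 8) :
    HasCliffordModel s t (Fin d → Matrix (Fin (2 ^ m * r)) (Fin (2 ^ m * r)) K) := by
  -- The differences s - t and s₀ - t₀ differ by 8c. So m diagonal steps from (s₀, t₀) followed by c
  -- exchanges of four generators reach (s, t).
  obtain ⟨c, hc | hc⟩ : ∃ c, s + t₀ = t + s₀ + 8 * c ∨ t + s₀ = s + t₀ + 8 * c := by
    rcases le_total (s + t₀) (t + s₀) with h | h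
    · exact ⟨(t + s₀ - (s + t₀)) / 8, by omega⟩
    · exact ⟨(s + t₀ - (t + s₀)) / 8, by omega⟩
  · have h1 := h.add_diag m
    rw [show t₀ + m = t + 4 * c by omega, ← HasCliffordModel.add_four_mul] at h1
    rwa [show s = s₀ + m + 4 * c by omega]
  · have h1 := h.add_diag m
    rw [show s₀ + m = s + 4 * c by omega, HasCliffordModel.add_four_mul] at h1
    rwa [show t = t₀ + m + 4 * c by omega]

end Periodicity

/-! ### Base models, one for each residue of s - t modulo 8. -/

section Bases

/-- The quaternion `a + b i + c j + d k`. -/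
def quat (a b c d : ℝ) : ℍ[ℝ] := ⟨a, b, c, d⟩

@[simp] theorem quat_re (a b c d : ℝ) : (quat a b c d).re = a := rfl

@[simp] theorem quat_imI (a b c d : ℝ) : (quat a b c d).imI = b := rfl

@[simp] theorem quat_imJ (a b c d : ℝ) : (quat a b c d).imJ = c := rfl

@[simp] theorem quat_imK (a b c d : ℝ) : (quat a b c d).imK = d := rfl

theorem pi_star_algEquiv (d : ℕ) (K : Type*) [Ring K] [StarRing K] [Algebra ℝ K] :
    ∃ e : (Fin d → K) ≃ₐ[ℝ] (Fin d → Matrix (Fin 1) (Fin 1) K), ∀ x, e (star x) = star (e x) := by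
  refine ⟨AlgEquiv.piCongrRight fun _ =>
    { toFun := fun x => Matrix.of fun _ _ => x
      invFun := fun M => M 0 0
      left_inv := fun _ => rfl
      right_inv := fun M => by ext a b; rw [Subsingleton.elim a 0, Subsingleton.elim b 0]; rfl
      map_add' := fun _ _ => rfl
      map_mul' := fun x y => by ext a b; simp [Matrix.mul_apply]
      commutes' := fun c => by
        ext a b
        rw [Subsingleton.elim a b]
        simp [Matrix.algebraMap_matrix_apply] }, fun x => ?_⟩
  ext i a b
  rfl

theorem unit_star_algEquiv (K : Type*) [Ring K] [StarRing K] [Algebra ℝ K] :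
    ∃ e : K ≃ₐ[ℝ] (Fin 1 → K), ∀ x, e (star x) = star (e x) :=
  ⟨(AlgEquiv.funUnique ℝ (Fin 1) K).symm, fun _ => rfl⟩

theorem HasCliffordModel.single {s t : ℕ} {K : Type*} [Ring K] [StarRing K] [Algebra ℝ K]
    (h : HasCliffordModel s t K) : HasCliffordModel s t (Fin 1 → Matrix (Fin 1) (Fin 1) K) := by
  obtain ⟨e, he⟩ := unit_star_algEquiv K
  obtain ⟨e', he'⟩ := pi_star_algEquiv 1 K
  exact (h.congr e he).congr e' he'

theorem real_subalgebra_mem (S : Subalgebra ℝ ℝ) (x : ℝ) : x ∈ S := S.algebraMap_mem x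

theorem complex_subalgebra_eq_top (S : Subalgebra ℝ ℂ) (h : Complex.I ∈ S) : S = ⊤ := by
  rw [eq_top_iff]
  rintro z -
  rw [← Complex.re_add_im z]
  exact add_mem (S.algebraMap_mem z.re) (mul_mem (S.algebraMap_mem z.im) h)

theorem quaternion_subalgebra_eq_top (S : Subalgebra ℝ ℍ[ℝ]) (hi : quat 0 1 0 0 ∈ S)
    (hj : quat 0 0 1 0 ∈ S) : S = ⊤ := by
  rw [eq_top_iff]
  rintro z -
  have h := add_mem (add_mem (S.algebraMap_mem z.re) (S.smul_mem hi z.imI))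
    (add_mem (S.smul_mem hj z.imJ) (S.smul_mem (mul_mem hi hj) z.imK))
  convert h using 1
  ext <;> simp

theorem hasCliffordModel_zero_zero : HasCliffordModel 0 0 ℝ := by
  refine ⟨fun _ => 1, ⟨⟨?_, ?_⟩, ?_, ?_, ?_⟩⟩
  · rintro (i | i) <;> exact i.elim0
  · rintro (i | i) <;> exact i.elim0
  · rintro (i | i) <;> exact i.elim0
  · exact eq_top_iff.2 fun x _ => real_subalgebra_mem _ x
  · simp

theorem hasCliffordModel_zero_one : HasCliffordModel 0 1 ℂ := by
  refine ⟨fun _ => Complex.I, ⟨⟨?_, ?_⟩, ?_, ?_, ?_⟩⟩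
  · rintro (i | i)
    · exact i.elim0
    · simp [sgn]
  · rintro (i | i) (j | j) hij
    all_goals first | exact i.elim0 | exact j.elim0 |
      exact absurd (congrArg _ (Subsingleton.elim i j)) hij
  · rintro (i | i)
    · exact i.elim0
    · simp [sgn]
  · exact complex_subalgebra_eq_top _ (Algebra.subset_adjoin ⟨.inr 0, rfl⟩)
  · simp

theorem hasCliffordModel_zero_two : HasCliffordModel 0 2 ℍ[ℝ] := by
  refine ⟨Sum.elim (fun _ => 0) ![quat 0 1 0 0, quat 0 0 1 0], ⟨⟨?_, ?_⟩, ?_, ?_, ?_⟩⟩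
  · rintro (i | i)
    · exact i.elim0
    · fin_cases i <;> ext <;> simp [sgn]
  · rintro (i | i) (j | j)
    · exact i.elim0
    · exact i.elim0
    · exact j.elim0
    · fin_cases i <;> fin_cases j <;> intro hij <;> first | exact absurd rfl hij | (ext <;> simp)
  · rintro (i | i)
    · exact i.elim0
    · fin_cases i <;> ext <;> simp [sgn]
  · exact quaternion_subalgebra_eq_top _ (Algebra.subset_adjoin ⟨.inr 0, rfl⟩)
      (Algebra.subset_adjoin ⟨.inr 1, rfl⟩)
  · simp [Quaternion.finrank_eq_four]

theorem hasCliffordModel_one_zero : HasCliffordModel 1 0 (Fin 2 → ℝ) := by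
  refine ⟨fun _ => ![1, -1], ⟨⟨?_, ?_⟩, ?_, ?_, ?_⟩⟩
  · rintro (i | i)
    · ext a; fin_cases a <;> simp [sgn]
    · exact i.elim0
  · rintro (i | i) (j | j) hij
    all_goals first | exact i.elim0 | exact j.elim0 |
      exact absurd (congrArg _ (Subsingleton.elim i j)) hij
  · rintro (i | i)
    · ext a; fin_cases a <;> simp [sgn]
    · exact i.elim0
  · rw [eq_top_iff]
    rintro x -
    have h : ![1, -1] ∈ Algebra.adjoin ℝ (Set.range fun _ : Fin 1 ⊕ Fin 0 => (![1, -1] : Fin 2 → ℝ)) :=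
      Algebra.subset_adjoin ⟨.inl 0, rfl⟩
    have h' := add_mem (Subalgebra.algebraMap_mem _ ((x 0 + x 1) / 2))
      (Subalgebra.smul_mem _ h ((x 0 - x 1) / 2))
    convert h' using 1
    ext a
    fin_cases a <;> simp <;> ring
  · simp

theorem hasCliffordModel_zero_three : HasCliffordModel 0 3 (Fin 2 → ℍ[ℝ]) := by
  set F : Fin 0 ⊕ Fin 3 → Fin 2 → ℍ[ℝ] := Sum.elim (fun _ => 0)
    ![fun _ => quat 0 1 0 0, fun _ => quat 0 0 1 0, ![quat 0 0 0 1, -quat 0 0 0 1]] with hF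
  refine ⟨F, ⟨⟨?_, ?_⟩, ?_, ?_, ?_⟩⟩
  · rintro (i | i)
    · exact i.elim0
    · ext1 a
      fin_cases i <;> fin_cases a <;> ext <;> simp [sgn, hF]
  · rintro (i | i) (j | j)
    · exact i.elim0
    · exact i.elim0
    · exact j.elim0
    · intro hij
      ext1 a
      fin_cases i <;> fin_cases j <;> first | exact absurd rfl hij | (fin_cases a <;> ext <;> simp [hF])
  · rintro (i | i)
    · exact i.elim0
    · ext1 a
      fin_cases i <;> fin_cases a <;> ext <;> simp [sgn, hF]
  · set S := Algebra.adjoin ℝ (Set.range F)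
    have h0 : F (.inr 0) ∈ S := adjoin_mem_range F _
    have h1 : F (.inr 1) ∈ S := adjoin_mem_range F _
    have h2 : F (.inr 2) ∈ S := adjoin_mem_range F _
    have hc : ∀ x : ℍ[ℝ], (fun _ => x) ∈ S := by
      intro x
      have h := add_mem (add_mem (S.algebraMap_mem x.re) (S.smul_mem h0 x.imI))
        (add_mem (S.smul_mem h1 x.imJ) (S.smul_mem (mul_mem h0 h1) x.imK))
      convert h using 1
      ext1 a
      fin_cases a <;> ext <;> simp [hF]
    -- The product of the three generators is (-1, 1), since ij = k and the third generator is (k,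
    -- -k); it separates the two factors.
    have hv : ![1, -1] ∈ S := by
      have h := S.smul_mem (mul_mem (mul_mem h0 h1) h2) (-1)
      convert h using 1
      ext1 a
      fin_cases a <;> ext <;> simp [hF]
    rw [eq_top_iff]
    rintro x -
    have h := add_mem (hc ((1 / 2 : ℝ) • (x 0 + x 1))) (mul_mem (hc ((1 / 2 : ℝ) • (x 0 - x 1))) hv)
    convert h using 1
    ext1 a
    fin_cases a <;> ext <;> simp <;> ring
  · simp [Module.finrank_pi_fintype, Quaternion.finrank_eq_four]

theorem hasCliffordModel_two_zero : HasCliffordModel 2 0 (Matrix (Fin 2) (Fin 2) ℝ) := by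
  set F : Fin 2 ⊕ Fin 0 → Matrix (Fin 2) (Fin 2) ℝ := Sum.elim
    ![!![0, 1; 1, 0], !![1, 0; 0, -1]] (fun _ => 0) with hF
  refine ⟨F, ⟨⟨?_, ?_⟩, ?_, ?_, ?_⟩⟩
  · rintro (i | i)
    · fin_cases i <;> ext a b <;> fin_cases a <;> fin_cases b <;> simp [hF, sgn]
    · exact i.elim0
  · rintro (i | i) (j | j)
    · intro hij
      fin_cases i <;> fin_cases j <;> first | exact absurd rfl hij |
        (ext a b; fin_cases a <;> fin_cases b <;> simp [hF])
    · exact j.elim0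
    · exact i.elim0
    · exact i.elim0
  · rintro (i | i)
    · fin_cases i <;> ext a b <;> fin_cases a <;> fin_cases b <;> simp [hF, sgn]
    · exact i.elim0
  · set S := Algebra.adjoin ℝ (Set.range F)
    have hX : !![0, 1; 1, 0] ∈ S := adjoin_mem_range F (.inl 0)
    have hZ : !![1, 0; 0, -1] ∈ S := adjoin_mem_range F (.inl 1)
    refine matrix_two_subalgebra_eq_top S hX ?_ fun c => ?_
    · convert mul_mem hZ hX using 1
      ext a b; fin_cases a <;> fin_cases b <;> simp
    · convert S.algebraMap_mem c using 1
      ext a b; fin_cases a <;> fin_cases b <;> simp [Matrix.algebraMap_matrix_apply]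
  · simp [Module.finrank_matrix]

theorem hasCliffordModel_three_zero : HasCliffordModel 3 0 (Matrix (Fin 2) (Fin 2) ℂ) := by
  set F : Fin 3 ⊕ Fin 0 → Matrix (Fin 2) (Fin 2) ℂ := Sum.elim
    ![!![0, 1; 1, 0], !![1, 0; 0, -1], !![0, Complex.I; -Complex.I, 0]] (fun _ => 0) with hF
  refine ⟨F, ⟨⟨?_, ?_⟩, ?_, ?_, ?_⟩⟩
  · rintro (i | i)
    · fin_cases i <;> ext a b <;> fin_cases a <;> fin_cases b <;> simp [hF, sgn]
    · exact i.elim0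
  · rintro (i | i) (j | j)
    · intro hij
      fin_cases i <;> fin_cases j <;> first | exact absurd rfl hij |
        (ext a b; fin_cases a <;> fin_cases b <;> simp [hF])
    · exact j.elim0
    · exact i.elim0
    · exact i.elim0
  · rintro (i | i)
    · fin_cases i <;> ext a b <;> fin_cases a <;> fin_cases b <;> simp [hF, sgn]
    · exact i.elim0
  · set S := Algebra.adjoin ℝ (Set.range F)
    have hX : !![0, 1; 1, 0] ∈ S := adjoin_mem_range F (.inl 0)
    have hZ : !![1, 0; 0, -1] ∈ S := adjoin_mem_range F (.inl 1)
    have hW : !![0, Complex.I; -Complex.I, 0] ∈ S := adjoin_mem_range F (.inl 2)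
    refine matrix_two_subalgebra_eq_top S hX ?_ fun c => ?_
    · convert mul_mem hZ hX using 1
      ext a b; fin_cases a <;> fin_cases b <;> simp
    -- The product of the three generators in this order is the scalar matrix i.
    · convert add_mem (S.algebraMap_mem c.re)
        (S.smul_mem (mul_mem (mul_mem hW hX) hZ) c.im) using 1
      ext a b; fin_cases a <;> fin_cases b <;> simp [Matrix.algebraMap_matrix_apply]
  · simp [Module.finrank_matrix]

/-- The generators are (0, 1; 1, 0) and (0, u; -u, 0) for u = i, j, k. The last three are Hermitian
because each u is skew, and they anticommute because the u do. -/
theorem hasCliffordModel_four_zero : HasCliffordModel 4 0 (Matrix (Fin 2) (Fin 2) ℍ[ℝ]) := by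
  obtain ⟨u, hu⟩ : ∃ u : Fin 3 → ℍ[ℝ], u = ![quat 0 1 0 0, quat 0 0 1 0, quat 0 0 0 1] := ⟨_, rfl⟩
  have u0 : u 0 = quat 0 1 0 0 := by rw [hu]; rfl
  have u1 : u 1 = quat 0 0 1 0 := by rw [hu]; rfl
  have u2 : u 2 = quat 0 0 0 1 := by rw [hu]; rfl
  have usq : ∀ a, u a * u a = -1 := by
    intro a
    fin_cases a <;> simp only [Fin.zero_eta, Fin.mk_one, Fin.reduceFinMk, u0, u1, u2] <;>
      ext <;> simp
  have uanti : ∀ a b, a ≠ b → u a * u b = -(u b * u a) := by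
    intro a b hab
    fin_cases a <;> fin_cases b <;> first | exact absurd rfl hab |
      (simp only [Fin.zero_eta, Fin.mk_one, Fin.reduceFinMk, u0, u1, u2]; ext <;> simp)
  have ustar : ∀ a, star (u a) = -u a := by
    intro a
    fin_cases a <;> simp only [Fin.zero_eta, Fin.mk_one, Fin.reduceFinMk, u0, u1, u2] <;>
      ext <;> simp
  have hYY : ∀ x y : ℍ[ℝ], !![0, x; -x, 0] * !![0, y; -y, 0] = !![-(x * y), 0; 0, -(x * y)] :=
    fun x y => by
      rw [Matrix.mul_fin_two]; simp
  have hXY : ∀ x : ℍ[ℝ], !![0, 1; 1, 0] * !![0, x; -x, 0] = !![-x, 0; 0, x] := fun x => by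
    rw [Matrix.mul_fin_two]; simp
  have hYX : ∀ x : ℍ[ℝ], !![0, x; -x, 0] * !![0, 1; 1, 0] = !![x, 0; 0, -x] := fun x => by
    rw [Matrix.mul_fin_two]; simp
  have hXX : !![0, 1; 1, 0] * !![0, 1; 1, 0] = (1 : Matrix (Fin 2) (Fin 2) ℍ[ℝ]) := by
    rw [Matrix.mul_fin_two, Matrix.one_fin_two]; simp
  obtain ⟨G, hG⟩ : ∃ G : Fin 4 → Matrix (Fin 2) (Fin 2) ℍ[ℝ],
      G = Fin.cons !![0, 1; 1, 0] fun a : Fin 3 => !![0, u a; -u a, 0] := ⟨_, rfl⟩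
  have G0 : G 0 = !![0, 1; 1, 0] := by rw [hG]; rfl
  have GS : ∀ a : Fin 3, G a.succ = !![0, u a; -u a, 0] := fun a => by rw [hG]; rfl
  refine ⟨Sum.elim G (fun _ => 0), ⟨⟨?_, ?_⟩, ?_, ?_, ?_⟩⟩
  · rintro (i | i)
    · simp only [Sum.elim_inl, sgn, one_smul]
      refine Fin.cases ?_ (fun a => ?_) i
      · rw [G0, hXX]
      · rw [GS, hYY, usq, neg_neg, Matrix.one_fin_two]
    · exact i.elim0
  · rintro (i | i) (j | j)
    · simp only [Sum.elim_inl, ne_eq, Sum.inl.injEq]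
      refine Fin.cases ?_ (fun a => ?_) i <;> refine Fin.cases ?_ (fun b => ?_) j <;> intro hij
      · exact absurd rfl hij
      · rw [G0, GS, hXY, hYX]; simp
      · rw [G0, GS, hXY, hYX]; simp
      · rw [GS, GS, hYY, hYY, uanti a b fun h => hij (congrArg _ h)]; simp
    · exact j.elim0
    · exact i.elim0
    · exact i.elim0
  · rintro (i | i)
    · simp only [Sum.elim_inl, sgn, one_smul]
      refine Fin.cases ?_ (fun a => ?_) i
      · rw [G0]; refine Matrix.ext fun a b => ?_; fin_cases a <;> fin_cases b <;> simp
      · rw [GS]; refine Matrix.ext fun c b => ?_; fin_cases c <;> fin_cases b <;> simp [ustar]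
    · exact i.elim0
  · set S := Algebra.adjoin ℝ (Set.range (Sum.elim G (fun _ : Fin 0 => 0)))
    have hX : !![0, 1; 1, 0] ∈ S := G0 ▸ adjoin_mem_range _ (Sum.inl 0)
    have hY : ∀ a, !![0, u a; -u a, 0] ∈ S := fun a => GS a ▸ adjoin_mem_range _ (Sum.inl a.succ)
    have hs : ∀ d : ℍ[ℝ], !![d, 0; 0, d] ∈ S := fun c => by
      -- Products of two of the last three generators are scalar matrices, and i = jk, j = ki, k =
      -- ij yield all quaternions.
      have h2 : ∀ a b, !![u a * u b, 0; 0, u a * u b] ∈ S := fun a b => by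
        have h := neg_mem (mul_mem (hY a) (hY b))
        rw [hYY] at h
        convert h using 1
        simp
      have h := add_mem (add_mem (S.algebraMap_mem c.re) (S.smul_mem (h2 1 2) c.imI))
        (add_mem (S.smul_mem (h2 2 0) c.imJ) (S.smul_mem (h2 0 1) c.imK))
      have hc : c = algebraMap ℝ ℍ[ℝ] c.re + c.imI • (u 1 * u 2)
          + (c.imJ • (u 2 * u 0) + c.imK • (u 0 * u 1)) := by
        rw [u0, u1, u2]
        ext <;> simp
      convert h using 1
      conv_lhs => rw [hc]
      refine Matrix.ext fun a b => ?_
      fin_cases a <;> fin_cases b <;> simp [Matrix.algebraMap_matrix_apply]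
    refine matrix_two_subalgebra_eq_top S hX ?_ hs
    -- Since -u₀ u₀ = 1, this product is (0, 1; -1, 0).
    have h := mul_mem (hs (-u 0)) (hY 0)
    rw [Matrix.mul_fin_two] at h
    simpa [usq] using h
  · simp [Module.finrank_matrix, Quaternion.finrank_eq_four]

end Bases

/-! ### The models for all signatures and the dimension of R_{p,q}. -/

section Classes

variable {s t : ℕ} (m : ℕ)

/-- The numeral in the names of this series of models is the residue of s - t modulo 8. -/
theorem hasCliffordModel_zero (hm : s + t = 2 * m) (h : s % 8 = t % 8) :
    HasCliffordModel s t (Fin 1 → Matrix (Fin (2 ^ m)) (Fin (2 ^ m)) ℝ) := by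
  have := hasCliffordModel_zero_zero.single.of_base (by omega) (by omega) (by omega) (s := s)
    (t := t) m (by omega) (by omega)
  rwa [mul_one] at this

theorem hasCliffordModel_one (hm : s + t = 2 * m + 1) (h : s % 8 = (t + 1) % 8) :
    HasCliffordModel s t (Fin 2 → Matrix (Fin (2 ^ m)) (Fin (2 ^ m)) ℝ) := by
  obtain ⟨e, he⟩ := pi_star_algEquiv 2 ℝ
  have := (hasCliffordModel_one_zero.congr e he).of_base (by omega) (by omega) (by omega) (s := s)
    (t := t) m (by omega) (by omega)
  rwa [mul_one] at this

theorem HasCliffordModel.single_two {K : Type*} [Ring K] [StarRing K] [Algebra ℝ K] {d : ℕ}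
    (h : HasCliffordModel d 0 (Matrix (Fin 2) (Fin 2) K)) (hd : d ≤ 4) (hm : s + t = 2 * m + d)
    (hmod : s % 8 = (t + d) % 8) :
    HasCliffordModel s t (Fin 1 → Matrix (Fin (2 ^ (m + 1))) (Fin (2 ^ (m + 1))) K) := by
  obtain ⟨e, he⟩ := unit_star_algEquiv (Matrix (Fin 2) (Fin 2) K)
  have := (h.congr e he).of_base (by omega) (by omega) (by omega) (s := s)
    (t := t) m (by omega) (by omega)
  rwa [← pow_succ] at this

theorem hasCliffordModel_two (hm : s + t = 2 * m + 2) (h : s % 8 = (t + 2) % 8) :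
    HasCliffordModel s t (Fin 1 → Matrix (Fin (2 ^ (m + 1))) (Fin (2 ^ (m + 1))) ℝ) :=
  hasCliffordModel_two_zero.single_two m (by omega) hm h

theorem hasCliffordModel_three (hm : s + t = 2 * m + 3) (h : s % 8 = (t + 3) % 8) :
    HasCliffordModel s t (Fin 1 → Matrix (Fin (2 ^ (m + 1))) (Fin (2 ^ (m + 1))) ℂ) :=
  hasCliffordModel_three_zero.single_two m (by omega) hm h

theorem hasCliffordModel_four (hm : s + t = 2 * m + 4) (h : s % 8 = (t + 4) % 8) :
    HasCliffordModel s t (Fin 1 → Matrix (Fin (2 ^ (m + 1))) (Fin (2 ^ (m + 1))) ℍ[ℝ]) :=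
  hasCliffordModel_four_zero.single_two m (by omega) hm h

theorem hasCliffordModel_five (hm : s + t = 2 * m + 3) (h : (s + 3) % 8 = t % 8) :
    HasCliffordModel s t (Fin 2 → Matrix (Fin (2 ^ m)) (Fin (2 ^ m)) ℍ[ℝ]) := by
  obtain ⟨e, he⟩ := pi_star_algEquiv 2 ℍ[ℝ]
  have := (hasCliffordModel_zero_three.congr e he).of_base (by omega) (by omega) (by omega)
    (s := s) (t := t) m (by omega) (by omega)
  rwa [mul_one] at this

theorem hasCliffordModel_six (hm : s + t = 2 * m + 2) (h : (s + 2) % 8 = t % 8) :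
    HasCliffordModel s t (Fin 1 → Matrix (Fin (2 ^ m)) (Fin (2 ^ m)) ℍ[ℝ]) := by
  have := hasCliffordModel_zero_two.single.of_base (by omega) (by omega) (by omega) (s := s)
    (t := t) m (by omega) (by omega)
  rwa [mul_one] at this

theorem hasCliffordModel_seven (hm : s + t = 2 * m + 1) (h : (s + 1) % 8 = t % 8) :
    HasCliffordModel s t (Fin 1 → Matrix (Fin (2 ^ m)) (Fin (2 ^ m)) ℂ) := by
  have := hasCliffordModel_zero_one.single.of_base (by omega) (by omega) (by omega) (s := s)
    (t := t) m (by omega) (by omega)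
  rwa [mul_one] at this

/-- The model supplies the lower bound 2^s for the dimension, which the generators alone do not
give. -/
theorem HasCliffordModel.finrank_clifford {D : Type*} [Ring D] [StarRing D] [Algebra ℝ D]
    (h : HasCliffordModel s 0 D) : Module.finrank ℝ (CliffordAlgebra (sqForm s)) = 2 ^ s ∧
      Module.Finite ℝ (CliffordAlgebra (sqForm s)) := by
  obtain ⟨F, hF⟩ := h
  have hG := hF.reindex (Equiv.sumEmpty (Fin s) (Fin 0)).symm (δ := fun _ => 1) fun _ => rfl
  obtain ⟨e, -⟩ := hG.toIsCliffordFamily.exists_equiv hG.adjoin_eq hG.finrank_eq.ge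
  refine ⟨by simpa using e.toLinearEquiv.finrank_eq.trans hG.finrank_eq, ?_⟩
  exact ((isCliffordFamily_ι _).finite (adjoin_ι_single _)).1

theorem finrank_cliffordAlgebra (s : ℕ) : Module.finrank ℝ (CliffordAlgebra (sqForm s)) = 2 ^ s ∧
    Module.Finite ℝ (CliffordAlgebra (sqForm s)) := by
  have : s % 8 < 8 := Nat.mod_lt _ (by norm_num)
  obtain ⟨m, hm | hm⟩ := Nat.even_or_odd' s
  · rcases (by omega : s % 8 = 0 ∨ s % 8 = 2 ∨ s % 8 = 4 ∨ s % 8 = 6) with h | h | h | h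
    · exact (hasCliffordModel_zero (s := s) (t := 0) m (by omega) (by omega)).finrank_clifford
    · exact (hasCliffordModel_two (s := s) (t := 0) (m - 1) (by omega) (by omega)).finrank_clifford
    · exact (hasCliffordModel_four (s := s) (t := 0) (m - 2) (by omega) (by omega)).finrank_clifford
    · exact (hasCliffordModel_six (s := s) (t := 0) (m - 1) (by omega) (by omega)).finrank_clifford
  · rcases (by omega : s % 8 = 1 ∨ s % 8 = 3 ∨ s % 8 = 5 ∨ s % 8 = 7) with h | h | h | h
    · exact (hasCliffordModel_one (s := s) (t := 0) m (by omega) (by omega)).finrank_clifford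
    · exact (hasCliffordModel_three (s := s) (t := 0) (m - 1) (by omega)
        (by omega)).finrank_clifford
    · exact (hasCliffordModel_five (s := s) (t := 0) (m - 1) (by omega) (by omega)).finrank_clifford
    · exact (hasCliffordModel_seven (s := s) (t := 0) m (by omega) (by omega)).finrank_clifford

theorem finrank_R (p q : ℕ) : Module.finrank ℝ (R p q) = 2 ^ (p + q) := by
  have h1 := finrank_cliffordAlgebra p
  have h2 := finrank_cliffordAlgebra q
  rw [Module.finrank_tensorProduct, h1.1, h2.1, pow_add]

theorem finite_R (p q : ℕ) : Module.Finite ℝ (R p q) := by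
  have h1 := (finrank_cliffordAlgebra p).2
  have h2 := (finrank_cliffordAlgebra q).2
  infer_instance

end Classes

/-! ### Generating systems of `R_{p,q}` and the even subalgebra -/

/-- The antiautomorphism of `R_{p,q}` fixing the generators. -/
def rev (p q : ℕ) : R p q →ₐ[ℝ] (R p q)ᵐᵒᵖ :=
  liftR (fun i => MulOpposite.op (gen p q i))
    ⟨fun i => by rw [← MulOpposite.op_mul, gen_sq, MulOpposite.op_one], fun i j hij => by
      rw [← MulOpposite.op_mul, ← MulOpposite.op_mul, gen_comm p q hij.symm, MulOpposite.op_smul,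
        mul_comm (sgn p q j)]⟩

theorem rev_gen (p q : ℕ) (i : Fin p ⊕ Fin q) : rev p q (gen p q i) = MulOpposite.op (gen p q i) :=
  liftR_gen _ _ i

/-- A family of elements of an algebra `A` with an antiautomorphism `τ` that looks like the
generators of `R_{p,q}`, up to interchanging `p` and `q`. -/
structure IsRSystem {A : Type*} [Ring A] [Algebra ℝ A] {p q : ℕ} (τ : A →ₐ[ℝ] Aᵐᵒᵖ)
    (S : Subalgebra ℝ A) (e : Fin p ⊕ Fin q → A) : Prop extends IsRFamily e where
  adjoin_eq : Algebra.adjoin ℝ (Set.range e) = ⊤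
  finrank_eq : Module.finrank ℝ A = 2 ^ (p + q)
  rev_eq : ∀ i, τ (e i) = MulOpposite.op (e i)
  even_eq : S = Algebra.adjoin ℝ {x | ∃ i j, i ≠ j ∧ x = e i * e j}

theorem isRSystem_gen (p q : ℕ) : IsRSystem (rev p q) (REven p q) (gen p q) where
  toIsRFamily := isRFamily_gen p q
  adjoin_eq := adjoin_gen p q
  finrank_eq := finrank_R p q
  rev_eq := rev_gen p q
  even_eq := rfl

namespace IsRSystem

variable {A : Type*} [Ring A] [Algebra ℝ A] {p q : ℕ} {τ : A →ₐ[ℝ] Aᵐᵒᵖ}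
    {S : Subalgebra ℝ A} {e : Fin p ⊕ Fin q → A}

/-- Only the products ε_i ε_j enter the relations, so the two kinds of generators may change roles.
Statements about the first kind thereby apply to the second. -/
theorem swap (h : IsRSystem τ S e) : IsRSystem (p := q) (q := p) τ S (e ∘ Sum.swap) where
  sq i := h.sq _
  comm i j hij := by
    rw [Function.comp_apply, Function.comp_apply, h.comm _ _ (Sum.swap_leftInverse.injective.ne hij)]
    congr 2
    rcases i with i | i <;> rcases j with j | j <;> simp [sgn]
  adjoin_eq := by
    rw [show Set.range (e ∘ Sum.swap) = Set.range e from
      (Equiv.sumComm (Fin q) (Fin p)).surjective.range_comp e, h.adjoin_eq]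
  finrank_eq := by rw [h.finrank_eq, add_comm]
  rev_eq i := h.rev_eq _
  even_eq := by
    rw [h.even_eq]
    congr 1
    ext x
    constructor
    · rintro ⟨i, j, hij, rfl⟩
      exact ⟨i.swap, j.swap, Sum.swap_leftInverse.injective.ne hij, by simp⟩
    · rintro ⟨i, j, hij, rfl⟩
      exact ⟨i.swap, j.swap, Sum.swap_leftInverse.injective.ne hij, rfl⟩

variable (h : IsRSystem τ S e)

include h

theorem mul_mem (i j : Fin p ⊕ Fin q) : e i * e j ∈ S := by
  rcases eq_or_ne i j with rfl | hij
  · rw [h.sq]; exact one_mem _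
  · rw [h.even_eq]; exact Algebra.subset_adjoin ⟨i, j, hij, rfl⟩

theorem conj_mem {s : A} (hs : s ∈ S) : ∀ i j, e i * s * e j ∈ S := by
  rw [h.even_eq] at hs
  induction hs using Algebra.adjoin_induction with
  | mem x hx =>
    obtain ⟨k, l, -, rfl⟩ := hx
    intro i j
    rw [← mul_assoc, mul_assoc]
    exact S.mul_mem (h.mul_mem _ _) (h.mul_mem _ _)
  | algebraMap r =>
    intro i j
    rw [← Algebra.commutes, mul_assoc]
    exact S.mul_mem (S.algebraMap_mem r) (h.mul_mem _ _)
  | add x y _ _ hx hy =>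
    intro i j
    rw [mul_add, add_mul]
    exact add_mem (hx i j) (hy i j)
  | mul x y _ _ hx hy =>
    intro i j
    -- The factor e_i e_i = 1 is inserted between x and y.
    have := S.mul_mem (hx i i) (hy i j)
    rwa [show e i * x * e i * (e i * y * e j) = e i * x * (e i * e i) * y * e j by noncomm_ring,
      h.sq, mul_one, show e i * x * y * e j = e i * (x * y) * e j by noncomm_ring] at this

/-- `R_{p,q} = R^+ + R^+ e_i`. -/
theorem exists_add_mul (i : Fin p ⊕ Fin q) (a : A) : ∃ b ∈ S, ∃ c ∈ S, a = b + c * e i := by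
  have ha : a ∈ Algebra.adjoin ℝ (Set.range e) := by rw [h.adjoin_eq]; trivial
  -- The sum R⁺ + R⁺ e_i contains 1 and is stable under left multiplication: e_j (b + c e_i) = e_j c
  -- e_i + (e_j b e_i) e_i.
  suffices hs : ∀ x, (∃ b ∈ S, ∃ c ∈ S, x = b + c * e i) →
      ∃ b ∈ S, ∃ c ∈ S, a * x = b + c * e i by
    simpa using hs 1 ⟨1, one_mem _, 0, zero_mem _, by simp⟩
  induction ha using Algebra.adjoin_induction with
  | mem x hx =>
    obtain ⟨j, rfl⟩ := hx
    rintro _ ⟨b, hb, c, hc, rfl⟩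
    refine ⟨e j * c * e i, h.conj_mem hc _ _, e j * b * e i, h.conj_mem hb _ _, ?_⟩
    rw [mul_assoc _ (e i), h.sq]; noncomm_ring
  | algebraMap r =>
    rintro _ ⟨b, hb, c, hc, rfl⟩
    exact ⟨_, S.mul_mem (S.algebraMap_mem r) hb, _, S.mul_mem (S.algebraMap_mem r) hc, by
      noncomm_ring⟩
  | add x y _ _ hx hy =>
    intro z hz
    obtain ⟨b, hb, c, hc, h1⟩ := hx z hz
    obtain ⟨b', hb', c', hc', h2⟩ := hy z hz
    exact ⟨_, add_mem hb hb', _, add_mem hc hc', by rw [add_mul, h1, h2]; noncomm_ring⟩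
  | mul x y _ _ hx hy =>
    intro z hz
    rw [mul_assoc]
    exact hx _ (hy _ hz)

end IsRSystem

/-! ### The even algebra as a Clifford algebra. -/

namespace IsRSystem

variable {A : Type*} [Ring A] [Algebra ℝ A] {p q : ℕ} {τ : A →ₐ[ℝ] Aᵐᵒᵖ}
    {S : Subalgebra ℝ A} {e : Fin (p + 1) ⊕ Fin q → A} (h : IsRSystem τ S e)

/-- Enumeration of the indices different from the first one. -/
def restIndex (p q : ℕ) : Fin q ⊕ Fin p → Fin (p + 1) ⊕ Fin q :=
  Sum.elim .inr fun i => .inl i.succ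

theorem restIndex_ne (k : Fin q ⊕ Fin p) : (.inl 0 : Fin (p + 1) ⊕ Fin q) ≠ restIndex p q k := by
  rcases k with k | k
  · simp [restIndex]
  · simpa [restIndex] using (Fin.succ_ne_zero k).symm

theorem restIndex_injective : Function.Injective (restIndex p q) := by
  rintro (k | k) (l | l) hkl <;> simpa [restIndex] using hkl

/-- The remaining indices of the second kind are listed first because e_1 commutes with e_j for
them, so that e_1 e_j has square 1; for the others it has square -1. -/
theorem sgn_restIndex (k : Fin q ⊕ Fin p) : sgn (p + 1) q (restIndex p q k) = -sgn q p k := by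
  rcases k with k | k <;> simp [sgn, restIndex]

theorem eq_zero_or_restIndex (i : Fin (p + 1) ⊕ Fin q) : i = .inl 0 ∨ ∃ k, i = restIndex p q k := by
  rcases i with i | i
  · refine Fin.cases (Or.inl rfl) (fun j => Or.inr ⟨.inr j, rfl⟩) i
  · exact Or.inr ⟨.inl i, rfl⟩

include h

theorem zero_mul_rest (k : Fin q ⊕ Fin p) :
    e (.inl 0) * e (restIndex p q k) = sgn q p k • (e (restIndex p q k) * e (.inl 0)) := by
  rw [h.comm _ _ (restIndex_ne k), sgn_restIndex]
  simp [sgn]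

/-- The products `e_1 e_j`, as elements of the even algebra. -/
def evenGen (k : Fin q ⊕ Fin p) : S := ⟨e (.inl 0) * e (restIndex p q k), h.mul_mem _ _⟩

theorem evenGen_mul_evenGen (k l : Fin q ⊕ Fin p) : (h.evenGen k * h.evenGen l : A)
    = sgn q p k • (e (restIndex p q k) * e (restIndex p q l)) :=
  calc e (.inl 0) * e (restIndex p q k) * (e (.inl 0) * e (restIndex p q l))
      = sgn q p k • (e (restIndex p q k) * e (.inl 0)) * (e (.inl 0) * e (restIndex p q l)) := by
        rw [← h.zero_mul_rest]
    _ = sgn q p k • (e (restIndex p q k) * (e (.inl 0) * e (.inl 0)) * e (restIndex p q l)) := by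
        rw [smul_mul_assoc]; congr 1; noncomm_ring
    _ = _ := by rw [h.sq, mul_one]

/-- With e_1² = 1, the product (e_1 e_k)(e_1 e_l) is ± e_k e_l, with the sign that arises when e_1
passes e_k. -/
theorem isCliffordFamily_evenGen : IsCliffordFamily (sgn q p) h.evenGen where
  sq k := Subtype.ext <| (h.evenGen_mul_evenGen k k).trans (by rw [h.sq]; rfl)
  anti k l hkl := Subtype.ext <| by
    refine (h.evenGen_mul_evenGen k l).trans ?_
    change _ = -(h.evenGen l * h.evenGen k : A)
    rw [h.evenGen_mul_evenGen, h.comm _ _ (restIndex_injective.ne hkl), sgn_restIndex,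
      sgn_restIndex, smul_smul, ← neg_smul]
    congr 1
    linear_combination (-sgn q p l) * sgn_sq q p k

/-- Reversal gives e_j e_1, which is e_1 e_j times the sign of its square. This is the sign required
of the star in `IsCliffordModel`. -/
theorem rev_evenGen (k : Fin q ⊕ Fin p) :
    τ (h.evenGen k) = MulOpposite.op ((sgn q p k • h.evenGen k : S) : A) := by
  change τ (e (.inl 0) * e (restIndex p q k)) =
    MulOpposite.op (sgn q p k • (e (.inl 0) * e (restIndex p q k)))
  rw [map_mul, h.rev_eq, h.rev_eq, ← MulOpposite.op_mul, h.zero_mul_rest, smul_smul, sgn_sq,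
    one_smul]

/-- Because e_1² = 1, one has e_i e_j = (e_i e_1)(e_1 e_j). -/
theorem adjoin_evenGen : Algebra.adjoin ℝ (Set.range h.evenGen) = ⊤ := by
  have key : S = (Algebra.adjoin ℝ (Set.range h.evenGen)).map S.val := by
    refine le_antisymm ?_ ?_
    · conv_lhs => rw [h.even_eq]
      refine Algebra.adjoin_le ?_
      have h0 : ∀ k, e (.inl 0) * e (restIndex p q k)
          ∈ (Algebra.adjoin ℝ (Set.range h.evenGen)).map S.val :=
        fun k => ⟨h.evenGen k, adjoin_mem_range _ k, rfl⟩
      have h0' : ∀ k, e (restIndex p q k) * e (.inl 0)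
          ∈ (Algebra.adjoin ℝ (Set.range h.evenGen)).map S.val := fun k => by
        have := Subalgebra.smul_mem _ (h0 k) (sgn q p k)
        rwa [h.zero_mul_rest, smul_smul, sgn_sq, one_smul] at this
      rintro _ ⟨i, j, hij, rfl⟩
      rcases eq_zero_or_restIndex i with rfl | ⟨k, rfl⟩ <;>
        rcases eq_zero_or_restIndex j with rfl | ⟨l, rfl⟩
      · exact absurd rfl hij
      · exact h0 l
      · exact h0' k
      · have := Subalgebra.mul_mem _ (h0' k) (h0 l)
        rwa [mul_assoc, ← mul_assoc (e (.inl 0)), h.sq, one_mul] at this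
    · rintro _ ⟨x, -, rfl⟩
      exact x.2
  rw [eq_top_iff]
  rintro x -
  obtain ⟨y, hy, hxy⟩ := key.le x.2
  rwa [← Subtype.ext hxy]

/-- The Clifford generators give the upper bound. The lower bound holds because A = S + S e_1 has at
most twice the dimension of S. -/
theorem finrank_even : Module.Finite ℝ S ∧ Module.finrank ℝ S = 2 ^ (p + q) := by
  obtain ⟨h1, h2⟩ := h.isCliffordFamily_evenGen.finite h.adjoin_evenGen
  refine ⟨h1, le_antisymm (by simpa [add_comm] using h2) ?_⟩
  set φ : S × S →ₗ[ℝ] A := LinearMap.coprod S.val.toLinearMap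
    ((LinearMap.mulRight ℝ (e (.inl 0))).comp S.val.toLinearMap) with hφ
  have hs : Function.Surjective φ := by
    intro a
    obtain ⟨b, hb, c, hc, rfl⟩ := h.exists_add_mul (.inl 0) a
    exact ⟨(⟨b, hb⟩, ⟨c, hc⟩), by simp [hφ]⟩
  have h3 := LinearMap.finrank_le_finrank_of_surjective hs
  rw [h.finrank_eq, Module.finrank_prod, pow_add, pow_succ] at h3
  rw [pow_add]
  nlinarith

/-- The even algebra is isomorphic, as an algebra with involution, to any model of the Clifford
algebra of signature `(q, p - 1)`. -/
theorem exists_even_equiv {D : Type*} [Ring D] [StarRing D] [Algebra ℝ D]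
    [StarModule ℝ D] (hD : HasCliffordModel q p D) : ∃ E : S ≃ₐ[ℝ] D, ∀ a : S, ∃ b : S,
      τ a.1 = MulOpposite.op b.1 ∧ E b = star (E a) := by
  obtain ⟨F, hF⟩ := hD
  obtain ⟨φ, hφ⟩ := hF.toIsCliffordFamily.exists_hom hF.adjoin_eq hF.finrank_eq.ge
    h.isCliffordFamily_evenGen
  obtain ⟨h1, h2⟩ := h.finrank_even
  have hs : Function.Surjective φ := by
    rw [← AlgHom.range_eq_top, eq_top_iff, ← h.adjoin_evenGen]
    refine Algebra.adjoin_le ?_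
    rintro _ ⟨i, rfl⟩
    exact ⟨_, hφ i⟩
  have : Module.Finite ℝ D := (hF.toIsCliffordFamily.finite hF.adjoin_eq).1
  have hi : Function.Injective φ.toLinearMap :=
    (LinearMap.injective_iff_surjective_of_finrank_eq_finrank
      (by rw [h2, hF.finrank_eq]; simp [add_comm])).2 hs
  obtain ⟨E, hE'⟩ : ∃ E : S ≃ₐ[ℝ] D, ∀ x, E (φ x) = x :=
    ⟨(AlgEquiv.ofBijective φ ⟨hi, hs⟩).symm, fun x =>
      (AlgEquiv.ofBijective φ ⟨hi, hs⟩).symm_apply_apply x⟩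
  have hE : ∀ k, E (h.evenGen k) = F k := fun k => by
    rw [← hφ, hE']
  refine ⟨E, fun a => ?_⟩
  -- Both `τ` and the star reverse products, so their agreement need only be checked on generators.
  have ha : a ∈ Algebra.adjoin ℝ (Set.range h.evenGen) := by rw [h.adjoin_evenGen]; trivial
  induction ha using Algebra.adjoin_induction with
  | mem x hx =>
    obtain ⟨k, rfl⟩ := hx
    exact ⟨_, h.rev_evenGen k, by rw [map_smul, hE, hF.star_eq]⟩
  | algebraMap r =>
    refine ⟨algebraMap ℝ S r, τ.commutes r, ?_⟩
    rw [AlgEquiv.commutes, Algebra.algebraMap_eq_smul_one, star_smul, star_one, star_trivial]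
  | add x y _ _ hx hy =>
    obtain ⟨b, hb, hb'⟩ := hx
    obtain ⟨c, hc, hc'⟩ := hy
    exact ⟨b + c, by rw [Subalgebra.coe_add, map_add, hb, hc]; rfl,
      by rw [map_add, map_add, star_add, hb', hc']⟩
  | mul x y _ _ hx hy =>
    obtain ⟨b, hb, hb'⟩ := hx
    obtain ⟨c, hc, hc'⟩ := hy
    exact ⟨c * b, by rw [Subalgebra.coe_mul, map_mul, hb, hc]; rfl,
      by rw [map_mul, map_mul, star_mul, hb', hc']⟩

end IsRSystem

/-! ### Products of anticommuting elements -/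

section Volume

variable {A : Type*} [Ring A] [Algebra ℝ A]

/-- The sign `(-1) ^ (n (n - 1) / 2)`. -/
def volSign : ℕ → ℝ
  | 0 => 1
  | n + 1 => (-1) ^ n * volSign n

theorem volSign_eq (n : ℕ) : volSign n = if n % 4 < 2 then 1 else -1 := by
  induction n using Nat.strong_induction_on with
  | _ n ih =>
    rcases n with _ | _ | _ | _ | n
    · simp [volSign]
    · simp [volSign]
    · simp [volSign]
    · simp [volSign]
    · have : volSign (n + 4) = volSign n := by
        simp only [volSign, pow_succ]
        have : ((-1 : ℝ) ^ n) * (-1) ^ n = 1 := by rw [← mul_pow]; simp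
        linear_combination (((-1 : ℝ) ^ n) * (-1) ^ n + 1) * volSign n * this
      rw [this, ih n (by omega), show (n + 4) % 4 = n % 4 by omega]

theorem anticomm_prod (a : A) (l : List A) (h : ∀ x ∈ l, a * x = -(x * a)) :
    a * l.prod = (-1 : ℝ) ^ l.length • (l.prod * a) := by
  induction l with
  | nil => simp
  | cons x l ih =>
    have ih' := ih fun y hy => h y (List.mem_cons_of_mem _ hy)
    rw [List.prod_cons, ← mul_assoc, h x List.mem_cons_self, neg_mul, mul_assoc, ih',
      List.length_cons, pow_succ, mul_smul_comm, mul_neg_one, neg_smul, mul_assoc]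

/-- The element commutes with itself and anticommutes with the other factors, one fewer than the
length; the exponent has the same parity. -/
theorem mem_mul_prod (l : List A) (hsq : ∀ x ∈ l, x * x = 1)
    (hl : l.Pairwise fun x y => y * x = -(x * y)) (a : A) (ha : a ∈ l) :
    a * l.prod = (-1 : ℝ) ^ (l.length + 1) • (l.prod * a) := by
  induction l with
  | nil => simp at ha
  | cons x l ih =>
    rw [List.pairwise_cons] at hl
    rcases List.mem_cons.1 ha with rfl | ha'
    · have := anticomm_prod a l fun y hy => by rw [hl.1 y hy, neg_neg]
      rw [List.prod_cons, ← mul_assoc, mul_assoc a l.prod, List.length_cons, pow_add,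
        ← mul_smul_comm, pow_succ]
      have h2 : (-1 : ℝ) ^ l.length * (-1) * (-1) ^ 1 = (-1) ^ l.length := by ring
      rw [h2, ← this]
      noncomm_ring
    · rw [List.prod_cons, ← mul_assoc, hl.1 a ha', neg_mul, mul_assoc,
        ih (fun y hy => hsq y (List.mem_cons_of_mem _ hy)) hl.2 ha', List.length_cons,
        pow_succ _ (l.length + 1), mul_smul_comm, mul_neg_one, neg_smul, mul_assoc]

/-- The product times its reversal is 1, so the square is the sign of the reversal. -/
theorem prod_mul_prod (l : List A) (hsq : ∀ x ∈ l, x * x = 1)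
    (hl : l.Pairwise fun x y => y * x = -(x * y)) :
    l.prod * l.prod = volSign l.length • (1 : A) := by
  induction l with
  | nil => simp [volSign]
  | cons x l ih =>
    rw [List.pairwise_cons] at hl
    have h1 := ih (fun y hy => hsq y (List.mem_cons_of_mem _ hy)) hl.2
    have h2 := anticomm_prod x l fun y hy => by rw [hl.1 y hy, neg_neg]
    have h3 : l.prod * x = (-1 : ℝ) ^ l.length • (x * l.prod) := by
      rw [h2, smul_smul, ← mul_pow]; simp
    rw [List.prod_cons, show x * l.prod * (x * l.prod) = x * (l.prod * x) * l.prod by noncomm_ring,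
      h3, mul_smul_comm, smul_mul_assoc,
      show x * (x * l.prod) * l.prod = x * x * (l.prod * l.prod) by noncomm_ring,
      hsq x List.mem_cons_self, h1, one_mul, smul_smul]
    rfl

/-- Reversing n anticommuting factors takes n (n - 1) / 2 transpositions. -/
theorem rev_prod (τ : A →ₐ[ℝ] Aᵐᵒᵖ) (l : List A) (hτ : ∀ x ∈ l, τ x = MulOpposite.op x)
    (hl : l.Pairwise fun x y => y * x = -(x * y)) :
    τ l.prod = MulOpposite.op (volSign l.length • l.prod) := by
  induction l with
  | nil => simp [volSign]
  | cons x l ih =>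
    rw [List.pairwise_cons] at hl
    have h1 := ih (fun y hy => hτ y (List.mem_cons_of_mem _ hy)) hl.2
    have h2 := anticomm_prod x l fun y hy => by rw [hl.1 y hy, neg_neg]
    have h3 : l.prod * x = (-1 : ℝ) ^ l.length • (x * l.prod) := by
      rw [h2, smul_smul, ← mul_pow]; simp
    rw [List.prod_cons, map_mul, h1, hτ x List.mem_cons_self, ← MulOpposite.op_mul, smul_mul_assoc,
      h3, smul_smul, mul_comm]
    rfl

end Volume

/-! ### Volume elements, and isomorphisms of R_{p,q} built from the even algebra and an odd element.
-/

namespace IsRSystem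

variable {A : Type*} [Ring A] [Algebra ℝ A] {p q : ℕ} {τ : A →ₐ[ℝ] Aᵐᵒᵖ}
    {S : Subalgebra ℝ A} {e : Fin p ⊕ Fin q → A} (h : IsRSystem τ S e)

include h

theorem prod_mem (l : List (Fin p ⊕ Fin q)) :
    (Even l.length → (l.map e).prod ∈ S) ∧
      (Odd l.length → ∀ i, e i * (l.map e).prod ∈ S) := by
  induction l with
  | nil => exact ⟨fun _ => by simpa using one_mem S, fun h => by simp at h⟩
  | cons j l ih =>
    rw [List.map_cons, List.prod_cons, List.length_cons]
    refine ⟨fun hl => ih.2 (by grind) j, fun hl i => ?_⟩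
    rw [← mul_assoc]
    exact S.mul_mem (h.mul_mem i j) (ih.1 (by grind))

/-- The product of the generators of the first kind. -/
theorem exists_volume : ∃ w : A, (∀ a, (∀ i, Commute a (e (.inl i))) → Commute a w) ∧
    (∀ i, e (.inl i) * w = (-1 : ℝ) ^ (p + 1) • (w * e (.inl i))) ∧
    w * w = volSign p • (1 : A) ∧ τ w = MulOpposite.op (volSign p • w) ∧
    (Even p → w ∈ S) ∧ (Odd p → ∀ i, e i * w ∈ S) := by
  set l : List (Fin p ⊕ Fin q) := List.ofFn .inl with hl
  have hlen : l.length = p := by simp [hl]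
  have hlen' : (l.map e).length = p := by simp [hl]
  have hmem : ∀ x ∈ l.map e, ∃ i, x = e (.inl i) := by
    intro x hx
    simp only [hl, List.map_ofFn, List.mem_ofFn] at hx
    obtain ⟨i, rfl⟩ := hx
    exact ⟨i, rfl⟩
  have hmem' : ∀ i, e (.inl i) ∈ l.map e := by
    intro i
    simp only [hl, List.map_ofFn, List.mem_ofFn]
    exact ⟨i, rfl⟩
  have hsq : ∀ x ∈ l.map e, x * x = 1 := fun x hx => by
    obtain ⟨i, rfl⟩ := hmem x hx; exact h.sq _
  have hp : (l.map e).Pairwise fun x y => y * x = -(x * y) := by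
    rw [hl, List.map_ofFn, List.pairwise_ofFn]
    intro i j hij
    rw [Function.comp_apply, Function.comp_apply, h.comm _ _ (by simpa using hij.ne')]
    simp [sgn]
  refine ⟨(l.map e).prod, fun a ha => Commute.list_prod_right _ _ fun x hx => ?_, fun i => ?_,
    ?_, ?_, ?_, ?_⟩
  · obtain ⟨i, rfl⟩ := hmem x hx; exact ha i
  · rw [mem_mul_prod _ hsq hp _ (hmem' i), hlen']
  · rw [prod_mul_prod _ hsq hp, hlen']
  · rw [rev_prod τ _ (fun x hx => by obtain ⟨i, rfl⟩ := hmem x hx; exact h.rev_eq _) hp, hlen']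
  · exact fun hp' => (h.prod_mem l).1 (by rwa [hlen])
  · exact fun hp' => (h.prod_mem l).2 (by rwa [hlen])

theorem commute_of_gen {a : A} (ha : ∀ i, Commute a (e i)) (b : A) : Commute a b :=
  (commute_of_adjoin h.adjoin_eq (AlgHom.id ℝ A) a
    (by rintro _ ⟨i, rfl⟩; exact (ha i).symm) b).symm

/-- If `p` is odd, then there is a central odd element with square `±1`. -/
theorem exists_central_odd (hp : Odd p) : ∃ z : A, (∀ a, Commute z a) ∧
    z * z = volSign p • (1 : A) ∧ τ z = MulOpposite.op (volSign p • z) ∧ ∀ i, e i * z ∈ S := by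
  obtain ⟨w, h1, h2, h3, h4, -, h6⟩ := h.exists_volume
  -- The product of the generators of the first kind commutes with each of them because p is odd,
  -- and with the second kind in any case.
  refine ⟨w, h.commute_of_gen ?_, h3, h4, h6 hp⟩
  rintro (i | i)
  · have := h2 i
    rw [Even.neg_one_pow (by grind), one_smul] at this
    exact this.symm
  · refine (h1 _ fun j => ?_).symm
    rw [Commute, SemiconjBy, h.comm _ _ (by simp)]
    simp [sgn]

/-- If `p` and `q` are even, then there is an even element with square `±1` that anticommutes with
the generators. -/
theorem exists_anticentral_even (hp : Even p) (hq : Even q) : ∃ w ∈ S,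
    (∀ i, e i * w = -(w * e i)) ∧ w * w = (volSign p * volSign q) • (1 : A) ∧
      τ w = MulOpposite.op ((volSign p * volSign q) • w) := by
  obtain ⟨v, h1, h2, h3, h4, h5, -⟩ := h.exists_volume
  obtain ⟨w, k1, k2, k3, k4, k5, -⟩ := h.swap.exists_volume
  simp only [Function.comp_apply, Sum.swap_inl] at k1 k2
  have c1 : ∀ j, Commute (e (.inr j)) v := fun j => h1 _ fun i => by
    rw [Commute, SemiconjBy, h.comm _ _ (by simp)]; simp [sgn]
  have c2 : ∀ i, Commute (e (.inl i)) w := fun i => k1 _ fun j => by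
    rw [Commute, SemiconjBy, h.comm _ _ (by simp)]; simp [sgn]
  have c3 : Commute v w := k1 _ fun j => (c1 j).symm
  -- Each of the two volume elements anticommutes with its own generators, their number being even,
  -- and commutes with the other kind.
  refine ⟨v * w, S.mul_mem (h5 hp) (k5 hq), ?_, ?_, ?_⟩
  · rintro (i | i)
    · rw [← mul_assoc, h2, Odd.neg_one_pow (by grind), neg_one_smul, neg_mul, mul_assoc, (c2 i).eq,
        mul_assoc]
    · rw [← mul_assoc, (c1 i).eq, mul_assoc, k2, Odd.neg_one_pow (by grind), neg_one_smul, mul_neg,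
        mul_assoc]
  · rw [show v * w * (v * w) = v * (w * v) * w by noncomm_ring, ← c3.eq,
      show v * (v * w) * w = (v * v) * (w * w) by noncomm_ring, h3, k3, smul_mul_smul_comm, one_mul]
  · rw [map_mul, h4, k4, ← MulOpposite.op_mul, smul_mul_smul_comm, c3.eq, mul_comm]

/-- An algebra generated by a system of generators of full dimension is `R_{p,q}`. -/
theorem exists_equiv_R : ∃ φ : R p q ≃ₐ[ℝ] A, ∀ i, φ (gen p q i) = e i := by
  have hs : Function.Surjective (liftR e h.toIsRFamily) := by
    rw [← AlgHom.range_eq_top, eq_top_iff, ← h.adjoin_eq]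
    refine Algebra.adjoin_le ?_
    rintro _ ⟨i, rfl⟩
    exact ⟨_, liftR_gen e h.toIsRFamily i⟩
  have := finite_R p q
  have : Module.Finite ℝ A := Module.Finite.of_surjective (liftR e h.toIsRFamily).toLinearMap hs
  have hi : Function.Injective (liftR e h.toIsRFamily).toLinearMap :=
    (LinearMap.injective_iff_surjective_of_finrank_eq_finrank
      (by rw [finrank_R, h.finrank_eq])).2 hs
  exact ⟨AlgEquiv.ofBijective (liftR e h.toIsRFamily) ⟨hi, hs⟩, liftR_gen e h.toIsRFamily⟩

/-- An isomorphism `μ` of the even algebra onto a subalgebra of `D` and an element `Y` of `D`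
corresponding to an odd element `y` define an isomorphism of `R_{p,q}` onto `D`. -/
theorem exists_equiv_of_even {D : Type*} [Ring D] [Algebra ℝ D] (μ : S →ₐ[ℝ] D) {y : A} {σ : ℝ}
    (hσ : σ * σ = 1) (hy : y * y = σ • (1 : A)) (i₀ : Fin p ⊕ Fin q)
    (hy1 : ∀ i, e i * y ∈ S) (hy2 : ∀ i, y * e i ∈ S) {Y : D}
    (hY : Y * Y = σ • (1 : D)) (hYμ : ∀ s s' : S, (s' : A) * y = y * s → μ s' * Y = Y * μ s)
    (hsurj : ∀ d, ∃ a b, d = μ a + μ b * Y) (hdim : Module.finrank ℝ D = 2 ^ (p + q)) :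
    ∃ E : A ≃ₐ[ℝ] D, (∀ s : S, E s = μ s) ∧ E y = Y := by
  -- The formula is forced: e_i = σ (e_i y) y with e_i y even.
  set g : Fin p ⊕ Fin q → D := fun i => σ • (μ ⟨e i * y, hy1 i⟩ * Y) with hg
  have hgg : ∀ i j, g i * g j = μ ⟨e i * e j, h.mul_mem i j⟩ := by
    intro i j
    -- From (y e_j) y = y (e_j y), the element Y can be moved past μ(e_j y). In g_i g_j the two Y
    -- then meet and give σ.
    have h1 := hYμ ⟨e j * y, hy1 j⟩ ⟨y * e j, hy2 j⟩ (by simp [mul_assoc])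
    have h2 : (⟨e i * y, hy1 i⟩ : S) * ⟨y * e j, hy2 j⟩ = σ • ⟨e i * e j, h.mul_mem i j⟩ :=
      Subtype.ext <| by
        change e i * y * (y * e j) = σ • (e i * e j)
        rw [show e i * y * (y * e j) = e i * (y * y) * e j by noncomm_ring, hy]
        simp
    simp only [hg]
    rw [smul_mul_smul_comm, hσ, one_smul, mul_assoc, ← mul_assoc Y, ← h1, mul_assoc _ Y Y, hY,
      ← mul_assoc, ← map_mul, h2, map_smul, mul_smul_comm, mul_one, smul_smul, hσ, one_smul]
  have hfam : IsRFamily g := by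
    refine ⟨fun i => ?_, fun i j hij => ?_⟩
    · rw [hgg, ← map_one μ]
      congr 1
      exact Subtype.ext (h.sq i)
    · rw [hgg, hgg, ← map_smul]
      congr 1
      exact Subtype.ext (h.comm i j hij)
  obtain ⟨φ, hφ⟩ := h.exists_equiv_R
  set ψ : A →ₐ[ℝ] D := (liftR g hfam).comp (φ.symm : A →ₐ[ℝ] R p q) with hψ
  have hψe : ∀ i, ψ (e i) = g i := fun i => by
    rw [hψ, AlgHom.comp_apply, ← hφ i]
    simp [liftR_gen]
  have hψS : ∀ s : S, ψ s = μ s := by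
    rintro ⟨x, hx⟩
    have hx' := hx
    rw [h.even_eq] at hx'
    change ψ x = _
    induction hx' using Algebra.adjoin_induction with
    | mem x hx' =>
      obtain ⟨i, j, -, rfl⟩ := hx'
      rw [map_mul, hψe, hψe, hgg]
    | algebraMap r =>
      rw [AlgHom.commutes]
      exact (μ.commutes r).symm
    | add x y hx1 hy1 ihx ihy =>
      rw [← h.even_eq] at hx1 hy1
      rw [map_add, ihx hx1, ihy hy1, ← map_add]
      rfl
    | mul x y hx1 hy1 ihx ihy =>
      rw [← h.even_eq] at hx1 hy1
      rw [map_mul, ihx hx1, ihy hy1, ← map_mul]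
      rfl
  have hψy : ψ y = Y := by
    -- Writing y = (y e_{i₀}) e_{i₀} reduces y to an even element and a generator.
    have h1 : ψ y = ψ (y * e i₀) * ψ (e i₀) := by rw [← map_mul, mul_assoc, h.sq, mul_one]
    rw [h1, hψe, show ψ (y * e i₀) = μ ⟨y * e i₀, hy2 i₀⟩ from hψS ⟨_, hy2 i₀⟩]
    simp only [hg]
    rw [mul_smul_comm, ← mul_assoc, ← map_mul]
    have h2 : (⟨y * e i₀, hy2 i₀⟩ : S) * ⟨e i₀ * y, hy1 i₀⟩ = σ • 1 := Subtype.ext <| by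
      change y * e i₀ * (e i₀ * y) = σ • 1
      rw [show y * e i₀ * (e i₀ * y) = y * (e i₀ * e i₀) * y by noncomm_ring, h.sq, mul_one, hy]
    rw [h2, map_smul, map_one, smul_mul_assoc, one_mul, smul_smul, hσ, one_smul]
  have hs : Function.Surjective ψ := fun d => by
    obtain ⟨a, b, rfl⟩ := hsurj d
    exact ⟨a + b * y, by rw [map_add, map_mul, hψS, hψS, hψy]⟩
  have := finite_R p q
  have : Module.Finite ℝ A := Module.Finite.equiv φ.toLinearEquiv
  have : Module.Finite ℝ D := Module.Finite.of_surjective ψ.toLinearMap hs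
  have hi : Function.Injective ψ.toLinearMap :=
    (LinearMap.injective_iff_surjective_of_finrank_eq_finrank
      (by rw [hdim, h.finrank_eq])).2 hs
  exact ⟨AlgEquiv.ofBijective ψ ⟨hi, hs⟩, hψS, hψy⟩

end IsRSystem

/-! ### The even algebra as a complexification -/

section Complexification

variable {r : ℕ}

theorem map_re_mul {l m n : Type*} [Fintype m] (X : Matrix l m ℂ) (Y : Matrix m n ℂ) : (X * Y).map Complex.re
    = X.map Complex.re * Y.map Complex.re - X.map Complex.im * Y.map Complex.im := by
  ext i j
  simp [Matrix.mul_apply, Finset.sum_sub_distrib]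

theorem map_im_mul {l m n : Type*} [Fintype m] (X : Matrix l m ℂ) (Y : Matrix m n ℂ) : (X * Y).map Complex.im
    = X.map Complex.re * Y.map Complex.im + X.map Complex.im * Y.map Complex.re := by
  ext i j
  simp [Matrix.mul_apply, Finset.sum_add_distrib]

/-- The extension of a representation of `M(r; ℝ)` to `M(r; ℂ)` defined by a commuting square root
of `-1`. -/
def complexify {B : Type*} [Ring B] [Algebra ℝ B] (G : Matrix (Fin r) (Fin r) ℝ →ₐ[ℝ] B) (w : B)
    (hw : w * w = -1) (hc : ∀ b, Commute w b) : Matrix (Fin r) (Fin r) ℂ →ₐ[ℝ] B :=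
  AlgHom.ofLinearMap
    { toFun := fun X => G (X.map Complex.re) + w * G (X.map Complex.im)
      map_add' := fun X Y => by
        have h1 : (X + Y).map Complex.re = X.map Complex.re + Y.map Complex.re := by ext; simp
        have h2 : (X + Y).map Complex.im = X.map Complex.im + Y.map Complex.im := by ext; simp
        rw [h1, h2, map_add, map_add]; noncomm_ring
      map_smul' := fun a X => by
        have h1 : (a • X).map Complex.re = a • X.map Complex.re := by ext; simp
        have h2 : (a • X).map Complex.im = a • X.map Complex.im := by ext; simp
        rw [h1, h2, map_smul, map_smul]; simp }
    (by
      have h1 : (1 : Matrix (Fin r) (Fin r) ℂ).map Complex.re = 1 := by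
        ext i j; by_cases h : i = j <;> simp [Matrix.one_apply, h]
      have h2 : (1 : Matrix (Fin r) (Fin r) ℂ).map Complex.im = 0 := by
        ext i j; by_cases h : i = j <;> simp [Matrix.one_apply, h]
      simp [h1, h2])
    (fun X Y => by
      change G ((X * Y).map Complex.re) + w * G ((X * Y).map Complex.im)
        = (G (X.map Complex.re) + w * G (X.map Complex.im)) *
          (G (Y.map Complex.re) + w * G (Y.map Complex.im))
      rw [map_re_mul, map_im_mul, map_sub, map_add, map_mul, map_mul, map_mul, map_mul]
      have h1 := (hc (G (X.map Complex.re))).eq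
      have h2 := (hc (G (X.map Complex.im))).eq
      generalize G (X.map Complex.re) = a at *
      generalize G (X.map Complex.im) = b at *
      generalize G (Y.map Complex.re) = c at *
      generalize G (Y.map Complex.im) = d at *
      rw [show (a + w * b) * (c + w * d) = a * c + a * w * d + w * b * c + w * (b * w) * d by
        noncomm_ring, ← h1, ← h2, ← mul_assoc, hw]
      noncomm_ring)

theorem complexify_apply {B : Type*} [Ring B] [Algebra ℝ B]
    (G : Matrix (Fin r) (Fin r) ℝ →ₐ[ℝ] B) (w : B)
    (hw : w * w = -1) (hc : ∀ b, Commute w b) (X : Matrix (Fin r) (Fin r) ℂ) :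
    complexify G w hw hc X = G (X.map Complex.re) + w * G (X.map Complex.im) := rfl

end Complexification

namespace IsRSystem

/-- The two signs from a product of two generators cancel. -/
theorem commute_even {A : Type*} [Ring A] [Algebra ℝ A] {p q : ℕ} {τ : A →ₐ[ℝ] Aᵐᵒᵖ}
    {S : Subalgebra ℝ A} {e : Fin p ⊕ Fin q → A} (h : IsRSystem τ S e) {w : A}
    (hw : ∀ i, e i * w = -(w * e i)) {s : A} (hs : s ∈ S) : Commute w s := by
  rw [h.even_eq] at hs
  induction hs using Algebra.adjoin_induction with
  | mem x hx =>
    obtain ⟨i, j, -, rfl⟩ := hx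
    rw [Commute, SemiconjBy, mul_assoc, hw j, mul_neg, ← mul_assoc, ← mul_assoc, hw i, neg_mul,
      neg_neg]
  | algebraMap r => exact (Algebra.commutes r w).symm
  | add x y _ _ hx hy => exact hx.add_right hy
  | mul x y _ _ hx hy => exact hx.mul_right hy

variable {A : Type*} [Ring A] [Algebra ℝ A] {p q : ℕ} {τ : A →ₐ[ℝ] Aᵐᵒᵖ}
    {S : Subalgebra ℝ A} {e : Fin (p + 1) ⊕ Fin q → A} (h : IsRSystem τ S e)

include h

/-- Suppose that the even algebra contains a central square root `w` of `-1`, and that the odd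
element `y` anticommutes with `w` and commutes or anticommutes with the generators of the even
algebra. Then the even algebra is the complexification of the centralizer of `y` in it. -/
theorem exists_even_equiv_complex {w y : A} (hwS : w ∈ S) (hw : ∀ i, e i * w = -(w * e i))
    (hww : w * w = -1) (hτw : τ w = MulOpposite.op (-w)) (hyw : y * w = -(w * y)) {σ : ℝ}
    (hσ : σ * σ = 1) (hyy : y * y = σ • (1 : A)) (c : Fin q ⊕ Fin p → ℝ)
    (hc : ∀ k, c k = 1 ∨ c k = -1) (hyf : ∀ k, y * h.evenGen k = c k • (h.evenGen k * y : A))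
    {s t : ℕ} (ι : Fin s ⊕ Fin t → Fin q ⊕ Fin p) (hι : Function.Injective ι)
    (hδ : ∀ j, c (ι j) * sgn q p (ι j) = sgn s t j) (hst : s + t + 1 = p + q) {r : ℕ} (hr : 0 < r)
    (hD : HasCliffordModel s t (Fin 1 → Matrix (Fin r) (Fin r) ℝ)) :
    ∃ E : S ≃ₐ[ℝ] (Fin 1 → Matrix (Fin r) (Fin r) ℂ),
      (∀ a : S, ∃ b : S, τ a.1 = MulOpposite.op b.1 ∧ E b = star (E a)) ∧
      ∀ a b : S, (b : A) * y = y * a → E b 0 = (E a 0).map (starRingEnd ℂ) := by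
  obtain ⟨h1, h2⟩ := h.finrank_even
  set w' : S := ⟨w, hwS⟩ with hw'
  have hwc : ∀ b : S, Commute w' b := fun b => Subtype.ext (h.commute_even hw b.2).eq
  have hww' : w' * w' = -1 := Subtype.ext hww
  have hcc : ∀ k, c k * c k = 1 := fun k => by rcases hc k with h | h <;> rw [h] <;> norm_num
  -- A generator that anticommutes with y is multiplied by the central element w, which also
  -- anticommutes with y. All g_k then commute with y, and the altered ones have the sign of their
  -- square reversed.
  obtain ⟨g, hg⟩ : ∃ g : Fin q ⊕ Fin p → S,
      ∀ k, g k = if c k = 1 then h.evenGen k else w' * h.evenGen k := ⟨_, fun _ => rfl⟩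
  have hf := h.isCliffordFamily_evenGen
  have hgg : ∀ k, g k * g k = (c k * sgn q p k) • (1 : S) := by
    intro k
    rw [hg]
    split_ifs with hk
    · rw [hk, one_mul, hf.sq]
    · rw [(hc k).resolve_left hk, show w' * h.evenGen k * (w' * h.evenGen k)
        = w' * (h.evenGen k * w') * h.evenGen k by noncomm_ring, ← (hwc _).eq, ← mul_assoc, hww',
        mul_assoc, hf.sq, neg_one_mul, neg_one_mul, neg_smul]
  have hganti : ∀ k l, k ≠ l → g k * g l = -(g l * g k) := by
    intro k l hkl
    have key : ∀ x y : S, (x = 1 ∨ x = w') → (y = 1 ∨ y = w') →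
        (x * h.evenGen k) * (y * h.evenGen l) = -((y * h.evenGen l) * (x * h.evenGen k)) := by
      intro x y hx hy
      have hx' : ∀ b, Commute x b := fun b => by
        rcases hx with rfl | rfl
        exacts [Commute.one_left b, hwc b]
      have hy' : ∀ b, Commute y b := fun b => by
        rcases hy with rfl | rfl
        exacts [Commute.one_left b, hwc b]
      rw [show x * h.evenGen k * (y * h.evenGen l) = x * (h.evenGen k * y) * h.evenGen l by
        noncomm_ring, ← (hy' _).eq, show y * h.evenGen l * (x * h.evenGen k)
        = y * (h.evenGen l * x) * h.evenGen k by noncomm_ring, ← (hx' (h.evenGen l)).eq,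
        show x * (y * h.evenGen k) * h.evenGen l = x * y * (h.evenGen k * h.evenGen l) by
        noncomm_ring, hf.anti k l hkl, (hx' y).eq]
      noncomm_ring
    have hk : ∃ x, (x = 1 ∨ x = w') ∧ g k = x * h.evenGen k := by
      rw [hg]
      split_ifs
      exacts [⟨1, Or.inl rfl, (one_mul _).symm⟩, ⟨w', Or.inr rfl, rfl⟩]
    have hl : ∃ x, (x = 1 ∨ x = w') ∧ g l = x * h.evenGen l := by
      rw [hg]
      split_ifs
      exacts [⟨1, Or.inl rfl, (one_mul _).symm⟩, ⟨w', Or.inr rfl, rfl⟩]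
    obtain ⟨x, hx, hx'⟩ := hk
    obtain ⟨y, hy, hy'⟩ := hl
    rw [hx', hy', key x y hx hy]
  have hgτ : ∀ k, τ (g k) = MulOpposite.op (((c k * sgn q p k) • g k : S) : A) := by
    intro k
    rw [hg]
    split_ifs with hk
    · rw [hk, one_mul, h.rev_evenGen]
    · change τ (w * h.evenGen k) = MulOpposite.op ((c k * sgn q p k) • (w * h.evenGen k : A))
      rw [map_mul, hτw, h.rev_evenGen, ← MulOpposite.op_mul, (hc k).resolve_left hk]
      congr 1
      have := congrArg Subtype.val (hwc (h.evenGen k)).eq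
      change w * (h.evenGen k : A) = h.evenGen k * w at this
      rw [this]
      simp
  have hgy : ∀ k, Commute y (g k) := by
    intro k
    rw [hg, Commute, SemiconjBy]
    split_ifs with hk
    · rw [hyf, hk, one_smul]
    · change y * (w * h.evenGen k : A) = w * h.evenGen k * y
      rw [← mul_assoc, hyw, neg_mul, mul_assoc, hyf, (hc k).resolve_left hk, neg_one_smul, mul_neg,
        neg_neg, mul_assoc]
  obtain ⟨F, hF⟩ := hD
  have hfam : IsCliffordFamily (sgn s t) fun j => g (ι j) :=
    ⟨fun j => by rw [hgg, hδ], fun i j hij => hganti _ _ (hι.ne hij)⟩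
  obtain ⟨G, hG⟩ := hF.toIsCliffordFamily.exists_hom hF.adjoin_eq hF.finrank_eq.ge hfam
  -- On the real subalgebra generated by the selected g_k, `τ` is the transpose.
  have hGτ : ∀ x, τ (G x) = MulOpposite.op (G (star x) : A) := by
    intro x
    have hx : x ∈ Algebra.adjoin ℝ (Set.range F) := by rw [hF.adjoin_eq]; trivial
    induction hx using Algebra.adjoin_induction with
    | mem x hx =>
      obtain ⟨j, rfl⟩ := hx
      rw [hF.star_eq, map_smul, hG, hgτ, hδ]
    | algebraMap a =>
      rw [Algebra.algebraMap_eq_smul_one, star_smul, star_one, star_trivial, map_smul, map_one]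
      change τ (a • (1 : A)) = MulOpposite.op (a • (1 : A))
      rw [map_smul, map_one]; rfl
    | add x y _ _ hx hy =>
      rw [map_add, star_add, map_add, Subalgebra.coe_add, map_add, hx, hy]; rfl
    | mul x y _ _ hx hy =>
      rw [map_mul, star_mul, map_mul, Subalgebra.coe_mul, map_mul, hx, hy]; rfl
  have hGy : ∀ x, Commute y (G x) := fun x => by
    refine (commute_of_adjoin hF.adjoin_eq (S.val.comp G) y ?_ x).symm
    rintro _ ⟨j, rfl⟩
    change Commute (G (F j) : A) y
    rw [hG]
    exact (hgy _).symm
  set G₀ : Matrix (Fin r) (Fin r) ℝ →ₐ[ℝ] S :=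
    G.comp (AlgEquiv.funUnique ℝ (Fin 1) (Matrix (Fin r) (Fin r) ℝ)).symm with hG₀
  have hG₀τ : ∀ X, τ (G₀ X) = MulOpposite.op (G₀ Xᵀ : A) := fun X => by
    have := hGτ ((AlgEquiv.funUnique ℝ (Fin 1) (Matrix (Fin r) (Fin r) ℝ)).symm X)
    rw [show star ((AlgEquiv.funUnique ℝ (Fin 1) (Matrix (Fin r) (Fin r) ℝ)).symm X)
      = (AlgEquiv.funUnique ℝ (Fin 1) (Matrix (Fin r) (Fin r) ℝ)).symm Xᵀ from by
        ext i a b; simp] at this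
    exact this
  have hG₀y : ∀ X, Commute y (G₀ X) := fun X => hGy _
  -- Here w plays the role of i: `τ` sends w to -w and y anticommutes with w. So `τ` becomes the
  -- conjugate transpose and conjugation by y becomes complex conjugation.
  set H := complexify G₀ w' hww' hwc with hH
  have hτH : ∀ X, τ (H X) = MulOpposite.op (H Xᴴ : A) := fun X => by
    have e1 : Xᴴ.map Complex.re = (X.map Complex.re)ᵀ := by ext; simp
    have e2 : Xᴴ.map Complex.im = -(X.map Complex.im)ᵀ := by ext; simp
    rw [hH, complexify_apply, complexify_apply, e1, e2, map_neg]
    change τ (G₀ (X.map Complex.re) + w * G₀ (X.map Complex.im)) =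
      MulOpposite.op (G₀ (X.map Complex.re)ᵀ + w * -(G₀ (X.map Complex.im)ᵀ) : A)
    have := congrArg Subtype.val (hwc (G₀ (X.map Complex.im)ᵀ)).eq
    change w * (G₀ (X.map Complex.im)ᵀ : A) = G₀ (X.map Complex.im)ᵀ * w at this
    rw [map_add, map_mul, hG₀τ, hG₀τ, hτw, ← MulOpposite.op_mul, mul_neg, mul_neg, this]
    rfl
  have hyH : ∀ X, y * (H X : A) = (H (X.map (starRingEnd ℂ)) : A) * y := fun X => by
    have e1 : (X.map (starRingEnd ℂ)).map Complex.re = X.map Complex.re := by ext; simp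
    have e2 : (X.map (starRingEnd ℂ)).map Complex.im = -X.map Complex.im := by ext; simp
    rw [hH, complexify_apply, complexify_apply, e1, e2, map_neg]
    change y * (G₀ (X.map Complex.re) + w * G₀ (X.map Complex.im) : A) =
      (G₀ (X.map Complex.re) + w * -(G₀ (X.map Complex.im)) : A) * y
    rw [mul_add, add_mul, (hG₀y _).eq, ← mul_assoc, hyw, neg_mul, mul_assoc, (hG₀y _).eq]
    noncomm_ring
  have : Nonempty (Fin r) := ⟨⟨0, hr⟩⟩
  have hA : Nontrivial S := by
    by_contra hn
    rw [not_nontrivial_iff_subsingleton] at hn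
    have := Module.finrank_zero_of_subsingleton (R := ℝ) (M := S)
    rw [h2] at this
    exact absurd this (by positivity)
  -- A full matrix algebra over ℂ is simple. Surjectivity follows by dimension, as adjoining w makes
  -- up for the one generator that was left out.
  have hi : Function.Injective H := (H : Matrix (Fin r) (Fin r) ℂ →+* S).injective
  have hdim : Module.finrank ℝ (Matrix (Fin r) (Fin r) ℂ) = Module.finrank ℝ S := by
    have h3 := hF.finrank_eq
    simp only [Module.finrank_pi_fintype, Module.finrank_matrix, Fintype.card_fin,
      Fintype.card_sum, Finset.sum_const, Finset.card_univ, Module.finrank_self, smul_eq_mul,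
      one_mul, mul_one] at h3
    rw [h2, ← hst, Module.finrank_matrix, Fintype.card_fin, h3, Complex.finrank_real_complex,
      pow_succ]
  have hs : Function.Surjective H :=
    (LinearMap.injective_iff_surjective_of_finrank_eq_finrank (f := H.toLinearMap) hdim).1 hi
  obtain ⟨E, hE⟩ : ∃ E : S ≃ₐ[ℝ] (Fin 1 → Matrix (Fin r) (Fin r) ℂ), ∀ X, E (H X) = fun _ => X :=
    ⟨(AlgEquiv.ofBijective H ⟨hi, hs⟩).symm.trans
      (AlgEquiv.funUnique ℝ (Fin 1) (Matrix (Fin r) (Fin r) ℂ)).symm, fun X => by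
      rw [AlgEquiv.trans_apply, show (AlgEquiv.ofBijective H ⟨hi, hs⟩).symm (H X) = X from
        (AlgEquiv.ofBijective H ⟨hi, hs⟩).symm_apply_apply X]
      rfl⟩
  refine ⟨E, fun a => ?_, fun a b hab => ?_⟩
  · obtain ⟨X, rfl⟩ := hs a
    exact ⟨H Xᴴ, hτH X, by rw [hE, hE]; rfl⟩
  · obtain ⟨X, rfl⟩ := hs a
    -- Since y is invertible, b y = y a determines b.
    have hb : b = H (X.map (starRingEnd ℂ)) := by
      rw [hyH] at hab
      have := congrArg (fun z => σ • (z * y)) hab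
      simp only [mul_assoc, hyy, mul_smul_comm, smul_smul, hσ, one_smul, mul_one] at this
      exact Subtype.ext this
    rw [hb, hE, hE]

end IsRSystem

/-! ### Modules over direct sums of matrix algebras -/

section Multiplicities

variable {K : Type*} [DivisionRing K] [Algebra ℝ K] {ℓ : ℕ}
  {W : Type*} [AddCommGroup W] [Module ℝ W] [Module.Finite ℝ W]

/-- A (non-unital) finite-dimensional representation of `M(ℓ; 𝕂)` is, up to a trivial
representation, a sum of copies of `𝕂^ℓ`. -/
theorem exists_columns (hℓ : 0 < ℓ) (f : Matrix (Fin ℓ) (Fin ℓ) K →ₗ[ℝ] Module.End ℝ W)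
    (hf : ∀ M N, f (M * N) = f M * f N) :
    ∃ (k : ℕ) (Ψ : W →ₗ[ℝ] Matrix (Fin ℓ) (Fin k) K), (∀ M w, Ψ (f M w) = M * Ψ w) ∧
      (∀ w, Ψ w = 0 → f 1 w = 0) ∧ ∀ N, ∃ w, Ψ w = N := by
  set o : Fin ℓ := ⟨0, hℓ⟩
  -- The matrix units act with the usual rule e_{ab} e_{b'c} = δ_{bb'} e_{ac}.
  have hfs : ∀ (a b b' c : Fin ℓ) (x y : K) (w : W), f (Matrix.single a b x) (f (Matrix.single b' c y) w)
      = if b = b' then f (Matrix.single a c (x * y)) w else 0 := by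
    intro a b b' c x y w
    rw [← Module.End.mul_apply, ← hf]
    split_ifs with h
    · subst h; rw [Matrix.single_mul_single_same]
    · rw [Matrix.single_mul_single_of_ne (h := h)]; simp
  -- The image U of the idempotent e_{oo} is a vector space over 𝕂, on which x acts as x e_{oo}. Its
  -- dimension is the multiplicity.
  set U : Submodule ℝ W := LinearMap.range (f (Matrix.single o o 1)) with hU
  have hmem : ∀ (b : Fin ℓ) (x : K) (w : W), f (Matrix.single o b x) w ∈ U := fun b x w =>
    ⟨f (Matrix.single o b x) w, by rw [hfs, if_pos rfl, one_mul]⟩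
  have hfix : ∀ u : U, f (Matrix.single o o 1) u = u := by
    rintro ⟨_, w, rfl⟩
    rw [hfs, if_pos rfl, one_mul]
  let φ : K →+* Module.End ℝ U :=
    { toFun := fun x => (f (Matrix.single o o x)).restrict fun w _ => hmem o x w
      map_one' := by ext u; exact hfix u
      map_mul' := fun x y => by
        ext u
        change f (Matrix.single o o (x * y)) u = f (Matrix.single o o x) (f (Matrix.single o o y) u)
        rw [hfs, if_pos rfl]
      map_zero' := by
        ext u
        change f (Matrix.single o o 0) u = 0
        simp
      map_add' := fun x y => by
        ext u
        change f (Matrix.single o o (x + y)) u = f (Matrix.single o o x) u + f (Matrix.single o o y) u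
        rw [Matrix.single_add, map_add, LinearMap.add_apply] }
  letI : Module K U := Module.compHom U φ
  have hsmul : ∀ (x : K) (u : U), ((x • u : U) : W) = f (Matrix.single o o x) u := fun _ _ => rfl
  haveI : IsScalarTower ℝ K U := ⟨fun r x u => Subtype.ext <| by
    rw [hsmul, ← Matrix.smul_single, map_smul]; rfl⟩
  haveI : Module.Finite K U := Module.Finite.of_restrictScalars_finite ℝ K U
  set B := Module.finBasis K U
  -- The operator e_{oa} carries the a-th component of w into U, where a basis gives the entries of
  -- the a-th row.
  let row : Fin ℓ → W →ₗ[ℝ] U := fun a => (f (Matrix.single o a 1)).codRestrict U (hmem a 1)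
  have hrow : ∀ a w, (row a w : W) = f (Matrix.single o a 1) w := fun _ _ => rfl
  refine ⟨Module.finrank K U,
    { toFun := fun w => Matrix.of fun a b => B.repr (row a w) b
      map_add' := fun v w => by ext a b; simp
      map_smul' := fun r w => by
        ext a b
        simp only [map_smul, Matrix.of_apply, RingHom.id_apply, Matrix.smul_apply]
        rw [← algebraMap_smul K r (row a w), map_smul, Finsupp.smul_apply, algebraMap_smul] },
    fun M w => ?_, fun w hw => ?_, fun N => ?_⟩
  · ext a b
    change B.repr (row a (f M w)) b = (M * Matrix.of fun a b => B.repr (row a w) b) a b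
    have : row a (f M w) = ∑ c, M a c • row c w := Subtype.ext <| by
      rw [hrow, ← Module.End.mul_apply, ← hf, Submodule.coe_sum]
      simp only [hsmul, hrow, hfs, if_true, mul_one]
      rw [← LinearMap.sum_apply, ← map_sum]
      congr 2
      ext i j
      rw [Matrix.sum_apply]
      by_cases hi : i = o
      · subst hi
        simp [Matrix.single_apply]
      · rw [Matrix.single_mul_apply_of_ne (h := hi), Finset.sum_eq_zero]
        intro c _
        simp [Matrix.single_apply, Ne.symm hi]
    rw [this, map_sum, Matrix.mul_apply, Finsupp.finset_sum_apply]
    simp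
  · have hw' : ∀ a, row a w = 0 := fun a => by
      apply B.repr.injective
      ext b
      simpa using congrFun (congrFun hw a) b
    -- Since 1 = ∑ e_{ao} e_{oa}, a vector with all rows zero is killed by f 1.
    have h1 : (1 : Matrix (Fin ℓ) (Fin ℓ) K) = ∑ a, Matrix.single a o 1 * Matrix.single o a 1 := by
      ext i j
      rw [Matrix.sum_apply, Finset.sum_eq_single i]
      · rw [Matrix.single_mul_single_same]
        by_cases h : i = j <;> simp [Matrix.single_apply, Matrix.one_apply, h]
      · intro a _ ha
        rw [Matrix.single_mul_single_same, Matrix.single_apply, if_neg (fun h => ha h.1)]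
      · simp
    rw [h1, map_sum, LinearMap.sum_apply]
    refine Finset.sum_eq_zero fun a _ => ?_
    rw [hf, Module.End.mul_apply, ← hrow, hw']
    simp
  -- The operators e_{ao} put prescribed vectors of U back into the rows.
  · set u : Fin ℓ → U := fun a => ∑ b, N a b • B b
    refine ⟨∑ a, f (Matrix.single a o 1) (u a), ?_⟩
    ext a b
    change B.repr (row a (∑ a, f (Matrix.single a o 1) (u a))) b = N a b
    have : row a (∑ a, f (Matrix.single a o 1) (u a)) = u a := Subtype.ext <| by
      rw [hrow, map_sum]
      simp only [hfs]
      rw [Finset.sum_ite_eq]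
      simp [hfix]
    rw [this]
    simp [u, Finsupp.single_apply]

/-- The central idempotents of the direct sum split W. On each piece `exists_columns` applies to one
summand, which acts non-unitally on all of W. -/
theorem SymRep.exists_multiplicities {p q m : ℕ} (ρ : SymRep p q m) {d : ℕ} (hℓ : 0 < ℓ)
    (E : R p q ≃ₐ[ℝ] (Fin d → Matrix (Fin ℓ) (Fin ℓ) K)) :
    ∃ k : Fin d → ℕ, ρ.HasMultiplicities E k := by
  let φ : (Fin d → Matrix (Fin ℓ) (Fin ℓ) K) →ₐ[ℝ] Module.End ℝ (Fin m → ℝ) :=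
    (Matrix.toLinAlgEquiv' : Matrix (Fin m) (Fin m) ℝ ≃ₐ[ℝ] _).toAlgHom.comp
      (ρ.toAlgHom.comp (E.symm : (Fin d → Matrix (Fin ℓ) (Fin ℓ) K) →ₐ[ℝ] R p q))
  have hφ : ∀ a w, φ (E a) w = ρ.toAlgHom a *ᵥ w := fun a w => by
    simp [φ]
  have key := fun i : Fin d => exists_columns (K := K) hℓ
    (φ.toLinearMap.comp (LinearMap.single ℝ (fun _ : Fin d => Matrix (Fin ℓ) (Fin ℓ) K) i))
    (fun M N => by
      change φ (Pi.single i (M * N)) = φ (Pi.single i M) * φ (Pi.single i N)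
      rw [← map_mul, ← Pi.single_mul])
  choose k Ψ h1 h2 h3 using key
  replace h1 : ∀ i M w, Ψ i (φ (Pi.single i M) w) = M * Ψ i w := h1
  replace h2 : ∀ i w, Ψ i w = 0 → φ (Pi.single i 1) w = 0 := h2
  have h4 : ∀ t w i, Ψ i (φ t w) = t i * Ψ i w := fun t w i => by
    have e1 := h1 i 1 (φ t w)
    rw [Matrix.one_mul, ← Module.End.mul_apply, ← map_mul, ← Pi.single_mul_left, one_mul, h1] at e1
    exact e1.symm
  refine ⟨k, LinearEquiv.ofBijective (LinearMap.pi Ψ) ⟨?_, ?_⟩, fun a w i => ?_⟩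
  · rw [injective_iff_map_eq_zero]
    intro w hw
    have e1 : (1 : Fin d → Matrix (Fin ℓ) (Fin ℓ) K) = ∑ i, Pi.single i 1 :=
      (Finset.univ_sum_single 1).symm
    have e2 : φ 1 w = w := by rw [map_one]; rfl
    rw [← e2, e1, map_sum, LinearMap.sum_apply]
    exact Finset.sum_eq_zero fun i _ => h2 i w (congrFun hw i)
  · intro N
    choose w hw using fun i => h3 i (N i)
    refine ⟨∑ j, φ (Pi.single j 1) (w j), funext fun i => ?_⟩
    change Ψ i _ = _
    rw [map_sum, Finset.sum_eq_single i]
    · rw [h4, Pi.single_eq_same, Matrix.one_mul, hw]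
    · intro j _ hj
      rw [h4, Pi.single_eq_of_ne hj.symm, Matrix.zero_mul]
    · simp
  · rw [← hφ]
    exact h4 (E a) w i

end Multiplicities

/-! ### Isometric equivalence -/

section Polar

-- The square root is obtained from T by functional calculus, so it commutes with whatever commutes
-- with T.
open scoped MatrixOrder Matrix.Norms.L2Operator in
theorem exists_sqrt_commute_of_posDef {n : Type*} [Fintype n] [DecidableEq n]
    {T : Matrix n n ℝ} (hT : T.PosDef) :
    ∃ Q : Matrix n n ℝ, Q * Q = T ∧ Q.transpose = Q ∧ ∀ S, Commute T S → Commute Q S := by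
  have h0 : 0 ≤ T := hT.posSemidef.nonneg
  refine ⟨CFC.sqrt T, CFC.sqrt_mul_sqrt_self T, ?_, fun S h => h.cfcₙ_nnreal _⟩
  have := (CFC.sqrt_nonneg T).isSelfAdjoint
  simpa [IsSelfAdjoint, Matrix.star_eq_conjTranspose] using this

theorem mulVec_dotProduct_eq {n : Type*} [Fintype n] (M : Matrix n n ℝ) (v w : n → ℝ) :
    (M *ᵥ v) ⬝ᵥ w = v ⬝ᵥ M.transpose *ᵥ w := by
  rw [Matrix.mulVec_transpose, dotProduct_comm, Matrix.dotProduct_mulVec, dotProduct_comm]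

variable {p q m : ℕ} (ρ : SymRep p q m) {U : Type*} [AddCommGroup U] [Module ℝ U]
  (act : R p q →ₐ[ℝ] Module.End ℝ U) (B : LinearMap.BilinForm ℝ U)

/-- Equivalent orthogonal representations are isometrically equivalent. -/
theorem SymRep.exists_isometry (hpos : ∀ u, u ≠ 0 → 0 < B u u) (hsymm : ∀ u v, B u v = B v u)
    (hadj : ∀ i u v, B (act (gen p q i) u) v = B u (act (gen p q i) v))
    (Ψ : (Fin m → ℝ) ≃ₗ[ℝ] U) (hΨ : ∀ a w, Ψ (ρ.toAlgHom a *ᵥ w) = act a (Ψ w)) :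
    ∃ Φ : (Fin m → ℝ) ≃ₗ[ℝ] U, (∀ a w, Φ (ρ.toAlgHom a *ᵥ w) = act a (Φ w)) ∧
      ∀ v w, B (Φ v) (Φ w) = v ⬝ᵥ w := by
  -- T is the Gram matrix of B transported to W. The isometry will be Ψ T^{-1/2}.
  set T : Matrix (Fin m) (Fin m) ℝ :=
    LinearMap.toMatrix₂' ℝ (B.compl₁₂ Ψ.toLinearMap Ψ.toLinearMap) with hTdef
  have hT : ∀ v w, v ⬝ᵥ T *ᵥ w = B (Ψ v) (Ψ w) := by
    intro v w
    rw [← Matrix.toLinearMap₂'_apply', hTdef, Matrix.toLinearMap₂'_toMatrix']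
    rfl
  have hext : ∀ M N : Matrix (Fin m) (Fin m) ℝ, (∀ v w, v ⬝ᵥ M *ᵥ w = v ⬝ᵥ N *ᵥ w) → M = N := by
    intro M N h
    ext i j
    simpa using h (Pi.single i 1) (Pi.single j 1)
  have hdot := mulVec_dotProduct_eq (n := Fin m)
  have hTt : T.transpose = T := hext _ _ fun v w => by
    rw [← hdot, dotProduct_comm, hT, hT, hsymm]
  have hpd : T.PosDef := Matrix.PosDef.of_dotProduct_mulVec_pos
    (by rw [Matrix.IsHermitian, Matrix.conjTranspose_eq_transpose_of_trivial, hTt]) fun w hw => by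
      rw [star_trivial]
      change 0 < w ⬝ᵥ T *ᵥ w
      rw [hT]
      exact hpos _ (Ψ.map_ne_zero_iff.2 hw)
  obtain ⟨Q, hQQ, hQt, hQc⟩ := exists_sqrt_commute_of_posDef hpd
  -- The generators are symmetric for both the dot product and B.
  have hTS : ∀ i, Commute T (ρ.S i) := fun i => hext _ _ fun v w => by
    rw [← Matrix.mulVec_mulVec, ← Matrix.mulVec_mulVec, hT, SymRep.S, hΨ, ← hadj, ← hΨ, ← hT, hdot,
      ρ.symm i]
  have hdet : IsUnit Q.det := by
    have := hpd.isUnit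
    rw [Matrix.isUnit_iff_isUnit_det, ← hQQ, Matrix.det_mul] at this
    exact isUnit_of_mul_isUnit_left this
  have hQ1 : Q * Q⁻¹ = 1 := Matrix.mul_nonsing_inv Q hdet
  have hQ2 : Q⁻¹ * Q = 1 := Matrix.nonsing_inv_mul Q hdet
  have hQS : ∀ a, Commute (ρ.toAlgHom a) Q⁻¹ := fun a => by
    refine commute_of_adjoin (adjoin_gen p q) ρ.toAlgHom Q⁻¹ ?_ a
    rintro _ ⟨i, rfl⟩
    have h1 := (hQc _ (hTS i)).eq
    change ρ.S i * Q⁻¹ = Q⁻¹ * ρ.S i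
    calc ρ.S i * Q⁻¹ = Q⁻¹ * (Q * ρ.S i) * Q⁻¹ := by rw [← mul_assoc, hQ2, one_mul]
      _ = Q⁻¹ * ρ.S i * (Q * Q⁻¹) := by rw [h1]; noncomm_ring
      _ = _ := by rw [hQ1, mul_one]
  let L : (Fin m → ℝ) ≃ₗ[ℝ] (Fin m → ℝ) :=
    LinearEquiv.ofLinear (Matrix.mulVecLin Q⁻¹) (Matrix.mulVecLin Q)
      (by rw [← Matrix.mulVecLin_mul, hQ2, Matrix.mulVecLin_one])
      (by rw [← Matrix.mulVecLin_mul, hQ1, Matrix.mulVecLin_one])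
  have hL : ∀ w, L w = Q⁻¹ *ᵥ w := fun _ => rfl
  refine ⟨L.trans Ψ, fun a w => ?_, fun v w => ?_⟩
  · rw [LinearEquiv.trans_apply, LinearEquiv.trans_apply, hL, hL, ← hΨ, Matrix.mulVec_mulVec,
      Matrix.mulVec_mulVec, (hQS a).eq]
  · rw [LinearEquiv.trans_apply, LinearEquiv.trans_apply, ← hT, hL, hL, hdot,
      Matrix.transpose_nonsing_inv, hQt, Matrix.mulVec_mulVec, Matrix.mulVec_mulVec, ← hQQ,
      show Q⁻¹ * (Q * Q) * Q⁻¹ = Q⁻¹ * Q * (Q * Q⁻¹) by noncomm_ring, hQ1, hQ2, one_mul,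
      Matrix.one_mulVec]

end Polar

/-! ### A criterion for `ActsAs` -/

section Criterion

variable {p q m : ℕ} (ρ : SymRep p q m) {U : Type*} [AddCommGroup U] [Module ℝ U]
  {𝔰 : Type*} [LieRing 𝔰] [LieAlgebra ℝ 𝔰]

/-- An isometry turns the transpose into the adjoint for B. So 𝔥 becomes the set of operators that
are skew for all the forms B(u, e_i v), and the last hypotheses identify this set with 𝔰. -/
theorem SymRep.actsAs_of_isometry (act : R p q →ₐ[ℝ] Module.End ℝ U) (B : LinearMap.BilinForm ℝ U)
    (Φ : (Fin m → ℝ) ≃ₗ[ℝ] U)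
    (hΦ : ∀ a w, Φ (ρ.toAlgHom a *ᵥ w) = act a (Φ w)) (hB : ∀ v w, B (Φ v) (Φ w) = v ⬝ᵥ w)
    (hadj : ∀ i u v, B (act (gen p q i) u) v = B u (act (gen p q i) v))
    (π : soPQ p q × 𝔰 →ₗ⁅ℝ⁆ Module.End ℝ U) (hπ : ∀ A, π (A, 0) = act (spin p q A))
    (hinj : ∀ x, π (0, x) = 0 → x = 0)
    (hskew : ∀ x i u v, B (π (0, x) u) (act (gen p q i) v)
      + B u (act (gen p q i) (π (0, x) v)) = 0)
    (hsurj : ∀ Y : Module.End ℝ U, (∀ i u v, B (Y u) (act (gen p q i) v)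
      + B u (act (gen p q i) (Y v)) = 0) → ∃ x, π (0, x) = Y) : ρ.ActsAs π := by
  let c : Module.End ℝ U ≃ₐ[ℝ] Matrix (Fin m) (Fin m) ℝ :=
    (Φ.symm.conjAlgEquiv ℝ).trans LinearMap.toMatrixAlgEquiv'
  have hc : ∀ Y w, Φ (c Y *ᵥ w) = Y (Φ w) := fun Y w => by
    have : c Y *ᵥ w = Φ.symm (Y (Φ w)) :=
      LinearMap.congr_fun (Matrix.toLinAlgEquiv'_toMatrixAlgEquiv' (Φ.symm.conjAlgEquiv ℝ Y)) w
    rw [this, LinearEquiv.apply_symm_apply]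
  have hcS : ∀ i w, Φ (ρ.S i *ᵥ w) = act (gen p q i) (Φ w) := fun i w => hΦ _ _
  have hmem : ∀ Y, (∀ i u v, B (Y u) (act (gen p q i) v) + B u (act (gen p q i) (Y v)) = 0) ↔
      c Y ∈ ρ.h := by
    intro Y
    have e1 : ∀ i v w, B (Y (Φ v)) (act (gen p q i) (Φ w)) + B (Φ v) (act (gen p q i) (Y (Φ w)))
        = v ⬝ᵥ ((c Y).transpose * ρ.S i + ρ.S i * c Y) *ᵥ w := by
      intro i v w
      rw [← hc Y v, ← hc Y w, ← hcS i w, ← hcS i, hB, hB, Matrix.add_mulVec, dotProduct_add,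
        ← Matrix.mulVec_mulVec, ← Matrix.mulVec_mulVec, mulVec_dotProduct_eq]
    constructor
    · intro h i
      ext a b
      have := e1 i (Pi.single a 1) (Pi.single b 1)
      rw [h] at this
      simpa using this.symm
    · intro h i u v
      obtain ⟨u, rfl⟩ := Φ.surjective u
      obtain ⟨v, rfl⟩ := Φ.surjective v
      rw [e1, h i]
      simp
  let t : 𝔰 →ₗ⁅ℝ⁆ ρ.h :=
    { toFun := fun x => ⟨c (π (0, x)), (hmem _).1 (hskew x)⟩
      map_add' := fun x y => Subtype.ext <| by
        change c (π (0, x + y)) = c (π (0, x)) + c (π (0, y))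
        rw [← map_add, ← map_add, Prod.mk_add_mk, add_zero]
      map_smul' := fun r x => Subtype.ext <| by
        change c (π (0, r • x)) = r • c (π (0, x))
        rw [← map_smul, ← map_smul, Prod.smul_mk, smul_zero]
      map_lie' := fun {x y} => Subtype.ext <| by
        change c (π (0, ⁅x, y⁆)) = ⁅c (π (0, x)), c (π (0, y))⁆
        rw [show ((0, ⁅x, y⁆) : soPQ p q × 𝔰) = ⁅((0, x) : soPQ p q × 𝔰), ((0, y) : soPQ p q × 𝔰)⁆ by
          rw [LieAlgebra.Prod.bracket_apply, lie_self], LieHom.map_lie,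
          LieRing.of_associative_ring_bracket, LieRing.of_associative_ring_bracket, map_sub,
          map_mul, map_mul] }
  have ht : ∀ x, ((t x : ρ.h) : Matrix (Fin m) (Fin m) ℝ) = c (π (0, x)) := fun _ => rfl
  have htb : Function.Bijective t := by
    constructor
    · rw [injective_iff_map_eq_zero]
      intro x hx
      refine hinj x (c.injective ?_)
      rw [← ht, hx, map_zero]; rfl
    · rintro ⟨X, hX⟩
      obtain ⟨Y, rfl⟩ := c.surjective X
      obtain ⟨x, rfl⟩ := hsurj Y ((hmem Y).2 hX)
      exact ⟨x, rfl⟩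
  refine ⟨(LieEquiv.ofBijective t htb).symm, Φ, fun A X w => ?_⟩
  obtain ⟨x, rfl⟩ := htb.2 X
  have e1 : (LieEquiv.ofBijective t htb).symm (t x) = x :=
    (LieEquiv.ofBijective t htb).symm_apply_apply x
  rw [e1, show ((A, x) : soPQ p q × 𝔰) = (A, 0) + (0, x) by simp, map_add, LinearMap.add_apply, hπ,
    ← hΦ, ← hc, ← map_add, ← Matrix.add_mulVec]
  rfl

/-- A criterion for `𝔤'_{p,q}(ρ)` to act as a given representation `π` on `U`, where `U` is an
orthogonal model of the representation `ρ`. Only the action of the even algebra and of one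
invertible odd element are needed. -/
theorem SymRep.actsAs_of_model {K : Type*} [Ring K] [Algebra ℝ K] {d ℓ : ℕ}
    (E : R p q ≃ₐ[ℝ] (Fin d → Matrix (Fin ℓ) (Fin ℓ) K)) {k : Fin d → ℕ}
    (hk : ρ.HasMultiplicities E k)
    (Θ : ((i : Fin d) → Matrix (Fin ℓ) (Fin (k i)) K) ≃ₗ[ℝ] U)
    (B : LinearMap.BilinForm ℝ U) (hpos : ∀ u, u ≠ 0 → 0 < B u u) (hsymm : ∀ u v, B u v = B v u)
    (i₀ : Fin p ⊕ Fin q) {y : R p q} {σ : ℝ} (hσ : σ * σ = 1) (hyy : y * y = σ • (1 : R p q))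
    (hτy : rev p q y = MulOpposite.op (σ • y)) (hy1 : ∀ i, gen p q i * y ∈ REven p q)
    (hy2 : ∀ i, y * gen p q i ∈ REven p q)
    (aS : REven p q → Module.End ℝ U) (haS : ∀ (s : REven p q) n, Θ (fun i => E (s : R p q) i * n i) = aS s (Θ n))
    (yU : Module.End ℝ U) (hyU : ∀ n, Θ (fun i => E y i * n i) = yU (Θ n))
    (adjS : ∀ s s' : REven p q, rev p q s = MulOpposite.op (s' : R p q) →
      ∀ u v, B (aS s u) v = B u (aS s' v))
    (adjy : ∀ u v, B (yU u) v = σ * B u (yU v))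
    (π : soPQ p q × 𝔰 →ₗ⁅ℝ⁆ Module.End ℝ U) (hπ : ∀ A u, π (A, 0) u = aS (spin p q A) u)
    (hinj : ∀ x, π (0, x) = 0 → x = 0)
    (hcomm : ∀ x s u, π (0, x) (aS s u) = aS s (π (0, x) u))
    (hskew : ∀ x u v, B (π (0, x) u) (yU v) + B u (yU (π (0, x) v)) = 0)
    (hsurj : ∀ Y : Module.End ℝ U, (∀ s u, Y (aS s u) = aS s (Y u)) →
      (∀ u v, B (Y u) (yU v) + B u (yU (Y v)) = 0) → ∃ x, π (0, x) = Y) : ρ.ActsAs π := by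
  let lm : (Fin d → Matrix (Fin ℓ) (Fin ℓ) K) →ₐ[ℝ]
      Module.End ℝ ((i : Fin d) → Matrix (Fin ℓ) (Fin (k i)) K) :=
    AlgHom.ofLinearMap
      { toFun := fun t =>
          { toFun := fun n i => t i * n i
            map_add' := fun a b => by ext1 i; simp [Matrix.mul_add]
            map_smul' := fun r a => by ext1 i; simp }
        map_add' := fun a b => LinearMap.ext fun n => funext fun i => Matrix.add_mul (a i) (b i) (n i)
        map_smul' := fun r a => LinearMap.ext fun n => funext fun i => Matrix.smul_mul r (a i) (n i) }
      (LinearMap.ext fun n => funext fun i => Matrix.one_mul _)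
      (fun a b => LinearMap.ext fun n => funext fun i => Matrix.mul_assoc (a i) (b i) (n i))
  let act : R p q →ₐ[ℝ] Module.End ℝ U :=
    ((Θ.conjAlgEquiv ℝ : _ →ₐ[ℝ] Module.End ℝ U).comp lm).comp (E : R p q →ₐ[ℝ] _)
  have hact : ∀ a n, act a (Θ n) = Θ fun i => E a i * n i := fun a n => by
    change Θ (lm (E a) (Θ.symm (Θ n))) = _
    rw [Θ.symm_apply_apply]; rfl
  have hactS : ∀ (s : REven p q) u, act s u = aS s u := fun s u => by
    obtain ⟨n, rfl⟩ := Θ.surjective u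
    rw [hact, haS]
  have hacty : ∀ u, act y u = yU u := fun u => by
    obtain ⟨n, rfl⟩ := Θ.surjective u
    rw [hact, hyU]
  have hmul : ∀ a b u, act (a * b) u = act a (act b u) := fun a b u => by rw [map_mul]; rfl
  have hsmul : ∀ (r : ℝ) a u, act (r • a) u = r • act a u := fun r a u => by rw [map_smul]; rfl
  -- Every generator is an even element times y, and y times an even element. This transfers
  -- information from R⁺ and y to the generators.
  have hgy : ∀ i, gen p q i = σ • (gen p q i * y * y) := fun i => by
    rw [mul_assoc, hyy, mul_smul_comm, smul_smul, hσ, one_smul, mul_one]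
  have hyg : ∀ i, gen p q i = σ • (y * (y * gen p q i)) := fun i => by
    rw [← mul_assoc, hyy, smul_mul_assoc, smul_smul, hσ, one_smul, one_mul]
  have hygen : ∀ i, y = gen p q i * (gen p q i * y) := fun i => by
    rw [← mul_assoc, gen_sq, one_mul]
  have hadj : ∀ i u v, B (act (gen p q i) u) v = B u (act (gen p q i) v) := by
    intro i u v
    have e1 : rev p q (gen p q i * y) = MulOpposite.op ((σ • ⟨y * gen p q i, hy2 i⟩ : REven p q) : R p q) := by
      rw [map_mul, rev_gen, hτy, ← MulOpposite.op_mul, smul_mul_assoc]; rfl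
    have e2 := adjS ⟨_, hy1 i⟩ _ e1
    rw [hgy i, hsmul, hmul, map_smul, LinearMap.smul_apply,
      hactS ⟨_, hy1 i⟩, e2, hacty, adjy, ← hactS, ← hacty, ← hmul]
    change σ • (σ * B u (act (y * (σ • (y * gen p q i))) v)) = _
    rw [smul_eq_mul, ← mul_assoc, hσ, one_mul, mul_smul_comm, ← hyg, ← hgy]
  have hnd : ∀ u v, (∀ w, B u w = B v w) → u = v := fun u v h => by
    by_contra hne
    have h1 := hpos (u - v) (sub_ne_zero.2 hne)
    rw [map_sub B, LinearMap.sub_apply, h, sub_self] at h1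
    exact lt_irrefl _ h1
  obtain ⟨Ψ, hΨ⟩ := hk
  obtain ⟨Φ, hΦ, hB⟩ := ρ.exists_isometry act B hpos hsymm hadj (Ψ.trans Θ) fun a w => by
    rw [LinearEquiv.trans_apply, LinearEquiv.trans_apply, hact]
    congr 1
    exact funext fun i => hΨ a w i
  -- If Y^* e_i = -e_i Y for all i, then e_i Y^* = -Y e_i as e_i² = 1. The two signs cancel, so Y
  -- commutes with e_i e_j and hence with R⁺.
  have hYS : ∀ Y : Module.End ℝ U, (∀ i u v, B (Y u) (act (gen p q i) v)
      + B u (act (gen p q i) (Y v)) = 0) → ∀ s u, Y (aS s u) = aS s (Y u) := by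
    intro Y hY
    have hYij : ∀ i j u, Y (act (gen p q i * gen p q j) u) = act (gen p q i * gen p q j) (Y u) := by
      have hsq : ∀ i u, act (gen p q i) (act (gen p q i) u) = u := fun i u => by
        rw [← hmul, gen_sq, map_one]; rfl
      intro i j u
      refine hnd _ _ fun v => ?_
      rw [hmul, hmul, hadj, hadj]
      have e1 := hY i (act (gen p q i) (act (gen p q j) u)) (act (gen p q i) v)
      have e2 := hY j (act (gen p q i) v) u
      rw [hsq, hadj, hsq] at e1
      have e3 := hsymm (act (gen p q j) u) (Y (act (gen p q i) v))
      have e4 := hsymm (act (gen p q i) v) (act (gen p q j) (Y u))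
      have e5 := hadj j (Y u) (act (gen p q i) v)
      linarith
    intro s u
    rw [← hactS, ← hactS]
    obtain ⟨s, hs⟩ := s
    have hs' := hs
    change s ∈ Algebra.adjoin ℝ _ at hs'
    change Y (act s u) = act s (Y u)
    clear hs
    induction hs' using Algebra.adjoin_induction generalizing u with
    | mem x hx => obtain ⟨i, j, -, rfl⟩ := hx; exact hYij i j u
    | algebraMap r => rw [Algebra.algebraMap_eq_smul_one, hsmul, hsmul, map_smul, map_one]; rfl
    | add a b _ _ ha hb => rw [map_add, LinearMap.add_apply, map_add, ha, hb]; rfl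
    | mul a b _ _ ha hb => rw [hmul, ha, hb, ← hmul]
  refine ρ.actsAs_of_isometry act B Φ hΦ hB hadj π (fun A => ?_) hinj (fun x i u v => ?_)
    (fun Y hY => hsurj Y (hYS Y hY) fun u v => ?_)
  · ext1 u
    rw [hπ, ← hactS]
  -- As e_i = σ y (y e_i) with y e_i even, the condition at e_i is the one at y tested on σ (y e_i)
  -- v.
  · have e1 := hskew x u (act (σ • (y * gen p q i)) v)
    rw [← hacty, ← hacty, ← hmul, mul_smul_comm, ← hyg] at e1
    rw [← e1]
    congr 2
    rw [hsmul, map_smul, hactS ⟨_, hy2 i⟩, hcomm, ← hactS, ← hsmul, ← hmul, mul_smul_comm, ← hyg]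
  -- Conversely y = e_{i₀} (e_{i₀} y) derives the condition at y from that at e_{i₀}.
  · have e1 : ∀ v, yU v = act (gen p q i₀) (aS ⟨_, hy1 i₀⟩ v) := fun v => by
      rw [← hacty, ← hactS, ← hmul, ← hygen]
    rw [e1, e1, ← hYS Y hY, hY]

end Criterion

/-! ### The real trace form on matrices -/

section TraceForm

variable {K : Type*} [Ring K] [StarRing K] [Algebra ℝ K]

/-- The properties of the real part on `ℝ`, `ℂ`, `ℍ`. -/
structure IsRealPart (re : K →ₗ[ℝ] ℝ) : Prop where
  re_star : ∀ x, re (star x) = re x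
  re_mul_comm : ∀ x y, re (x * y) = re (y * x)
  pos : ∀ x, x ≠ 0 → 0 < re (star x * x)

theorem isRealPart_real : IsRealPart (LinearMap.id : ℝ →ₗ[ℝ] ℝ) :=
  ⟨fun _ => rfl, fun x y => mul_comm x y, fun x hx => by
    rw [star_trivial]; exact mul_self_pos.2 hx⟩

theorem isRealPart_complex : IsRealPart Complex.reLm :=
  ⟨fun x => by simp, fun x y => by rw [mul_comm], fun x hx => by
    have := Complex.normSq_pos.2 hx
    simpa [Complex.normSq_apply] using this⟩

/-- The real part of a quaternion as a linear map. -/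
def quaternionRe : ℍ[ℝ] →ₗ[ℝ] ℝ where
  toFun x := x.re
  map_add' _ _ := rfl
  map_smul' _ _ := rfl

theorem quaternionRe_apply (x : ℍ[ℝ]) : quaternionRe x = x.re := rfl

theorem isRealPart_quaternion : IsRealPart quaternionRe :=
  ⟨fun x => by simp [quaternionRe_apply], fun x y => by simp [quaternionRe_apply]; ring,
    fun x hx => by
      have h0 : 0 < Quaternion.normSq x :=
        lt_of_le_of_ne Quaternion.normSq_nonneg (Ne.symm (Quaternion.normSq_ne_zero.2 hx))
      rw [Quaternion.star_mul_self, quaternionRe_apply, Quaternion.re_coe]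
      exact h0⟩

variable [StarModule ℝ K] {re : K →ₗ[ℝ] ℝ} {n κ ι : Type*} [Fintype n] [Fintype κ] [Fintype ι]

/-- The real bilinear form `(u, v) ↦ Re tr (u^* v)`. -/
def traceForm (re : K →ₗ[ℝ] ℝ) : LinearMap.BilinForm ℝ (Matrix n κ K) :=
  LinearMap.mk₂ ℝ (fun u v => re (uᴴ * v).trace)
    (fun u v w => by simp [Matrix.add_mul])
    (fun c u v => by simp [Matrix.conjTranspose_smul])
    (fun u v w => by simp [Matrix.mul_add])
    (fun c u v => by simp)

theorem traceForm_apply (u v : Matrix n κ K) : traceForm re u v = re (uᴴ * v).trace := rfl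

theorem traceForm_mul_left (M : Matrix n n K) (u v : Matrix n κ K) :
    traceForm re (M * u) v = traceForm re u (Mᴴ * v) := by
  rw [traceForm_apply, traceForm_apply, Matrix.conjTranspose_mul, Matrix.mul_assoc]

namespace IsRealPart

variable (h : IsRealPart re)
include h

theorem re_trace_mul_comm (u : Matrix n κ K) (v : Matrix κ n K) :
    re (u * v).trace = re (v * u).trace := by
  simp only [Matrix.trace, Matrix.diag_apply, Matrix.mul_apply, map_sum]
  rw [Finset.sum_comm]
  exact Finset.sum_congr rfl fun i _ => Finset.sum_congr rfl fun j _ => h.re_mul_comm _ _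

theorem traceForm_mul_right (u v : Matrix n κ K) (c : Matrix κ κ K) :
    traceForm re (u * c) v = traceForm re u (v * cᴴ) := by
  rw [traceForm_apply, traceForm_apply, Matrix.conjTranspose_mul, Matrix.mul_assoc,
    h.re_trace_mul_comm, Matrix.mul_assoc]

theorem traceForm_symm (u v : Matrix n κ K) : traceForm re u v = traceForm re v u := by
  rw [traceForm_apply, traceForm_apply, ← h.re_star, ← Matrix.trace_conjTranspose,
    Matrix.conjTranspose_mul, Matrix.conjTranspose_conjTranspose]

theorem traceForm_nonneg_pos (u : Matrix n κ K) :
    0 ≤ traceForm re u u ∧ (u ≠ 0 → 0 < traceForm re u u) := by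
  have e1 : traceForm re u u = ∑ j, ∑ i, re (star (u i j) * u i j) := by
    rw [traceForm_apply]
    simp [Matrix.trace, Matrix.mul_apply, map_sum]
  have h0 : ∀ x, 0 ≤ re (star x * x) := fun x => by
    by_cases hx : x = 0
    · simp [hx]
    · exact (h.pos x hx).le
  rw [e1]
  refine ⟨Finset.sum_nonneg fun j _ => Finset.sum_nonneg fun i _ => h0 _, fun hu => ?_⟩
  obtain ⟨i, j, hij⟩ : ∃ i j, u i j ≠ 0 := by
    by_contra! hu'
    exact hu (by ext i j; exact hu' i j)
  exact Finset.sum_pos' (fun j _ => Finset.sum_nonneg fun i _ => h0 _) ⟨j, Finset.mem_univ _,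
    Finset.sum_pos' (fun i _ => h0 _) ⟨i, Finset.mem_univ _, h.pos _ hij⟩⟩

theorem traceForm_pos {u : Matrix n κ K} (hu : u ≠ 0) : 0 < traceForm re u u :=
  (h.traceForm_nonneg_pos u).2 hu

/-- With v the matrix unit at (o, j) and u = v N, positivity gives v N = 0; this product carries the
j-th row of N. -/
theorem eq_zero_of_traceForm_mul [DecidableEq n] [DecidableEq κ] [Nonempty n] (N : Matrix κ ι K)
    (hN : ∀ (u : Matrix n ι K) (v : Matrix n κ K), traceForm re u (v * N) = 0) : N = 0 := by
  obtain ⟨o⟩ := ‹Nonempty n›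
  ext j l
  have h1 : Matrix.single o j (1 : K) * N = 0 := by
    by_contra h2
    exact (h.traceForm_pos h2).ne' (hN _ _)
  simpa using congrFun (congrFun h1 o) l

end IsRealPart

/-- The orthogonal sum of two bilinear forms. -/
def prodForm {U V : Type*} [AddCommGroup U] [Module ℝ U] [AddCommGroup V] [Module ℝ V]
    (B : LinearMap.BilinForm ℝ U) (C : LinearMap.BilinForm ℝ V) : LinearMap.BilinForm ℝ (U × V) :=
  LinearMap.mk₂ ℝ (fun u v => B u.1 v.1 + C u.2 v.2)
    (fun u v w => by simp; ring) (fun c u v => by simp; ring)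
    (fun u v w => by simp; ring) (fun c u v => by simp; ring)

theorem prodForm_apply {U V : Type*} [AddCommGroup U] [Module ℝ U] [AddCommGroup V] [Module ℝ V]
    (B : LinearMap.BilinForm ℝ U) (C : LinearMap.BilinForm ℝ V) (u v : U × V) :
    prodForm B C u v = B u.1 v.1 + C u.2 v.2 := rfl

/-- A real linear map that commutes with the left multiplications is a right multiplication. -/
theorem exists_eq_mul_right [DecidableEq n] [DecidableEq κ] [Nonempty n]
    (Y : Module.End ℝ (Matrix n κ K)) (hY : ∀ (M : Matrix n n K) u, Y (M * u) = M * Y u) :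
    ∃ b : Matrix κ κ K, ∀ u, Y u = u * b := by
  obtain ⟨o⟩ := ‹Nonempty n›
  -- The rows of b are read off from the images of the matrix units in one fixed row; left
  -- multiplication moves the columns of u into that row.
  refine ⟨Matrix.of fun j l => Y (Matrix.single o j 1) o l, fun u => ?_⟩
  set col : κ → Matrix n n K := fun j => Matrix.of fun i a => if a = o then u i j else 0 with hcol
  have hc : ∀ j (N : Matrix n κ K) i l, (col j * N) i l = u i j * N o l := fun j N i l => by
    simp [hcol, Matrix.mul_apply]
  have hu : u = ∑ j, col j * Matrix.single o j (1 : K) := by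
    ext i l
    rw [Matrix.sum_apply]
    simp [hc, Matrix.single_apply]
  have h1 : Y u = ∑ j, col j * Y (Matrix.single o j (1 : K)) := by
    conv_lhs => rw [hu, map_sum]
    exact Finset.sum_congr rfl fun j _ => hY _ _
  rw [h1]
  ext i l
  rw [Matrix.sum_apply, Matrix.mul_apply]
  exact Finset.sum_congr rfl fun j _ => hc j _ i l

/-- The left multiplications by (1, 0) and (0, 1) exclude cross terms between the two factors. -/
theorem exists_eq_mul_right_prod [DecidableEq n] [DecidableEq κ] [DecidableEq ι] [Nonempty n]
    (Y : Module.End ℝ (Matrix n κ K × Matrix n ι K))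
    (hY : ∀ (M N : Matrix n n K) u, Y (M * u.1, N * u.2) = (M * (Y u).1, N * (Y u).2)) :
    ∃ (b : Matrix κ κ K) (b' : Matrix ι ι K), ∀ u, Y u = (u.1 * b, u.2 * b') := by
  obtain ⟨b, hb⟩ := exists_eq_mul_right
    ((LinearMap.fst ℝ _ _).comp (Y.comp (LinearMap.inl ℝ (Matrix n κ K) (Matrix n ι K))))
    fun M u => by simpa using congrArg Prod.fst (hY M 0 (u, 0))
  obtain ⟨b', hb'⟩ := exists_eq_mul_right
    ((LinearMap.snd ℝ _ _).comp (Y.comp (LinearMap.inr ℝ (Matrix n κ K) (Matrix n ι K))))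
    fun M u => by simpa using congrArg Prod.snd (hY 0 M (0, u))
  refine ⟨b, b', fun u => Prod.ext ?_ ?_⟩
  · have := congrArg Prod.fst (hY 1 0 u)
    simp only [Matrix.one_mul, Matrix.zero_mul] at this
    rw [← this]
    exact hb u.1
  · have := congrArg Prod.snd (hY 0 1 u)
    simp only [Matrix.one_mul, Matrix.zero_mul] at this
    rw [← this]
    exact hb' u.2

end TraceForm

/-! ### Criteria for `ActsAs` in terms of the even algebra and an odd element -/

section Blocks

/-- An odd element of `R_{p,q}` with square `σ = ±1`, fixed up to the sign `σ` by the
anti-involution that fixes the generators. -/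
structure IsOddElement {p q : ℕ} (y : R p q) (σ : ℝ) : Prop where
  sign_sq : σ * σ = 1
  sq : y * y = σ • (1 : R p q)
  rev_eq : rev p q y = MulOpposite.op (σ • y)
  gen_mul : ∀ i, gen p q i * y ∈ REven p q
  mul_gen : ∀ i, y * gen p q i ∈ REven p q

/-- An isomorphism of the even algebra with a sum of matrix algebras under which the
anti-involution fixing the generators corresponds to the conjugate transpose. -/
def IsStarIso {p q : ℕ} {D : Type*} [Ring D] [StarRing D] [Algebra ℝ D]
    (E' : REven p q ≃ₐ[ℝ] D) : Prop :=
  ∀ a : REven p q, ∃ b : REven p q, rev p q a = MulOpposite.op (b : R p q) ∧ E' b = star (E' a)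

theorem IsStarIso.eq_star {p q : ℕ} {D : Type*} [Ring D] [StarRing D] [Algebra ℝ D]
    {E' : REven p q ≃ₐ[ℝ] D} (h : IsStarIso E') {a b : REven p q}
    (hab : rev p q a = MulOpposite.op (b : R p q)) : E' b = star (E' a) := by
  obtain ⟨b', hb, hb'⟩ := h a
  rw [← hb']
  congr 1
  exact Subtype.ext (MulOpposite.op_injective (hab.symm.trans hb))

variable {p q m : ℕ} (ρ : SymRep p q m) {K : Type*} [Ring K] [Algebra ℝ K] {d ℓ : ℕ}
  {E : R p q ≃ₐ[ℝ] (Fin d → Matrix (Fin ℓ) (Fin ℓ) K)} {k : Fin d → ℕ}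
  (hk : ρ.HasMultiplicities E k) {K' : Type*} [Ring K'] [StarRing K'] [Algebra ℝ K']
  [StarModule ℝ K'] {re : K' →ₗ[ℝ] ℝ} (hre : IsRealPart re) {r : ℕ} (hr : 0 < r)
  {κ ι : Type*} [Fintype κ] [DecidableEq κ] [Fintype ι] [DecidableEq ι]
  (i₀ : Fin p ⊕ Fin q) {y : R p q} {σ : ℝ} (hy : IsOddElement y σ)
  {𝔰 : Type*} [LieRing 𝔰] [LieAlgebra ℝ 𝔰]

include hk hre hr i₀ hy

/-- The case of a simple R⁺, acting by left multiplication on matrices with columns indexed by κ.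
The odd element acts by u ↦ φ(u) c, with φ the identity if y is central and complex conjugation if
it is antilinear. A right multiplication by b is skew for B(u, y v) exactly when c b^* + φ(b) c = 0.
-/
theorem SymRep.actsAs_one_block
    {E' : REven p q ≃ₐ[ℝ] (Fin 1 → Matrix (Fin r) (Fin r) K')} (hE' : IsStarIso E')
    (φ : K' →ₐ[ℝ] K') (hφφ : ∀ x, φ (φ x) = x) (hφre : ∀ x, re (φ x) = re x)
    (hφstar : ∀ x, φ (star x) = star (φ x))
    (c : Matrix κ κ K') (hc : (cᴴ).map φ = σ • c)
    (Θ : ((i : Fin d) → Matrix (Fin ℓ) (Fin (k i)) K) ≃ₗ[ℝ] Matrix (Fin r) κ K')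
    (haS : ∀ (s : REven p q) n, Θ (fun i => E (s : R p q) i * n i) = E' s 0 * Θ n)
    (hyU : ∀ n, Θ (fun i => E y i * n i) = (Θ n).map φ * c)
    (π : soPQ p q × 𝔰 →ₗ⁅ℝ⁆ Module.End ℝ (Matrix (Fin r) κ K')) (β : 𝔰 → Matrix κ κ K')
    (hπ : ∀ A x u, π (A, x) u = spinRep E' 0 A * u + u * β x) (hβ0 : β 0 = 0)
    (hβinj : ∀ x, β x = 0 → x = 0)
    (hβ : ∀ b, c * bᴴ + b.map φ * c = 0 ↔ ∃ x, β x = b) : ρ.ActsAs π := by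
  have : Nonempty (Fin r) := ⟨⟨0, hr⟩⟩
  have hπ0 : ∀ x u, π (0, x) u = u * β x := fun x u => by
    rw [hπ, map_zero, Matrix.zero_mul, zero_add]
  have hφφm : ∀ M : Matrix (Fin r) κ K', (M.map φ).map φ = M := fun M => by
    ext; simp [hφφ]
  have hBφ : ∀ u v : Matrix (Fin r) κ K', traceForm re (u.map φ) v = traceForm re u (v.map φ) := by
    intro u v
    rw [traceForm_apply, traceForm_apply, ← hφre]
    congr 1
    simp only [Matrix.trace, Matrix.diag_apply, Matrix.mul_apply, map_sum, map_mul,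
      Matrix.conjTranspose_apply, Matrix.map_apply, hφstar, hφφ]
  have hsk : ∀ (b : Matrix κ κ K') (u v : Matrix (Fin r) κ K'),
      traceForm re (u * b) (v.map φ * c) + traceForm re u ((v * b).map φ * c)
        = traceForm re u (v.map φ * (c * bᴴ + b.map φ * c)) := by
    intro b u v
    rw [hre.traceForm_mul_right, ← map_add, Matrix.mul_add, Matrix.map_mul]
    simp only [Matrix.mul_assoc]
  let aS : REven p q → Module.End ℝ (Matrix (Fin r) κ K') := fun s =>
    { toFun := fun u => E' s 0 * u
      map_add' := fun u v => Matrix.mul_add _ _ _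
      map_smul' := fun c u => Matrix.mul_smul _ _ _ }
  let yU : Module.End ℝ (Matrix (Fin r) κ K') :=
    { toFun := fun u => u.map φ * c
      map_add' := fun u v => by rw [Matrix.map_add _ (map_add φ), Matrix.add_mul]
      map_smul' := fun a u => by rw [Matrix.map_smul _ _ (map_smul φ a), Matrix.smul_mul]; rfl }
  refine ρ.actsAs_of_model E hk Θ (traceForm re) (fun u hu => hre.traceForm_pos hu)
    hre.traceForm_symm i₀ hy.sign_sq hy.sq hy.rev_eq hy.gen_mul hy.mul_gen aS haS yU hyU ?_ ?_ π ?_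
    ?_ ?_ ?_ ?_
  · intro s s' hs u v
    change traceForm re (E' s 0 * u) v = traceForm re u (E' s' 0 * v)
    rw [traceForm_mul_left, hE'.eq_star hs]; rfl
  · intro u v
    change traceForm re (u.map φ * c) v = σ * traceForm re u (v.map φ * c)
    rw [hre.traceForm_mul_right, hBφ, Matrix.map_mul, hc, Matrix.mul_smul, map_smul, smul_eq_mul]
  · intro A u
    rw [hπ, hβ0, Matrix.mul_zero, add_zero]; rfl
  · intro x hx
    refine hβinj x (hre.eq_zero_of_traceForm_mul (n := Fin r) _ fun u v => ?_)
    rw [← hπ0, hx]; simp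
  · intro x s u
    rw [hπ0, hπ0]
    exact Matrix.mul_assoc (E' s 0) u (β x)
  · intro x u v
    rw [hπ0, hπ0]
    exact (hsk (β x) u v).trans (by rw [(hβ _).2 ⟨x, rfl⟩]; simp)
  · intro Y hYS hY
    obtain ⟨b, hb⟩ := exists_eq_mul_right Y fun M u => by
      obtain ⟨s, hs⟩ := E'.surjective fun _ => M
      have := hYS s u
      change Y (E' s 0 * u) = E' s 0 * Y u at this
      rwa [hs] at this
    -- The test vector φ(v) is used so that v itself appears after y has applied φ.
    obtain ⟨x, hx⟩ := (hβ b).1 <| hre.eq_zero_of_traceForm_mul (n := Fin r) _ fun u v => by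
      have := hsk b u (v.map φ)
      rw [hφφm] at this
      rw [← this, ← hb, ← hb]
      have := hY u (v.map φ)
      change traceForm re (Y u) ((v.map φ).map φ * c)
        + traceForm re u ((Y (v.map φ)).map φ * c) = 0 at this
      rwa [hφφm] at this
    exact ⟨x, by ext1 u; rw [hπ0, hb, hx]⟩

/-- The case of two summands of R⁺, each preserved by y. The conditions on b and b' are independent,
so 𝔥 is a direct sum. -/
theorem SymRep.actsAs_two_blocks
    {E' : REven p q ≃ₐ[ℝ] (Fin 2 → Matrix (Fin r) (Fin r) K')} (hE' : IsStarIso E')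
    (c : Matrix κ κ K') (c' : Matrix ι ι K') (hc : cᴴ = σ • c) (hc' : c'ᴴ = σ • c')
    (Θ : ((i : Fin d) → Matrix (Fin ℓ) (Fin (k i)) K) ≃ₗ[ℝ]
      Matrix (Fin r) κ K' × Matrix (Fin r) ι K')
    (haS : ∀ (s : REven p q) n, Θ (fun i => E (s : R p q) i * n i)
      = (E' s 0 * (Θ n).1, E' s 1 * (Θ n).2))
    (hyU : ∀ n, Θ (fun i => E y i * n i) = ((Θ n).1 * c, (Θ n).2 * c'))
    (π : soPQ p q × 𝔰 →ₗ⁅ℝ⁆ Module.End ℝ (Matrix (Fin r) κ K' × Matrix (Fin r) ι K'))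
    (β : 𝔰 → Matrix κ κ K') (β' : 𝔰 → Matrix ι ι K')
    (hπ : ∀ A x u, π (A, x) u = (spinRep E' 0 A * u.1 + u.1 * β x, spinRep E' 1 A * u.2 + u.2 * β' x))
    (hβ0 : β 0 = 0) (hβ'0 : β' 0 = 0)
    (hβinj : ∀ x, β x = 0 → β' x = 0 → x = 0)
    (hβ : ∀ b b', c * bᴴ + b * c = 0 ∧ c' * b'ᴴ + b' * c' = 0 ↔ ∃ x, β x = b ∧ β' x = b') :
    ρ.ActsAs π := by
  have : Nonempty (Fin r) := ⟨⟨0, hr⟩⟩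
  have hπ0 : ∀ x u, π (0, x) u = (u.1 * β x, u.2 * β' x) := fun x u => by
    rw [hπ, map_zero, map_zero, Matrix.zero_mul, zero_add, Matrix.zero_mul, zero_add]
  have hsk : ∀ (b : Matrix κ κ K') (b' : Matrix ι ι K') (u v : Matrix (Fin r) κ K' × Matrix (Fin r) ι K'),
      prodForm (traceForm re) (traceForm re) (u.1 * b, u.2 * b') (v.1 * c, v.2 * c')
        + prodForm (traceForm re) (traceForm re) u (v.1 * b * c, v.2 * b' * c')
        = traceForm re u.1 (v.1 * (c * bᴴ + b * c)) + traceForm re u.2 (v.2 * (c' * b'ᴴ + b' * c')) := by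
    intro b b' u v
    rw [prodForm_apply, prodForm_apply, hre.traceForm_mul_right, hre.traceForm_mul_right,
      Matrix.mul_add, Matrix.mul_add, map_add, map_add]
    simp only [Matrix.mul_assoc]
    ring
  let aS : REven p q → Module.End ℝ (Matrix (Fin r) κ K' × Matrix (Fin r) ι K') := fun s =>
    { toFun := fun u => (E' s 0 * u.1, E' s 1 * u.2)
      map_add' := fun u v => Prod.ext (Matrix.mul_add _ _ _) (Matrix.mul_add _ _ _)
      map_smul' := fun c u => Prod.ext (Matrix.mul_smul _ _ _) (Matrix.mul_smul _ _ _) }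
  let yU : Module.End ℝ (Matrix (Fin r) κ K' × Matrix (Fin r) ι K') :=
    { toFun := fun u => (u.1 * c, u.2 * c')
      map_add' := fun u v => Prod.ext (Matrix.add_mul _ _ _) (Matrix.add_mul _ _ _)
      map_smul' := fun a u => Prod.ext (Matrix.smul_mul _ _ _) (Matrix.smul_mul _ _ _) }
  refine ρ.actsAs_of_model E hk Θ (prodForm (traceForm re) (traceForm re)) (fun u hu => ?_)
    (fun u v => ?_) i₀ hy.sign_sq hy.sq hy.rev_eq hy.gen_mul hy.mul_gen aS haS yU hyU ?_ ?_ π ?_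
    ?_ ?_ ?_ ?_
  · rw [prodForm_apply]
    by_cases h1 : u.1 = 0
    · exact add_pos_of_nonneg_of_pos (hre.traceForm_nonneg_pos _).1
        (hre.traceForm_pos fun h2 => hu (Prod.ext h1 h2))
    · exact add_pos_of_pos_of_nonneg (hre.traceForm_pos h1) (hre.traceForm_nonneg_pos _).1
  · rw [prodForm_apply, prodForm_apply, hre.traceForm_symm, hre.traceForm_symm u.2]
  · intro s s' hs u v
    change traceForm re (E' s 0 * u.1) v.1 + traceForm re (E' s 1 * u.2) v.2
      = traceForm re u.1 (E' s' 0 * v.1) + traceForm re u.2 (E' s' 1 * v.2)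
    rw [traceForm_mul_left, traceForm_mul_left, hE'.eq_star hs]; rfl
  · intro u v
    change traceForm re (u.1 * c) v.1 + traceForm re (u.2 * c') v.2
      = σ * (traceForm re u.1 (v.1 * c) + traceForm re u.2 (v.2 * c'))
    rw [hre.traceForm_mul_right, hre.traceForm_mul_right, hc, hc', Matrix.mul_smul, map_smul,
      Matrix.mul_smul, map_smul, smul_eq_mul, smul_eq_mul, mul_add]
  · intro A u
    rw [hπ, hβ0, Matrix.mul_zero, add_zero, hβ'0, Matrix.mul_zero, add_zero]; rfl
  · intro x hx
    refine hβinj x (hre.eq_zero_of_traceForm_mul (n := Fin r) _ fun u v => ?_)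
      (hre.eq_zero_of_traceForm_mul (n := Fin r) _ fun u v => ?_)
    · have := congrArg Prod.fst (hπ0 x (v, 0))
      rw [hx] at this
      rw [show v * β x = 0 from this.symm, map_zero]
    · have := congrArg Prod.snd (hπ0 x (0, v))
      rw [hx] at this
      rw [show v * β' x = 0 from this.symm, map_zero]
  · intro x s u
    rw [hπ0, hπ0]
    exact Prod.ext (Matrix.mul_assoc _ _ _) (Matrix.mul_assoc _ _ _)
  · intro x u v
    rw [hπ0, hπ0]
    obtain ⟨h1, h2⟩ := (hβ _ _).2 ⟨x, rfl, rfl⟩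
    exact (hsk (β x) (β' x) u v).trans (by rw [h1, h2]; simp)
  · intro Y hYS hY
    obtain ⟨b, b', hb⟩ := exists_eq_mul_right_prod Y fun M N u => by
      obtain ⟨s, hs⟩ := E'.surjective ![M, N]
      have := hYS s u
      change Y (E' s 0 * u.1, E' s 1 * u.2) = (E' s 0 * (Y u).1, E' s 1 * (Y u).2) at this
      rwa [hs] at this
    have key : ∀ u v : Matrix (Fin r) κ K' × Matrix (Fin r) ι K', traceForm re u.1 (v.1 * (c * bᴴ + b * c))
        + traceForm re u.2 (v.2 * (c' * b'ᴴ + b' * c')) = 0 := fun u v => by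
      rw [← hsk]
      have := hY u v
      rw [hb, hb] at this
      exact this
    obtain ⟨x, hx⟩ := (hβ b b').1
      ⟨hre.eq_zero_of_traceForm_mul (n := Fin r) _ fun u v => by
        simpa using key (u, 0) (v, 0),
       hre.eq_zero_of_traceForm_mul (n := Fin r) _ fun u v => by
        simpa using key (0, u) (0, v)⟩
    exact ⟨x, LinearMap.ext fun u => by rw [hπ0, hb, hx.1, hx.2]⟩

/-- If y interchanges the two blocks, skewness couples the right multiplications by b' = -b^*. One
matrix x = b^* remains free: hence 𝔤𝔩, with the second block dual to the first. -/
theorem SymRep.actsAs_swapped_blocks (hσ : σ = 1)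
    {E' : REven p q ≃ₐ[ℝ] (Fin 2 → Matrix (Fin r) (Fin r) K')} (hE' : IsStarIso E')
    (Θ : ((i : Fin d) → Matrix (Fin ℓ) (Fin (k i)) K) ≃ₗ[ℝ]
      Matrix (Fin r) κ K' × Matrix (Fin r) κ K')
    (haS : ∀ (s : REven p q) n, Θ (fun i => E (s : R p q) i * n i)
      = (E' s 0 * (Θ n).1, E' s 1 * (Θ n).2))
    (hyU : ∀ n, Θ (fun i => E y i * n i) = ((Θ n).2, (Θ n).1))
    (π : soPQ p q × Matrix κ κ K' →ₗ⁅ℝ⁆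
      Module.End ℝ (Matrix (Fin r) κ K' × Matrix (Fin r) κ K'))
    (hπ : ∀ A x u, π (A, x) u = (spinRep E' 0 A * u.1 + u.1 * xᴴ, spinRep E' 1 A * u.2 - u.2 * x)) :
    ρ.ActsAs π := by
  have : Nonempty (Fin r) := ⟨⟨0, hr⟩⟩
  have hπ0 : ∀ x u, π (0, x) u = (u.1 * xᴴ, u.2 * -x) := fun x u => by
    rw [hπ, map_zero, map_zero, Matrix.zero_mul, zero_add, Matrix.zero_mul, zero_sub, Matrix.mul_neg]
  have hsk : ∀ (b b' : Matrix κ κ K') (u v : Matrix (Fin r) κ K' × Matrix (Fin r) κ K'),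
      prodForm (traceForm re) (traceForm re) (u.1 * b, u.2 * b') (v.2, v.1)
        + prodForm (traceForm re) (traceForm re) u (v.2 * b', v.1 * b)
        = traceForm re u.1 (v.2 * (bᴴ + b')) + traceForm re u.2 (v.1 * (b'ᴴ + b)) := by
    intro b b' u v
    rw [prodForm_apply, prodForm_apply, hre.traceForm_mul_right, hre.traceForm_mul_right,
      Matrix.mul_add, Matrix.mul_add, map_add, map_add]
    ring
  let aS : REven p q → Module.End ℝ (Matrix (Fin r) κ K' × Matrix (Fin r) κ K') := fun s =>
    { toFun := fun u => (E' s 0 * u.1, E' s 1 * u.2)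
      map_add' := fun u v => Prod.ext (Matrix.mul_add _ _ _) (Matrix.mul_add _ _ _)
      map_smul' := fun c u => Prod.ext (Matrix.mul_smul _ _ _) (Matrix.mul_smul _ _ _) }
  let yU : Module.End ℝ (Matrix (Fin r) κ K' × Matrix (Fin r) κ K') :=
    { toFun := fun u => (u.2, u.1)
      map_add' := fun u v => rfl
      map_smul' := fun a u => rfl }
  refine ρ.actsAs_of_model E hk Θ (prodForm (traceForm re) (traceForm re)) (fun u hu => ?_)
    (fun u v => ?_) i₀ hy.sign_sq hy.sq hy.rev_eq hy.gen_mul hy.mul_gen aS haS yU hyU ?_ ?_ π ?_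
    ?_ ?_ ?_ ?_
  · rw [prodForm_apply]
    by_cases h1 : u.1 = 0
    · exact add_pos_of_nonneg_of_pos (hre.traceForm_nonneg_pos _).1
        (hre.traceForm_pos fun h2 => hu (Prod.ext h1 h2))
    · exact add_pos_of_pos_of_nonneg (hre.traceForm_pos h1) (hre.traceForm_nonneg_pos _).1
  · rw [prodForm_apply, prodForm_apply, hre.traceForm_symm, hre.traceForm_symm u.2]
  · intro s s' hs u v
    change traceForm re (E' s 0 * u.1) v.1 + traceForm re (E' s 1 * u.2) v.2
      = traceForm re u.1 (E' s' 0 * v.1) + traceForm re u.2 (E' s' 1 * v.2)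
    rw [traceForm_mul_left, traceForm_mul_left, hE'.eq_star hs]; rfl
  · intro u v
    change traceForm re u.2 v.1 + traceForm re u.1 v.2
      = σ * (traceForm re u.1 v.2 + traceForm re u.2 v.1)
    rw [hσ, one_mul, add_comm]
  · intro A u
    rw [hπ, Matrix.conjTranspose_zero, Matrix.mul_zero, add_zero, Matrix.mul_zero, sub_zero]; rfl
  · intro x hx
    have : -x = 0 := hre.eq_zero_of_traceForm_mul (n := Fin r) _ fun u v => by
      have := congrArg Prod.snd (hπ0 x (0, v))
      rw [hx] at this
      rw [show v * -x = 0 from this.symm, map_zero]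
    exact neg_eq_zero.1 this
  · intro x s u
    rw [hπ0, hπ0]
    exact Prod.ext (Matrix.mul_assoc _ _ _) (Matrix.mul_assoc _ _ _)
  · intro x u v
    rw [hπ0, hπ0]
    exact (hsk _ _ u v).trans (by simp)
  · intro Y hYS hY
    obtain ⟨b, b', hb⟩ := exists_eq_mul_right_prod Y fun M N u => by
      obtain ⟨s, hs⟩ := E'.surjective ![M, N]
      have := hYS s u
      change Y (E' s 0 * u.1, E' s 1 * u.2) = (E' s 0 * (Y u).1, E' s 1 * (Y u).2) at this
      rwa [hs] at this
    have h1 : bᴴ + b' = 0 := hre.eq_zero_of_traceForm_mul (n := Fin r) _ fun u v => by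
      have h2 := hsk b b' (u, 0) (0, v)
      have h3 := hY (u, 0) (0, v)
      rw [hb, hb] at h3
      simpa using h2.symm.trans h3
    refine ⟨bᴴ, LinearMap.ext fun u => ?_⟩
    rw [hπ0, hb, Matrix.conjTranspose_conjTranspose, eq_neg_of_add_eq_zero_right h1]

end Blocks

/-! ### The structure of the even algebra -/

section EvenAlgebra

variable {p q : ℕ}

/-- The distinguished generator is taken from a kind that is present, so a model of signature (q, p
- 1) or (p, q - 1) is used. -/
theorem exists_starIso {D : Type*} [Ring D] [StarRing D] [Algebra ℝ D] [StarModule ℝ D]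
    (hpq : 1 ≤ p + q)
    (hD : ∀ s t, (s = q ∧ t + 1 = p ∨ s = p ∧ t + 1 = q) → HasCliffordModel s t D) :
    ∃ E' : REven p q ≃ₐ[ℝ] D, IsStarIso E' := by
  rcases p with _ | p
  · obtain ⟨q, rfl⟩ : ∃ q', q = q' + 1 := ⟨q - 1, by omega⟩
    exact (isRSystem_gen 0 (q + 1)).swap.exists_even_equiv (hD 0 q (Or.inr ⟨rfl, rfl⟩))
  · exact (isRSystem_gen (p + 1) q).exists_even_equiv (hD q p (Or.inl ⟨rfl, rfl⟩))

theorem finrank_REven (hpq : 1 ≤ p + q) : Module.finrank ℝ (REven p q) = 2 ^ (p + q - 1) := by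
  rcases p with _ | p
  · obtain ⟨q, rfl⟩ : ∃ q', q = q' + 1 := ⟨q - 1, by omega⟩
    rw [(isRSystem_gen 0 (q + 1)).swap.finrank_even.2]
    congr 1; omega
  · rw [(isRSystem_gen (p + 1) q).finrank_even.2]
    congr 1; omega

/-- In this series s - t is q - p + 1 or p - q + 1. It is 0 or 2 if p - q ≡ ±1 modulo 8, 7 or 3 if
±2, 6 or 4 if ±3, 1 if 0, and 5 if 4. Both choices give the same matrix algebra. -/
theorem exists_starIso_real {m : ℕ} (hm : p + q = 2 * m + 1)
    (h : p % 8 = (q + 1) % 8 ∨ (p + 1) % 8 = q % 8) :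
    ∃ E' : REven p q ≃ₐ[ℝ] (Fin 1 → Matrix (Fin (2 ^ m)) (Fin (2 ^ m)) ℝ), IsStarIso E' := by
  refine exists_starIso (by omega) fun s t hst => ?_
  by_cases h0 : s % 8 = t % 8
  · exact hasCliffordModel_zero m (by omega) h0
  · obtain ⟨m, rfl⟩ : ∃ m', m = m' + 1 := ⟨m - 1, by omega⟩
    exact hasCliffordModel_two m (by omega) (by omega)

theorem exists_starIso_complex {m : ℕ} (hm : p + q = 2 * m + 2)
    (h : p % 8 = (q + 2) % 8 ∨ (p + 2) % 8 = q % 8) :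
    ∃ E' : REven p q ≃ₐ[ℝ] (Fin 1 → Matrix (Fin (2 ^ m)) (Fin (2 ^ m)) ℂ), IsStarIso E' := by
  refine exists_starIso (by omega) fun s t hst => ?_
  by_cases h0 : (s + 1) % 8 = t % 8
  · exact hasCliffordModel_seven m (by omega) h0
  · obtain ⟨m, rfl⟩ : ∃ m', m = m' + 1 := ⟨m - 1, by omega⟩
    exact hasCliffordModel_three m (by omega) (by omega)

theorem exists_starIso_quaternion {m : ℕ} (hm : p + q = 2 * m + 3)
    (h : p % 8 = (q + 3) % 8 ∨ (p + 3) % 8 = q % 8) :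
    ∃ E' : REven p q ≃ₐ[ℝ] (Fin 1 → Matrix (Fin (2 ^ m)) (Fin (2 ^ m)) ℍ[ℝ]), IsStarIso E' := by
  refine exists_starIso (by omega) fun s t hst => ?_
  by_cases h0 : (s + 2) % 8 = t % 8
  · exact hasCliffordModel_six m (by omega) h0
  · obtain ⟨m, rfl⟩ : ∃ m', m = m' + 1 := ⟨m - 1, by omega⟩
    exact hasCliffordModel_four m (by omega) (by omega)

theorem exists_starIso_real_two {m : ℕ} (hm : p + q = 2 * m + 2) (h : p % 8 = q % 8) :
    ∃ E' : REven p q ≃ₐ[ℝ] (Fin 2 → Matrix (Fin (2 ^ m)) (Fin (2 ^ m)) ℝ), IsStarIso E' :=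
  exists_starIso (by omega) fun s t hst => hasCliffordModel_one m (by omega) (by omega)

theorem exists_starIso_quaternion_two {m : ℕ} (hm : p + q = 2 * m + 4)
    (h : p % 8 = (q + 4) % 8) :
    ∃ E' : REven p q ≃ₐ[ℝ] (Fin 2 → Matrix (Fin (2 ^ m)) (Fin (2 ^ m)) ℍ[ℝ]), IsStarIso E' :=
  exists_starIso (by omega) fun s t hst => hasCliffordModel_five m (by omega) (by omega)

end EvenAlgebra

/-! ### Odd elements -/

section OddElements

variable {p q : ℕ}

theorem isOddElement_gen (i : Fin p ⊕ Fin q) : IsOddElement (gen p q i) 1 where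
  sign_sq := one_mul 1
  sq := by rw [gen_sq, one_smul]
  rev_eq := by rw [rev_gen, one_smul]
  gen_mul j := gen_mul_gen_mem p q j i
  mul_gen j := gen_mul_gen_mem p q i j

theorem IsOddElement.eq_of_central {y : R p q} {σ : ℝ} (hy : IsOddElement y σ)
    (hc : ∀ a, Commute y a) {s s' : REven p q} (h : (s' : R p q) * y = y * s) : s' = s := by
  rw [(hc s).eq] at h
  have := congrArg (fun z => σ • (z * y)) h
  simp only [mul_assoc, hy.sq, mul_smul_comm, smul_smul, hy.sign_sq, one_smul, mul_one] at this
  exact Subtype.ext this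

theorem volSign_mul_self (n : ℕ) : volSign n * volSign n = 1 := by
  rw [volSign_eq]; split_ifs <;> norm_num

theorem exists_central_volSign (h : Odd p) :
    ∃ z : R p q, (∀ a, Commute z a) ∧ IsOddElement z (volSign p) := by
  obtain ⟨z, h1, h2, h3, h4⟩ := (isRSystem_gen p q).exists_central_odd h
  exact ⟨z, h1, volSign_mul_self p, h2, h3, h4, fun i => by rw [(h1 _).eq]; exact h4 i⟩

theorem exists_central_volSign' (h : Odd q) :
    ∃ z : R p q, (∀ a, Commute z a) ∧ IsOddElement z (volSign q) := by
  obtain ⟨z, h1, h2, h3, h4⟩ := (isRSystem_gen p q).swap.exists_central_odd h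
  have h5 : ∀ i, gen p q i * z ∈ REven p q := fun i => by simpa using h4 i.swap
  exact ⟨z, h1, volSign_mul_self q, h2, h3, h5, fun i => by rw [(h1 _).eq]; exact h5 i⟩

/-- For odd p the square of the volume element is 1 if p ≡ 1 and -1 if p ≡ 3 modulo 4. -/
theorem exists_central_pos (h : p % 4 = 1 ∨ q % 4 = 1) :
    ∃ z : R p q, (∀ a, Commute z a) ∧ IsOddElement z 1 := by
  rcases h with h | h
  · simpa [volSign_eq, h] using exists_central_volSign (p := p) (q := q) (Nat.odd_iff.2 (by omega))
  · simpa [volSign_eq, h] using exists_central_volSign' (p := p) (q := q) (Nat.odd_iff.2 (by omega))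

theorem exists_central_neg (h : p % 4 = 3 ∨ q % 4 = 3) :
    ∃ z : R p q, (∀ a, Commute z a) ∧ IsOddElement z (-1) := by
  rcases h with h | h
  · simpa [volSign_eq, h] using exists_central_volSign (p := p) (q := q) (Nat.odd_iff.2 (by omega))
  · simpa [volSign_eq, h] using exists_central_volSign' (p := p) (q := q) (Nat.odd_iff.2 (by omega))

/-- Extension of an isomorphism of the even algebra to `R_{p,q}`. -/
theorem exists_extension (hpq : 1 ≤ p + q) {D' D : Type*} [Ring D'] [Algebra ℝ D'] [Ring D]
    [Algebra ℝ D] (E' : REven p q ≃ₐ[ℝ] D') {y : R p q} {σ : ℝ} (hy : IsOddElement y σ)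
    (κ : D' →ₐ[ℝ] D) (Y : D) (hY : Y * Y = σ • (1 : D))
    (hκ : ∀ s s' : REven p q, (s' : R p q) * y = y * s → κ (E' s') * Y = Y * κ (E' s))
    (hsurj : ∀ X, ∃ a b, X = κ a + κ b * Y)
    (hdim : Module.finrank ℝ D = 2 * Module.finrank ℝ D') :
    ∃ E : R p q ≃ₐ[ℝ] D, (∀ s : REven p q, E s = κ (E' s)) ∧ E y = Y := by
  have hi : Nonempty (Fin p ⊕ Fin q) := by
    rw [← Fintype.card_pos_iff]; simp; omega
  obtain ⟨i₀⟩ := hi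
  refine (isRSystem_gen p q).exists_equiv_of_even (κ.comp (E' : REven p q →ₐ[ℝ] D')) hy.sign_sq
    hy.sq i₀ hy.gen_mul hy.mul_gen hY hκ (fun d => ?_) ?_
  · obtain ⟨a, b, rfl⟩ := hsurj d
    exact ⟨E'.symm a, E'.symm b, by simp⟩
  · rw [hdim, ← E'.toLinearEquiv.finrank_eq, finrank_REven hpq, ← pow_succ']
    congr 1; omega

end OddElements

/-! ### Half-spin representations interchanged by a generator -/

section SwappedHalves

variable {p q : ℕ}

/-- If the even algebra is a sum of two matrix algebras and `p`, `q` are even, then the conjugation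
by a generator interchanges the two summands. -/
theorem exists_starIso_swap {K : Type*} [DivisionRing K] [StarRing K] [Algebra ℝ K]
    [Module.Finite ℝ K] {r : ℕ}
    (hp : Even p) (hq : Even q) (hpq : (p + q) % 4 = 0) (i₀ : Fin p ⊕ Fin q)
    {E : REven p q ≃ₐ[ℝ] (Fin 2 → Matrix (Fin r) (Fin r) K)} (hE : IsStarIso E) :
    ∃ E' : REven p q ≃ₐ[ℝ] (Fin 2 → Matrix (Fin r) (Fin r) K), IsStarIso E' ∧
      ∀ s s' : REven p q, (s' : R p q) * gen p q i₀ = gen p q i₀ * s →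
        E' s' 0 = E' s 1 ∧ E' s' 1 = E' s 0 := by
  have hsys := isRSystem_gen p q
  obtain ⟨w, hwS, hw1, hw2, -⟩ := hsys.exists_anticentral_even hp hq
  set w' : REven p q := ⟨w, hwS⟩ with hw'
  have hvs : volSign p * volSign q = 1 := by
    have h1 : p % 2 = 0 := Nat.even_iff.1 hp
    have h2 : q % 2 = 0 := Nat.even_iff.1 hq
    rw [volSign_eq, volSign_eq]
    split_ifs <;> first | omega | norm_num
  rw [hvs, one_smul] at hw2
  have hww : w' * w' = 1 := Subtype.ext hw2
  have hwc : ∀ s : REven p q, Commute w' s := fun s => Subtype.ext (hsys.commute_even hw1 s.2).eq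
  set g := gen p q i₀ with hg
  have hgg : g * g = 1 := gen_sq p q i₀
  have hmem : ∀ s : REven p q, g * s * g ∈ REven p q := fun s => hsys.conj_mem s.2 i₀ i₀
  -- Conjugation by the generator, an involution of R⁺ that sends the central element w to -w.
  let α : REven p q →ₐ[ℝ] REven p q :=
    AlgHom.ofLinearMap
      { toFun := fun s => ⟨g * s * g, hmem s⟩
        map_add' := fun a b => Subtype.ext <| by
          change g * ((a : R p q) + b) * g = g * a * g + g * b * g
          rw [mul_add, add_mul]
        map_smul' := fun c a => Subtype.ext <| by
          change g * (c • (a : R p q)) * g = c • (g * a * g)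
          rw [mul_smul_comm, smul_mul_assoc] }
      (Subtype.ext <| by
        change g * 1 * g = 1
        rw [mul_one, hgg])
      (fun a b => Subtype.ext <| by
        change g * ((a : R p q) * b) * g = g * a * g * (g * b * g)
        rw [show g * (a : R p q) * g * (g * b * g) = g * a * (g * g) * b * g by noncomm_ring, hgg]
        noncomm_ring)
  have hα : ∀ s, ((α s : REven p q) : R p q) = g * s * g := fun _ => rfl
  have hαα : ∀ s, α (α s) = s := fun s => Subtype.ext <| by
    rw [hα, hα, show g * (g * (s : R p q) * g) * g = (g * g) * s * (g * g) by noncomm_ring, hgg,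
      one_mul, mul_one]
  have hαw : α w' = -w' := Subtype.ext <| by
    rw [hα]
    change g * w * g = -w
    rw [hw1, neg_mul, mul_assoc, hgg, mul_one]
  have hnt : Nontrivial (REven p q) := by
    by_contra hn
    rw [not_nontrivial_iff_subsingleton] at hn
    have := Module.finrank_zero_of_subsingleton (R := ℝ) (M := REven p q)
    rw [finrank_REven (by rcases i₀ with i | i <;> have := i.pos <;> omega)] at this
    exact absurd this (by positivity)
  have h20 : ∀ s : REven p q, s = -s → s = 0 := fun s hs => by
    have h2 : (2 : ℝ) • s = 0 := by
      rw [two_smul]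
      nth_rw 1 [hs]
      exact neg_add_cancel s
    exact (smul_eq_zero.1 h2).resolve_left two_ne_zero
  have hr : 0 < r := by
    rcases Nat.eq_zero_or_pos r with rfl | h
    · exact absurd (E.injective (funext fun i => Subsingleton.elim _ _) : (0 : REven p q) = 1)
        zero_ne_one
    · exact h
  set o : Fin r := ⟨0, hr⟩
  -- A central element is scalar in each block, and w² = 1.
  have hcen : ∀ i, E w' i = 1 ∨ E w' i = -1 := by
    intro i
    have h1 : ∀ M, Commute (E w' i) M := fun M => by
      have := (hwc (E.symm (Pi.single i M))).map E
      rw [AlgEquiv.apply_symm_apply] at this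
      have := congrFun this.eq i
      rw [Commute, SemiconjBy]
      simpa using this
    have h2 : E w' i * E w' i = 1 := by
      rw [← Pi.mul_apply, ← map_mul, hww, map_one]; rfl
    obtain ⟨c, hc⟩ : ∃ c, E w' i = Matrix.diagonal fun _ => c := by
      refine ⟨E w' i o o, ?_⟩
      ext a b
      have h3 := congrFun (congrFun (h1 (Matrix.single b o 1)).eq a) o
      rw [Matrix.mul_single_apply_same, mul_one] at h3
      rw [h3, Matrix.diagonal_apply]
      split_ifs with hab
      · subst hab; rw [Matrix.single_mul_apply_same, one_mul]
      · rw [Matrix.single_mul_apply_of_ne (h := hab)]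
    have h4 : c * c = 1 := by
      have := congrFun (congrFun h2 o) o
      rw [hc, Matrix.diagonal_mul_diagonal, Matrix.diagonal_apply_eq, Matrix.one_apply_eq] at this
      exact this
    rcases mul_self_eq_one_iff.1 h4 with h5 | h5
    · left; rw [hc, h5, Matrix.diagonal_one]
    · right; rw [hc, h5, ← Matrix.diagonal_one, Matrix.diagonal_neg]
  -- As α w = -w, the element w is not ±1, so its signs in the two blocks are opposite.
  obtain ⟨η, hη, hη0, hη1⟩ : ∃ η : ℝ, η * η = 1 ∧ E w' 0 = η • 1 ∧ E w' 1 = -(η • 1) := by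
    have hne : E w' 0 ≠ E w' 1 := by
      intro h01
      have : w' = 1 ∨ w' = -1 := by
        rcases hcen 0 with h | h
        · left
          apply E.injective
          rw [map_one]
          ext1 i; fin_cases i
          exacts [h, h01 ▸ h]
        · right
          apply E.injective
          rw [map_neg, map_one]
          ext1 i; fin_cases i
          exacts [h, h01 ▸ h]
      rcases this with h | h
      · rw [h, map_one] at hαw
        exact one_ne_zero (h20 _ hαw)
      · rw [h, map_neg, map_one, neg_neg] at hαw
        exact one_ne_zero (h20 _ hαw.symm)
    rcases hcen 0 with h0 | h0 <;> rcases hcen 1 with h1 | h1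
    · exact absurd (h0.trans h1.symm) hne
    · exact ⟨1, by norm_num, by rw [h0, one_smul], by rw [h1, one_smul]⟩
    · exact ⟨-1, by norm_num, by rw [h0, neg_one_smul], by rw [h1, neg_one_smul, neg_neg]⟩
    · exact absurd (h0.trans h1.symm) hne
  -- The second block is redefined as the first one composed with α. Conjugation by the generator
  -- then interchanges the blocks exactly, not only up to an automorphism.
  let μ : REven p q →ₐ[ℝ] (Fin 2 → Matrix (Fin r) (Fin r) K) :=
    AlgHom.pi fun i => (Pi.evalAlgHom ℝ _ 0).comp
      ((E : REven p q →ₐ[ℝ] (Fin 2 → Matrix (Fin r) (Fin r) K)).comp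
        ((![AlgHom.id ℝ _, α] : Fin 2 → (REven p q →ₐ[ℝ] REven p q)) i))
  have hμ0 : ∀ s, μ s 0 = E s 0 := fun _ => rfl
  have hμ1 : ∀ s, μ s 1 = E (α s) 0 := fun _ => rfl
  have hinj : Function.Injective μ.toLinearMap := by
    rw [injective_iff_map_eq_zero]
    intro s hs
    have h0 : E s 0 = 0 := congrFun hs 0
    have h1 : E (α s) 0 = 0 := congrFun hs 1
    -- If both s and α s vanish in block 0, then s w = -η s and s w = η s, so s = 0.
    have key : ∀ t, E t 0 = 0 → t * w' = -η • t := by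
      intro t ht
      apply E.injective
      ext1 i
      rw [map_mul, map_smul, Pi.mul_apply, Pi.smul_apply]
      fin_cases i
      · change E t 0 * E w' 0 = -η • E t 0
        rw [ht, zero_mul, smul_zero]
      · change E t 1 * E w' 1 = -η • E t 1
        rw [hη1, mul_neg, mul_smul_comm, mul_one, neg_smul]
    have k1 := key s h0
    have k2 := congrArg α (key _ h1)
    rw [map_mul, hαα, hαw, map_smul, hαα, show s * -w' = -(s * w') from mul_neg s w', k1] at k2
    have k3 := congrArg (fun z => η • z) k2
    simp only [neg_smul, neg_neg, smul_neg, smul_smul, hη, one_smul] at k3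
    exact h20 _ k3
  have : Module.Finite ℝ (REven p q) := Module.Finite.equiv E.symm.toLinearEquiv
  have hsur : Function.Surjective μ.toLinearMap :=
    (LinearMap.injective_iff_surjective_of_finrank_eq_finrank E.toLinearEquiv.finrank_eq).1 hinj
  refine ⟨AlgEquiv.ofBijective μ ⟨hinj, hsur⟩, fun a => ?_, fun s s' hs => ?_⟩
  · obtain ⟨b, hb, hb'⟩ := hE a
    have hb2 : rev p q (α a) = MulOpposite.op ((α b : REven p q) : R p q) := by
      rw [hα, hα, map_mul, map_mul, hb, hg, rev_gen, ← MulOpposite.op_mul, ← MulOpposite.op_mul,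
        mul_assoc]
    refine ⟨b, hb, ?_⟩
    change μ b = star (μ a)
    ext1 i; fin_cases i
    · change μ b 0 = star (μ a 0)
      rw [hμ0, hμ0, hb']; rfl
    · change μ b 1 = star (μ a 1)
      rw [hμ1, hμ1, hE.eq_star hb2]; rfl
  · have h1 : s' = α s := Subtype.ext <| by
      rw [hα, ← hs, mul_assoc, hgg, mul_one]
    subst h1
    exact ⟨rfl, by change μ (α s) 1 = μ s 0; rw [hμ1, hμ0, hαα]⟩

end SwappedHalves

/-! ### Odd elements acting on the even algebra by complex conjugation -/

namespace IsRSystem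

section One

variable {A : Type*} [Ring A] [Algebra ℝ A] {p q : ℕ} {τ : A →ₐ[ℝ] Aᵐᵒᵖ}
  {S : Subalgebra ℝ A} {e : Fin (p + 1) ⊕ Fin q → A} (h : IsRSystem τ S e) {m : ℕ}

include h

theorem exists_central_root (hp : Even (p + 1)) (hq : Even q) (hn : (p + 1 + q) % 4 = 2) :
    ∃ w ∈ S, (∀ i, e i * w = -(w * e i)) ∧ w * w = -1 ∧ τ w = MulOpposite.op (-w) := by
  obtain ⟨w, hwS, hw, hww, hτw⟩ := h.exists_anticentral_even hp hq
  have hvs : volSign (p + 1) * volSign q = -1 := by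
    have h1 : (p + 1) % 2 = 0 := Nat.even_iff.1 hp
    have h2 : q % 2 = 0 := Nat.even_iff.1 hq
    rw [volSign_eq, volSign_eq]
    split_ifs <;> first | omega | norm_num
  rw [hvs, neg_one_smul] at hww hτw
  exact ⟨w, hwS, hw, hww, hτw⟩

/-- Take y = e_1. It commutes with e_1 e_k for k of the second kind and anticommutes with it for k
of the first, so after correction by w all 2m + 1 generators have square 1. Any 2m of them form a
system of signature (2m, 0), and 2m ≡ 0 modulo 8 yields real matrices. -/
theorem exists_even_equiv_conj_gen (hp : Even (p + 1)) (hq : Even q) (hn : (p + 1 + q) % 8 = 2)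
    (hm : p + 1 + q = 2 * m + 2) :
    ∃ E : S ≃ₐ[ℝ] (Fin 1 → Matrix (Fin (2 ^ m)) (Fin (2 ^ m)) ℂ),
      (∀ a : S, ∃ b : S, τ a.1 = MulOpposite.op b.1 ∧ E b = star (E a)) ∧
      ∀ a b : S, (b : A) * e (.inl 0) = e (.inl 0) * a → E b 0 = (E a 0).map (starRingEnd ℂ) := by
  obtain ⟨w, hwS, hw, hww, hτw⟩ := h.exists_central_root hp hq (by omega)
  have hsgn : ∀ k, sgn q p k * sgn q p k = 1 := sgn_sq q p
  let ι : Fin (2 * m) ⊕ Fin 0 → Fin q ⊕ Fin p := fun j =>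
    finSumFinEquiv.symm (Fin.castLE (by omega) (Equiv.sumEmpty _ _ j))
  refine h.exists_even_equiv_complex hwS hw hww hτw (hw _) (σ := 1) (by norm_num)
    (by rw [h.sq, one_smul]) (sgn q p) ?_ (fun k => ?_) ι ?_ ?_ (by omega) (by positivity)
    (hasCliffordModel_zero m (by omega) (by omega))
  · rintro (k | k) <;> simp [sgn]
  · change e (.inl 0) * (e (.inl 0) * e (restIndex p q k)) =
      sgn q p k • (e (.inl 0) * e (restIndex p q k) * e (.inl 0))
    have h1 : e (restIndex p q k) * e (.inl 0) = sgn q p k • (e (.inl 0) * e (restIndex p q k)) := by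
      rw [h.zero_mul_rest, smul_smul, hsgn, one_smul]
    rw [mul_assoc, h1, mul_smul_comm, smul_smul, hsgn, one_smul]
  · exact finSumFinEquiv.symm.injective.comp
      ((Fin.castLE_injective _).comp (Equiv.sumEmpty _ _).injective)
  · rintro (j | j)
    · rw [hsgn]; rfl
    · exact j.elim0

end One

section Three

variable {A : Type*} [Ring A] [Algebra ℝ A] {p q : ℕ} {τ : A →ₐ[ℝ] Aᵐᵒᵖ}
  {S : Subalgebra ℝ A} {e : Fin (p + 2 + 1) ⊕ Fin q → A} (h : IsRSystem τ S e) {m : ℕ}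

include h

/-- Take y = e_1 e_2 e_3, of square -1. It commutes with e_1 e_2, e_1 e_3 and e_1 e_k for k of the
second kind, and anticommutes with e_1 e_k for the later k of the first kind. After correction by w
there are two generators of square -1 and 2m - 1 of square 1. Dropping one of the latter leaves
signature (2m - 2, 2), whose difference is 0 modulo 8. -/
theorem exists_even_equiv_conj_three (hp : Even (p + 2 + 1)) (hq : Even q)
    (hn : (p + 2 + 1 + q) % 8 = 6) (hm : p + 2 + 1 + q = 2 * m + 2) :
    ∃ y : A, y * y = -1 ∧ τ y = MulOpposite.op (-y) ∧ (∀ i, e i * y ∈ S) ∧ (∀ i, y * e i ∈ S) ∧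
    ∃ E : S ≃ₐ[ℝ] (Fin 1 → Matrix (Fin (2 ^ m)) (Fin (2 ^ m)) ℂ),
      (∀ a : S, ∃ b : S, τ a.1 = MulOpposite.op b.1 ∧ E b = star (E a)) ∧
      ∀ a b : S, (b : A) * y = y * a → E b 0 = (E a 0).map (starRingEnd ℂ) := by
  obtain ⟨w, hwS, hw, hww, hτw⟩ := h.exists_central_root hp hq (by omega)
  set e₀ := e (.inl 0) with he₀
  set e₁ := e (.inl 1) with he₁
  set e₂ := e (.inl 2) with he₂
  have s0 : e₀ * e₀ = 1 := h.sq _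
  have s1 : e₁ * e₁ = 1 := h.sq _
  have s2 : e₂ * e₂ = 1 := h.sq _
  -- Numerals in `Fin (p + 2 + 1)` are reduced modulo p + 3, so their values depend on p + 3 > 2.
  have hv1 : ((1 : Fin (p + 2 + 1)) : ℕ) = 1 := Nat.mod_eq_of_lt (show 1 < p + 2 + 1 by omega)
  have hv2 : ((2 : Fin (p + 2 + 1)) : ℕ) = 2 := Nat.mod_eq_of_lt (show 2 < p + 2 + 1 by omega)
  have hanti : ∀ i j : Fin (p + 2 + 1), (i : ℕ) ≠ j →
      e (.inl i) * e (.inl j) = -(e (.inl j) * e (.inl i)) := fun i j hij => by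
    rw [h.comm _ _ (by simpa [Fin.ext_iff] using hij)]
    simp [sgn]
  have hcomm2 : ∀ (i : Fin (p + 2 + 1)) (j : Fin q),
      e (.inl i) * e (.inr j) = e (.inr j) * e (.inl i) := fun i j => by
    rw [h.comm _ _ (by simp)]
    simp [sgn]
  have a01 : e₀ * e₁ = -(e₁ * e₀) := hanti _ _ (by rw [hv1, Fin.val_zero]; norm_num)
  have a02 : e₀ * e₂ = -(e₂ * e₀) := hanti _ _ (by rw [hv2, Fin.val_zero]; norm_num)
  have a12 : e₁ * e₂ = -(e₂ * e₁) := hanti _ _ (by rw [hv1, hv2]; norm_num)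
  set y := e₀ * e₁ * e₂ with hy
  have hyy : y * y = -1 := by
    rw [hy, show e₀ * e₁ * e₂ * (e₀ * e₁ * e₂) = e₀ * e₁ * (e₂ * e₀) * e₁ * e₂ by noncomm_ring,
      show e₂ * e₀ = -(e₀ * e₂) by rw [a02, neg_neg],
      show e₀ * e₁ * -(e₀ * e₂) * e₁ * e₂ = -(e₀ * (e₁ * e₀) * (e₂ * e₁) * e₂) by noncomm_ring,
      show e₁ * e₀ = -(e₀ * e₁) by rw [a01, neg_neg], show e₂ * e₁ = -(e₁ * e₂) by rw [a12, neg_neg],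
      show -(e₀ * -(e₀ * e₁) * -(e₁ * e₂) * e₂) = -((e₀ * e₀) * (e₁ * e₁) * (e₂ * e₂)) by
        noncomm_ring, s0, s1, s2]
    simp
  have hy' : e₂ * (e₁ * e₀) = -y := by
    rw [show e₁ * e₀ = -(e₀ * e₁) by rw [a01, neg_neg], mul_neg, ← mul_assoc,
      show e₂ * e₀ = -(e₀ * e₂) by rw [a02, neg_neg], neg_mul, mul_assoc,
      show e₂ * e₁ = -(e₁ * e₂) by rw [a12, neg_neg], hy]
    noncomm_ring
  have hy0 : y * e₀ = e₀ * y := by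
    rw [hy, mul_assoc, show e₂ * e₀ = -(e₀ * e₂) by rw [a02, neg_neg], mul_neg, ← mul_assoc,
      mul_assoc e₀ e₁ e₀, show e₁ * e₀ = -(e₀ * e₁) by rw [a01, neg_neg]]
    noncomm_ring
  have hy1 : y * e₁ = e₁ * y := by
    rw [hy, mul_assoc, show e₂ * e₁ = -(e₁ * e₂) by rw [a12, neg_neg], a01]
    simp only [mul_neg, neg_mul, neg_neg, mul_assoc]
    rw [← mul_assoc e₀ e₁, a01]
    noncomm_ring
  have hy2 : y * e₂ = e₂ * y := by
    rw [hy, ← mul_assoc, ← mul_assoc, show e₂ * e₀ = -(e₀ * e₂) by rw [a02, neg_neg], neg_mul,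
      mul_assoc e₀ e₂ e₁, show e₂ * e₁ = -(e₁ * e₂) by rw [a12, neg_neg]]
    noncomm_ring
  have hyr : ∀ j : Fin q, y * e (.inr j) = e (.inr j) * y := fun j => by
    have c0 := hcomm2 0 j
    have c1 := hcomm2 1 j
    have c2 := hcomm2 2 j
    rw [← he₀] at c0
    rw [← he₁] at c1
    rw [← he₂] at c2
    rw [hy, mul_assoc, c2, ← mul_assoc, mul_assoc e₀, c1, ← mul_assoc, c0]
    noncomm_ring
  have hyl : ∀ i : Fin (p + 2 + 1), 2 < (i : ℕ) → y * e (.inl i) = -(e (.inl i) * y) := fun i hi => by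
    have c0 : e₀ * e (.inl i) = -(e (.inl i) * e₀) := hanti _ _ (by simp; omega)
    have c1 : e₁ * e (.inl i) = -(e (.inl i) * e₁) := hanti _ _ (by omega)
    have c2 : e₂ * e (.inl i) = -(e (.inl i) * e₂) := hanti _ _ (by omega)
    rw [hy, mul_assoc, c2, mul_neg, ← mul_assoc, mul_assoc e₀, c1, mul_neg, ← mul_assoc, c0]
    noncomm_ring
  have hmem1 : ∀ i, e i * y ∈ S := fun i => by
    rw [hy, show e i * (e₀ * e₁ * e₂) = (e i * e₀) * (e₁ * e₂) by noncomm_ring]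
    exact S.mul_mem (h.mul_mem _ _) (h.mul_mem _ _)
  have hmem2 : ∀ i, y * e i ∈ S := fun i => by
    rw [hy, mul_assoc]
    exact S.mul_mem (h.mul_mem _ _) (h.mul_mem _ _)
  have hτy : τ y = MulOpposite.op (-y) := by
    rw [hy, map_mul, map_mul, h.rev_eq, h.rev_eq, h.rev_eq, ← MulOpposite.op_mul,
      ← MulOpposite.op_mul, hy']
  have hyw : y * w = -(w * y) := by
    rw [hy, mul_assoc, hw, mul_neg, ← mul_assoc, mul_assoc e₀, hw, mul_neg, ← mul_assoc, hw]
    noncomm_ring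
  refine ⟨y, hyy, hτy, hmem1, hmem2, ?_⟩
  -- The first two remaining indices of the first kind belong to e_2 and e_3.
  let c : Fin q ⊕ Fin (p + 2) → ℝ := Sum.elim (fun _ => 1) fun i => if (i : ℕ) < 2 then 1 else -1
  let ι₁ : Fin q ⊕ Fin p → Fin q ⊕ Fin (p + 2) := Sum.map id fun i => i.addNat 2
  let ι : Fin (2 * m - 2) ⊕ Fin 2 → Fin q ⊕ Fin (p + 2) :=
    Sum.elim (fun j => ι₁ (finSumFinEquiv.symm (Fin.castLE (by omega) j)))
      fun i => .inr (Fin.castLE (by omega) i)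
  have hι₁ : ∀ j, c (ι₁ j) * sgn q (p + 2) (ι₁ j) = 1 := by
    rintro (j | j)
    · simp [c, ι₁, sgn]
    · simp [c, ι₁, sgn]
  refine h.exists_even_equiv_complex hwS hw hww hτw hyw (σ := -1) (by norm_num)
    (by rw [hyy, neg_one_smul]) c ?_ (fun k => ?_) ι ?_ ?_ (s := 2 * m - 2) (t := 2) (by omega)
    (by positivity) (hasCliffordModel_zero m (by omega) (by omega))
  · rintro (k | k)
    · exact Or.inl rfl
    · change (if (k : ℕ) < 2 then (1 : ℝ) else -1) = 1 ∨ (if (k : ℕ) < 2 then (1 : ℝ) else -1) = -1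
      split_ifs <;> simp
  · change y * (e₀ * e (restIndex (p + 2) q k)) = c k • (e₀ * e (restIndex (p + 2) q k) * y)
    have h1 : y * e (restIndex (p + 2) q k) = c k • (e (restIndex (p + 2) q k) * y) := by
      rcases k with k | k
      · change y * e (.inr k) = (1 : ℝ) • (e (.inr k) * y)
        rw [hyr, one_smul]
      · change y * e (.inl k.succ) = (if (k : ℕ) < 2 then (1 : ℝ) else -1) • (e (.inl k.succ) * y)
        split_ifs with hk
        · rw [one_smul]
          have hk' : k.succ = 1 ∨ k.succ = 2 := by
            simp only [Fin.ext_iff, hv1, hv2, Fin.val_succ]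
            omega
          rcases hk' with h | h
          · rw [h]; exact hy1
          · rw [h]; exact hy2
        · rw [hyl _ (by simp; omega), neg_one_smul]
    rw [← mul_assoc, hy0, mul_assoc, h1, mul_smul_comm, mul_assoc]
  · rintro (i | i) (j | j) hij
    · have h1 : Function.Injective ι₁ :=
        Sum.map_injective.2 ⟨Function.injective_id, fun a b hab => by
          simpa [Fin.ext_iff] using hab⟩
      rw [Fin.castLE_injective _ (finSumFinEquiv.symm.injective (h1 hij))]
    · exfalso
      change ι₁ _ = .inr _ at hij
      rcases h2 : finSumFinEquiv.symm (Fin.castLE (by omega : 2 * m - 2 ≤ q + p) i) with a | a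
      · rw [h2] at hij; simp [ι₁] at hij
      · rw [h2] at hij; simp [ι₁, Fin.ext_iff] at hij; omega
    · exfalso
      change .inr _ = ι₁ _ at hij
      rcases h2 : finSumFinEquiv.symm (Fin.castLE (by omega : 2 * m - 2 ≤ q + p) j) with a | a
      · rw [h2] at hij; simp [ι₁] at hij
      · rw [h2] at hij; simp [ι₁, Fin.ext_iff] at hij; omega
    · simpa [ι, Fin.ext_iff] using hij
  · rintro (j | j)
    · exact hι₁ _
    · change (if (j : ℕ) < 2 then (1 : ℝ) else -1) * -1 = -1
      rw [if_pos j.isLt, one_mul]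

end Three

end IsRSystem

/-! ### Complex conjugation on R⁺ when n ≡ 2 modulo 4. -/

section Conj

variable {p q m : ℕ}

theorem exists_starIso_conj_pos (hp : Even p) (hq : Even q) (hn : (p + q) % 8 = 2)
    (hm : p + q = 2 * m + 2) : ∃ (y : R p q)
      (E' : REven p q ≃ₐ[ℝ] (Fin 1 → Matrix (Fin (2 ^ m)) (Fin (2 ^ m)) ℂ)),
      IsOddElement y 1 ∧ IsStarIso E' ∧ ∀ s s' : REven p q, (s' : R p q) * y = y * s →
        E' s' 0 = (E' s 0).map (starRingEnd ℂ) := by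
  rcases p with _ | p
  · obtain ⟨q, rfl⟩ : ∃ q', q = q' + 1 := ⟨q - 1, by omega⟩
    obtain ⟨E, h1, h2⟩ := (isRSystem_gen 0 (q + 1)).swap.exists_even_equiv_conj_gen (m := m) hq hp
      (by omega) (by omega)
    exact ⟨_, E, isOddElement_gen _, h1, h2⟩
  · obtain ⟨E, h1, h2⟩ := (isRSystem_gen (p + 1) q).exists_even_equiv_conj_gen (m := m) hp hq
      (by omega) (by omega)
    exact ⟨_, E, isOddElement_gen _, h1, h2⟩

theorem exists_starIso_conj_neg (hp : Even p) (hq : Even q) (hn : (p + q) % 8 = 6)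
    (hm : p + q = 2 * m + 2) : ∃ (y : R p q)
      (E' : REven p q ≃ₐ[ℝ] (Fin 1 → Matrix (Fin (2 ^ m)) (Fin (2 ^ m)) ℂ)),
      IsOddElement y (-1) ∧ IsStarIso E' ∧ ∀ s s' : REven p q, (s' : R p q) * y = y * s →
        E' s' 0 = (E' s 0).map (starRingEnd ℂ) := by
  -- Three generators of the same kind are needed; p and q are even with sum at least 6, so one of
  -- them is at least 4.
  rcases (by grind : 4 ≤ p ∨ 4 ≤ q) with h | h
  · obtain ⟨p, rfl⟩ : ∃ p', p = p' + 2 + 1 := ⟨p - 3, by omega⟩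
    obtain ⟨y, y1, y2, y3, y4, E, h1, h2⟩ :=
      (isRSystem_gen (p + 2 + 1) q).exists_even_equiv_conj_three (m := m) hp hq (by omega) (by omega)
    exact ⟨y, E, ⟨by norm_num, by rw [y1, neg_one_smul], by rw [y2, neg_one_smul], y3, y4⟩, h1, h2⟩
  · obtain ⟨q, rfl⟩ : ∃ q', q = q' + 2 + 1 := ⟨q - 3, by omega⟩
    obtain ⟨y, y1, y2, y3, y4, E, h1, h2⟩ :=
      (isRSystem_gen p (q + 2 + 1)).swap.exists_even_equiv_conj_three (m := m) hq hp (by omega)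
        (by omega)
    exact ⟨y, E, ⟨by norm_num, by rw [y1, neg_one_smul], by rw [y2, neg_one_smul],
      fun i => by simpa using y3 i.swap, fun i => by simpa using y4 i.swap⟩, h1, h2⟩

end Conj

/-! ### Linear equivalences between spaces of matrices -/

section LinearEquivs

/-- A product with one factor. -/
def piFinOne (M : Fin 1 → Type*) [∀ i, AddCommGroup (M i)] [∀ i, Module ℝ (M i)] :
    ((i : Fin 1) → M i) ≃ₗ[ℝ] M 0 where
  toFun n := n 0
  invFun x := Fin.cons x fun j => j.elim0
  map_add' _ _ := rfl
  map_smul' _ _ := rfl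
  left_inv n := by ext i; fin_cases i; rfl
  right_inv _ := rfl

variable {K : Type*} [Ring K] [Algebra ℝ K] {n κ ι : Type*}

/-- Concatenation of the columns of two matrices. -/
def colsEquiv (n κ ι K : Type*) [Ring K] [Algebra ℝ K] :
    (Matrix n κ K × Matrix n ι K) ≃ₗ[ℝ] Matrix n (κ ⊕ ι) K where
  toFun u := Matrix.fromCols u.1 u.2
  invFun w := (w.toCols₁, w.toCols₂)
  map_add' u v := by ext i (j | j) <;> simp
  map_smul' c u := by ext i (j | j) <;> simp
  left_inv u := by simp
  right_inv w := by simp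

theorem fromCols_neg_right {k₁ k₂ : ℕ} (a : Matrix n (Fin k₁) K) (b : Matrix n (Fin k₂) K) :
    Matrix.fromCols a (-b) = Matrix.fromCols a b * diagPM k₁ k₂ K := by
  rw [diagPM]
  ext i (j | j) <;> simp [Matrix.mul_diagonal]

/-- A vector as a matrix with one column. -/
def columnEquiv (n K : Type*) [Ring K] [Algebra ℝ K] : (n → K) ≃ₗ[ℝ] Matrix n (Fin 1) K where
  toFun v := Matrix.of fun i _ => v i
  invFun w i := w i 0
  map_add' _ _ := rfl
  map_smul' _ _ := rfl
  left_inv _ := rfl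
  right_inv w := by ext i j; rw [Subsingleton.elim j 0]; rfl

theorem columnEquiv_mulVec [Fintype n] (M : Matrix n n K) (v : n → K) :
    columnEquiv n K (M *ᵥ v) = M * columnEquiv n K v := by
  ext i j
  rfl

/-- Reindexing of columns. -/
def reindexCols (n K : Type*) [Ring K] [Algebra ℝ K] (e : κ ≃ ι) :
    Matrix n κ K ≃ₗ[ℝ] Matrix n ι K := Matrix.reindexLinearEquiv ℝ K (Equiv.refl n) e

theorem reindexCols_mul [Fintype n] (e : κ ≃ ι) (M : Matrix n n K) (N : Matrix n κ K) :
    reindexCols n K e (M * N) = M * reindexCols n K e N := by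
  ext i j
  simp [reindexCols, Matrix.mul_apply]

end LinearEquivs

/-! ### Extensions by a central odd element with square `1` -/

section CentralPos

variable {p q : ℕ} {K : Type*} [Ring K] [StarRing K] [Algebra ℝ K]

/-- Adjoining a central z with z² = 1 doubles R⁺: each summand j of R⁺ yields the summands `plus j`
and `minus j` of R, where z is 1 and -1. -/
theorem exists_extension_pos [Module.Finite ℝ K] (hpq : 1 ≤ p + q) {d' d r : ℕ}
    (E' : REven p q ≃ₐ[ℝ] (Fin d' → Matrix (Fin r) (Fin r) K)) {z : R p q}
    (hz : ∀ a, Commute z a) (hzo : IsOddElement z 1) (g : Fin d → Fin d') (ε : Fin d → ℝ)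
    (plus minus : Fin d' → Fin d)
    (hε : ∀ i, i = plus (g i) ∧ ε i = 1 ∨ i = minus (g i) ∧ ε i = -1) (hd : d = 2 * d') :
    ∃ E : R p q ≃ₐ[ℝ] (Fin d → Matrix (Fin r) (Fin r) K),
      (∀ (s : REven p q) i, E s i = E' s (g i)) ∧ ∀ i, E z i = ε i • 1 := by
  have hεε : ∀ i, ε i * ε i = 1 := fun i => by rcases hε i with h | h <;> rw [h.2] <;> norm_num
  let κ : (Fin d' → Matrix (Fin r) (Fin r) K) →ₐ[ℝ] (Fin d → Matrix (Fin r) (Fin r) K) :=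
    AlgHom.pi fun i => Pi.evalAlgHom ℝ _ (g i)
  have hκ : ∀ D i, κ D i = D (g i) := fun _ _ => rfl
  obtain ⟨E, h1, h2⟩ := exists_extension hpq E' hzo κ (fun i => ε i • 1)
    (by ext1 i; simp [smul_smul, hεε])
    (fun s s' h => by
      rw [hzo.eq_of_central hz h]
      ext1 i; simp)
    (fun X => by
      -- The solution of a + b = X at `plus j` and a - b = X at `minus j`.
      refine ⟨fun j => (1 / 2 : ℝ) • (X (plus j) + X (minus j)),
        fun j => (1 / 2 : ℝ) • (X (plus j) - X (minus j)), ?_⟩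
      ext1 i
      simp only [Pi.add_apply, Pi.mul_apply, hκ]
      rcases hε i with ⟨h, h'⟩ | ⟨h, h'⟩ <;> rw [h', ← h, mul_smul_comm, mul_one, smul_smul]
        <;> module)
    (by
      simp only [Module.finrank_pi_fintype, Finset.sum_const, Finset.card_univ, Fintype.card_fin,
        smul_eq_mul, hd, mul_assoc])
  exact ⟨E, fun s i => by rw [h1, hκ], fun i => by rw [h2]⟩

variable {m : ℕ} (ρ : SymRep p q m) [StarModule ℝ K] {re : K →ₗ[ℝ] ℝ} (hre : IsRealPart re) {r : ℕ}
  (hr : 0 < r) (i₀ : Fin p ⊕ Fin q) {z : R p q} (hz : IsOddElement z 1)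
  {𝔰 : Type*} [LieRing 𝔰] [LieAlgebra ℝ 𝔰]

omit [Algebra ℝ K] [StarModule ℝ K] in
theorem diagPM_conjTranspose (k₁ k₂ : ℕ) : (diagPM k₁ k₂ K)ᴴ = diagPM k₁ k₂ K := by
  rw [diagPM, Matrix.diagonal_conjTranspose]
  congr 1
  ext (i | i) <;> simp

include hre hr i₀ hz

/-- The two irreducible representations agree on R⁺ and differ in the sign of z. On the concatenated
columns z is right multiplication by 1_{k₁,k₂}, which becomes the Gram matrix of 𝔰. -/
theorem SymRep.actsAs_extension_pos {E : R p q ≃ₐ[ℝ] (Fin 2 → Matrix (Fin r) (Fin r) K)}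
    {k : Fin 2 → ℕ} (hk : ρ.HasMultiplicities E k)
    {E' : REven p q ≃ₐ[ℝ] (Fin 1 → Matrix (Fin r) (Fin r) K)} (hE' : IsStarIso E')
    (hES : ∀ (s : REven p q) i, E s i = E' s 0) (hz0 : E z 0 = 1) (hz1 : E z 1 = -1)
    (π : soPQ p q × 𝔰 →ₗ⁅ℝ⁆ Module.End ℝ (Matrix (Fin r) (Fin (k 0) ⊕ Fin (k 1)) K))
    (β : 𝔰 → Matrix (Fin (k 0) ⊕ Fin (k 1)) (Fin (k 0) ⊕ Fin (k 1)) K)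
    (hπ : ∀ A x u, π (A, x) u = spinRep E' 0 A * u + u * β x) (hβ0 : β 0 = 0)
    (hβinj : ∀ x, β x = 0 → x = 0)
    (hβ : ∀ b, diagPM (k 0) (k 1) K * bᴴ + b * diagPM (k 0) (k 1) K = 0 ↔ ∃ x, β x = b) :
    ρ.ActsAs π := by
  let Θ : ((i : Fin 2) → Matrix (Fin r) (Fin (k i)) K) ≃ₗ[ℝ]
      Matrix (Fin r) (Fin (k 0) ⊕ Fin (k 1)) K :=
    (LinearEquiv.piFinTwo ℝ fun i => Matrix (Fin r) (Fin (k i)) K).trans (colsEquiv _ _ _ _)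
  have hΘ : ∀ n, Θ n = Matrix.fromCols (n 0) (n 1) := fun _ => rfl
  refine ρ.actsAs_one_block hk hre hr i₀ hz hE' (AlgHom.id ℝ K) (fun _ => rfl) (fun _ => rfl)
    (fun _ => rfl) (diagPM (k 0) (k 1) K) ?_ Θ (fun s n => ?_) (fun n => ?_) π β hπ hβ0 hβinj ?_
  · rw [diagPM_conjTranspose, one_smul]; exact Matrix.map_id _
  · rw [hΘ, hΘ, hES, hES, Matrix.mul_fromCols]
  · rw [hΘ, hΘ, hz0, hz1, Matrix.one_mul, Matrix.neg_mul, Matrix.one_mul, fromCols_neg_right]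
    congr 1
  · intro b
    rw [← hβ]
    rfl

theorem SymRep.actsAs_extension_pos_two {E : R p q ≃ₐ[ℝ] (Fin 4 → Matrix (Fin r) (Fin r) K)}
    {k : Fin 4 → ℕ} (hk : ρ.HasMultiplicities E k)
    {E' : REven p q ≃ₐ[ℝ] (Fin 2 → Matrix (Fin r) (Fin r) K)} (hE' : IsStarIso E')
    (hES0 : ∀ s : REven p q, E s 0 = E' s 0) (hES1 : ∀ s : REven p q, E s 1 = E' s 0)
    (hES2 : ∀ s : REven p q, E s 2 = E' s 1) (hES3 : ∀ s : REven p q, E s 3 = E' s 1)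
    (hz0 : E z 0 = 1) (hz1 : E z 1 = -1) (hz2 : E z 2 = 1) (hz3 : E z 3 = -1)
    (π : soPQ p q × 𝔰 →ₗ⁅ℝ⁆ Module.End ℝ (Matrix (Fin r) (Fin (k 0) ⊕ Fin (k 1)) K ×
      Matrix (Fin r) (Fin (k 2) ⊕ Fin (k 3)) K))
    (β : 𝔰 → Matrix (Fin (k 0) ⊕ Fin (k 1)) (Fin (k 0) ⊕ Fin (k 1)) K)
    (β' : 𝔰 → Matrix (Fin (k 2) ⊕ Fin (k 3)) (Fin (k 2) ⊕ Fin (k 3)) K)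
    (hπ : ∀ A x u, π (A, x) u = (spinRep E' 0 A * u.1 + u.1 * β x, spinRep E' 1 A * u.2 + u.2 * β' x))
    (hβ0 : β 0 = 0) (hβ'0 : β' 0 = 0) (hβinj : ∀ x, β x = 0 → β' x = 0 → x = 0)
    (hβ : ∀ b b', diagPM (k 0) (k 1) K * bᴴ + b * diagPM (k 0) (k 1) K = 0 ∧
      diagPM (k 2) (k 3) K * b'ᴴ + b' * diagPM (k 2) (k 3) K = 0 ↔ ∃ x, β x = b ∧ β' x = b') :
    ρ.ActsAs π := by
  let Θ₀ : ((i : Fin 4) → Matrix (Fin r) (Fin (k i)) K) ≃ₗ[ℝ]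
      (Matrix (Fin r) (Fin (k 0)) K × Matrix (Fin r) (Fin (k 1)) K) ×
        (Matrix (Fin r) (Fin (k 2)) K × Matrix (Fin r) (Fin (k 3)) K) :=
    { toFun := fun n => ((n 0, n 1), (n 2, n 3))
      invFun := fun x => Fin.cons x.1.1 (Fin.cons x.1.2 (Fin.cons x.2.1 (Fin.cons x.2.2
        fun j => j.elim0)))
      map_add' := fun _ _ => rfl
      map_smul' := fun _ _ => rfl
      left_inv := fun n => by ext1 i; fin_cases i <;> rfl
      right_inv := fun _ => rfl }
  let Θ := Θ₀.trans ((colsEquiv _ _ _ _).prodCongr (colsEquiv _ _ _ _))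
  have hΘ : ∀ n, Θ n = (Matrix.fromCols (n 0) (n 1), Matrix.fromCols (n 2) (n 3)) := fun _ => rfl
  refine ρ.actsAs_two_blocks hk hre hr i₀ hz hE' (diagPM (k 0) (k 1) K) (diagPM (k 2) (k 3) K)
    (by rw [diagPM_conjTranspose, one_smul]) (by rw [diagPM_conjTranspose, one_smul]) Θ
    (fun s n => ?_) (fun n => ?_) π β β' hπ hβ0 hβ'0 hβinj hβ
  · rw [hΘ, hΘ, hES0, hES1, hES2, hES3, Matrix.mul_fromCols, Matrix.mul_fromCols]
  · rw [hΘ, hΘ, hz0, hz1, hz2, hz3, Matrix.one_mul, Matrix.neg_mul, Matrix.one_mul, Matrix.one_mul,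
      Matrix.neg_mul, Matrix.one_mul, fromCols_neg_right, fromCols_neg_right]

end CentralPos

/-! ### Extensions by a central odd element with square `-1` -/

section CentralNeg

variable {p q : ℕ} {K K' : Type*} [Ring K] [Algebra ℝ K] [Ring K'] [StarRing K'] [Algebra ℝ K']
  {r ℓ : ℕ}

/-- An extension of `M(r; 𝕂')` to `M(ℓ; 𝕂)` by a central element `J` with square `-1`, together with
a description of the columns over `𝕂` in terms of columns over `𝕂'`. -/
structure CentralExtension (K K' : Type*) [Ring K] [Algebra ℝ K] [Ring K'] [StarRing K']
    [Algebra ℝ K'] (r ℓ : ℕ) (κ : ℕ → Type) [∀ k, Fintype (κ k)] [∀ k, DecidableEq (κ k)] where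
  toAlgHom : Matrix (Fin r) (Fin r) K' →ₐ[ℝ] Matrix (Fin ℓ) (Fin ℓ) K
  J : Matrix (Fin ℓ) (Fin ℓ) K
  J_sq : J * J = -1
  commute : ∀ M, toAlgHom M * J = J * toAlgHom M
  surj : ∀ X, ∃ a b, X = toAlgHom a + toAlgHom b * J
  finrank_eq : Module.finrank ℝ (Matrix (Fin ℓ) (Fin ℓ) K)
    = 2 * Module.finrank ℝ (Matrix (Fin r) (Fin r) K')
  c : ∀ k, Matrix (κ k) (κ k) K'
  c_star : ∀ k, (c k)ᴴ = -c k
  equiv : ∀ k, Matrix (Fin ℓ) (Fin k) K ≃ₗ[ℝ] Matrix (Fin r) (κ k) K'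
  equiv_mul : ∀ k M n, equiv k (toAlgHom M * n) = M * equiv k n
  equiv_J : ∀ k n, equiv k (J * n) = equiv k n * c k

variable {κ : ℕ → Type} [∀ k, Fintype (κ k)] [∀ k, DecidableEq (κ k)]
  (C : CentralExtension K K' r ℓ κ)

/-- The central element z of square -1 is sent to J in every summand. -/
theorem CentralExtension.exists_extension [Module.Finite ℝ K] [Module.Finite ℝ K']
    (hpq : 1 ≤ p + q) {d : ℕ}
    (E' : REven p q ≃ₐ[ℝ] (Fin d → Matrix (Fin r) (Fin r) K')) {z : R p q}
    (hz : ∀ a, Commute z a) (hzo : IsOddElement z (-1)) :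
    ∃ E : R p q ≃ₐ[ℝ] (Fin d → Matrix (Fin ℓ) (Fin ℓ) K),
      (∀ (s : REven p q) i, E s i = C.toAlgHom (E' s i)) ∧ ∀ i, E z i = C.J := by
  let f : (Fin d → Matrix (Fin r) (Fin r) K') →ₐ[ℝ] (Fin d → Matrix (Fin ℓ) (Fin ℓ) K) :=
    AlgHom.pi fun i => C.toAlgHom.comp (Pi.evalAlgHom ℝ _ i)
  have hf : ∀ D i, f D i = C.toAlgHom (D i) := fun _ _ => rfl
  obtain ⟨E, h1, h2⟩ := CliffordQuartic.exists_extension hpq E' hzo f (fun i => C.J)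
    (by ext1 i; rw [Pi.mul_apply, C.J_sq, neg_one_smul]; rfl)
    (fun s s' h => by
      rw [hzo.eq_of_central hz h]
      ext1 i
      exact C.commute _)
    (fun X => by
      choose a b hab using C.surj
      exact ⟨fun i => a (X i), fun i => b (X i), funext fun i => hab _⟩)
    (by
      simp only [Module.finrank_pi_fintype, Finset.sum_const, Finset.card_univ, Fintype.card_fin,
        smul_eq_mul, C.finrank_eq]
      ring)
  exact ⟨E, fun s i => by rw [h1, hf], fun i => by rw [h2]⟩

/-- 𝕂^ℓ is the case of one column, and the number of copies is the size of κ 1. -/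
theorem CentralExtension.restrictsTo {d : ℕ}
    {E : R p q ≃ₐ[ℝ] (Fin d → Matrix (Fin ℓ) (Fin ℓ) K)}
    {E' : REven p q ≃ₐ[ℝ] (Fin d → Matrix (Fin r) (Fin r) K')}
    (hES : ∀ (s : REven p q) i, E s i = C.toAlgHom (E' s i)) {c : ℕ} (e : κ 1 ≃ Fin c) (i : Fin d) :
    RestrictsTo E E' i c i :=
  ⟨((columnEquiv (Fin ℓ) K).trans (C.equiv 1)).trans (reindexCols (Fin r) K' e), fun a v => by
    simp only [LinearEquiv.trans_apply]
    rw [columnEquiv_mulVec, hES, C.equiv_mul, reindexCols_mul]⟩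

variable {m : ℕ} (ρ : SymRep p q m) [StarModule ℝ K'] {re : K' →ₗ[ℝ] ℝ} (hre : IsRealPart re)
  (hr : 0 < r) (i₀ : Fin p ⊕ Fin q) {z : R p q} (hz : IsOddElement z (-1))
  {𝔰 : Type*} [LieRing 𝔰] [LieAlgebra ℝ 𝔰]

include hre hr i₀ hz

theorem CentralExtension.actsAs {E : R p q ≃ₐ[ℝ] (Fin 1 → Matrix (Fin ℓ) (Fin ℓ) K)}
    {k : Fin 1 → ℕ} (hk : ρ.HasMultiplicities E k)
    {E' : REven p q ≃ₐ[ℝ] (Fin 1 → Matrix (Fin r) (Fin r) K')} (hE' : IsStarIso E')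
    (hES : ∀ (s : REven p q) i, E s i = C.toAlgHom (E' s i)) (hEz : ∀ i, E z i = C.J)
    (π : soPQ p q × 𝔰 →ₗ⁅ℝ⁆ Module.End ℝ (Matrix (Fin r) (κ (k 0)) K'))
    (β : 𝔰 → Matrix (κ (k 0)) (κ (k 0)) K')
    (hπ : ∀ A x u, π (A, x) u = spinRep E' 0 A * u + u * β x) (hβ0 : β 0 = 0)
    (hβinj : ∀ x, β x = 0 → x = 0)
    (hβ : ∀ b, C.c (k 0) * bᴴ + b * C.c (k 0) = 0 ↔ ∃ x, β x = b) : ρ.ActsAs π := by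
  let Θ := (piFinOne fun i => Matrix (Fin ℓ) (Fin (k i)) K).trans (C.equiv (k 0))
  have hΘ : ∀ n, Θ n = C.equiv (k 0) (n 0) := fun _ => rfl
  refine ρ.actsAs_one_block hk hre hr i₀ hz hE' (AlgHom.id ℝ K') (fun _ => rfl) (fun _ => rfl)
    (fun _ => rfl) (C.c (k 0)) ?_ Θ (fun s n => ?_) (fun n => ?_) π β hπ hβ0 hβinj ?_
  · rw [C.c_star, neg_one_smul]; exact Matrix.map_id _
  · rw [hΘ, hΘ, hES, C.equiv_mul]
  · rw [hΘ, hΘ, hEz, C.equiv_J]; rfl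
  · intro b
    rw [← hβ]
    rfl

theorem CentralExtension.actsAs_two {E : R p q ≃ₐ[ℝ] (Fin 2 → Matrix (Fin ℓ) (Fin ℓ) K)}
    {k : Fin 2 → ℕ} (hk : ρ.HasMultiplicities E k)
    {E' : REven p q ≃ₐ[ℝ] (Fin 2 → Matrix (Fin r) (Fin r) K')} (hE' : IsStarIso E')
    (hES : ∀ (s : REven p q) i, E s i = C.toAlgHom (E' s i)) (hEz : ∀ i, E z i = C.J)
    (π : soPQ p q × 𝔰 →ₗ⁅ℝ⁆ Module.End ℝ (Matrix (Fin r) (κ (k 0)) K' × Matrix (Fin r) (κ (k 1)) K'))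
    (β : 𝔰 → Matrix (κ (k 0)) (κ (k 0)) K') (β' : 𝔰 → Matrix (κ (k 1)) (κ (k 1)) K')
    (hπ : ∀ A x u, π (A, x) u = (spinRep E' 0 A * u.1 + u.1 * β x, spinRep E' 1 A * u.2 + u.2 * β' x))
    (hβ0 : β 0 = 0) (hβ'0 : β' 0 = 0) (hβinj : ∀ x, β x = 0 → β' x = 0 → x = 0)
    (hβ : ∀ b b', C.c (k 0) * bᴴ + b * C.c (k 0) = 0 ∧ C.c (k 1) * b'ᴴ + b' * C.c (k 1) = 0 ↔
      ∃ x, β x = b ∧ β' x = b') : ρ.ActsAs π := by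
  let Θ := (LinearEquiv.piFinTwo ℝ fun i => Matrix (Fin ℓ) (Fin (k i)) K).trans
    ((C.equiv (k 0)).prodCongr (C.equiv (k 1)))
  have hΘ : ∀ n, Θ n = (C.equiv (k 0) (n 0), C.equiv (k 1) (n 1)) := fun _ => rfl
  refine ρ.actsAs_two_blocks hk hre hr i₀ hz hE' (C.c (k 0)) (C.c (k 1))
    (by rw [C.c_star, neg_one_smul]) (by rw [C.c_star, neg_one_smul]) Θ
    (fun s n => ?_) (fun n => ?_) π β β' hπ hβ0 hβ'0 hβinj hβ
  · rw [hΘ, hΘ, hES, hES, C.equiv_mul, C.equiv_mul]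
  · rw [hΘ, hΘ, hEz, hEz, C.equiv_J, C.equiv_J]

end CentralNeg

/-- `M(r; ℂ)` as an extension of `M(r; ℝ)`. -/
def complexExtension (r : ℕ) : CentralExtension ℂ ℝ r r fun k => Fin k ⊕ Fin k where
  toAlgHom := Complex.ofRealAm.mapMatrix
  J := Matrix.diagonal fun _ => Complex.I
  J_sq := by
    rw [Matrix.diagonal_mul_diagonal, Complex.I_mul_I, ← Matrix.diagonal_one, Matrix.diagonal_neg]
  commute M := by
    ext i j
    rw [Matrix.mul_diagonal, Matrix.diagonal_mul, mul_comm]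
  surj X := ⟨X.map Complex.re, X.map Complex.im, by
    ext i j
    rw [Matrix.add_apply, Matrix.mul_diagonal]
    exact (Complex.re_add_im (X i j)).symm⟩
  finrank_eq := by
    rw [Module.finrank_matrix, Module.finrank_matrix, Complex.finrank_real_complex,
      Module.finrank_self]
    ring
  -- Since i (a + b i) = -b + a i, multiplication by i sends the real columns (a, b) to (-b, a).
  c k := Matrix.fromBlocks 0 1 (-1) 0
  c_star k := by
    rw [Matrix.fromBlocks_conjTranspose, Matrix.fromBlocks_neg]
    simp
  equiv k :=
    { toFun := fun n => Matrix.fromCols (n.map Complex.re) (n.map Complex.im)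
      invFun := fun w => Matrix.of fun i j => ⟨w i (.inl j), w i (.inr j)⟩
      map_add' := fun u v => by ext i (j | j) <;> simp
      map_smul' := fun c u => by ext i (j | j) <;> simp
      left_inv := fun n => by ext i j <;> simp
      right_inv := fun w => by ext i (j | j) <;> simp }
  equiv_mul k M n := by
    ext i (j | j) <;> simp [Matrix.mul_apply, Complex.re_sum, Complex.im_sum]
  equiv_J k n := by
    refine Eq.trans ?_ (Matrix.fromCols_mul_fromBlocks (n.map Complex.re) (n.map Complex.im)
      (0 : Matrix (Fin k) (Fin k) ℝ) 1 (-1) 0).symm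
    ext i (j | j) <;> simp [Matrix.diagonal_mul]

/-! ### Block matrices with respect to a splitting of the index set -/

section BlockMatrices

variable {K : Type*} [Ring K] [Algebra ℝ K] {r ℓ : ℕ} (e : Fin r ⊕ Fin r ≃ Fin ℓ)

/-- Block matrices as matrices indexed by `Fin ℓ`. -/
def blockEquiv : Matrix (Fin r ⊕ Fin r) (Fin r ⊕ Fin r) K ≃ₐ[ℝ] Matrix (Fin ℓ) (Fin ℓ) K :=
  Matrix.reindexAlgEquiv ℝ K e

theorem blockEquiv_mul_apply {κ : Type*} (A B C D : Matrix (Fin r) (Fin r) K)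
    (n : Matrix (Fin ℓ) κ K) (i : Fin r) (j : κ) :
    (blockEquiv e (Matrix.fromBlocks A B C D) * n) (e (.inl i)) j
        = ∑ a, A i a * n (e (.inl a)) j + ∑ a, B i a * n (e (.inr a)) j ∧
      (blockEquiv e (Matrix.fromBlocks A B C D) * n) (e (.inr i)) j
        = ∑ a, C i a * n (e (.inl a)) j + ∑ a, D i a * n (e (.inr a)) j := by
  constructor <;>
    rw [Matrix.mul_apply, ← e.sum_comp, Fintype.sum_sum_type] <;>
    simp [blockEquiv, Matrix.reindexAlgEquiv_apply]

/-- The upper and the lower half of the rows of a matrix. -/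
def rowsEquiv (κ : Type*) :
    Matrix (Fin ℓ) κ K ≃ₗ[ℝ] Matrix (Fin r) κ K × Matrix (Fin r) κ K where
  toFun n := (Matrix.of fun i j => n (e (.inl i)) j, Matrix.of fun i j => n (e (.inr i)) j)
  invFun u := Matrix.of fun i j => Matrix.fromRows u.1 u.2 (e.symm i) j
  map_add' _ _ := rfl
  map_smul' _ _ := rfl
  left_inv n := by
    ext i j
    obtain ⟨a | a, rfl⟩ := e.surjective i <;> simp
  right_inv u := by
    refine Prod.ext ?_ ?_ <;> ext i j <;> simp

theorem rowsEquiv_mul {κ : Type*} (A B C D : Matrix (Fin r) (Fin r) K) (n : Matrix (Fin ℓ) κ K) :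
    rowsEquiv e κ (blockEquiv e (Matrix.fromBlocks A B C D) * n)
      = (A * (rowsEquiv e κ n).1 + B * (rowsEquiv e κ n).2,
        C * (rowsEquiv e κ n).1 + D * (rowsEquiv e κ n).2) := by
  refine Prod.ext ?_ ?_ <;> ext i j
  · exact (blockEquiv_mul_apply e A B C D n i j).1
  · exact (blockEquiv_mul_apply e A B C D n i j).2

end BlockMatrices

/-! ### Quaternionic columns as complex columns -/

section QuaternionColumns

variable {r ℓ : ℕ} (e : Fin r ⊕ Fin r ≃ Fin ℓ)

/-- The real-linear maps `ℍ → ℂ` that occur in the description of `ℍ` by complex matrices. -/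
def complexPart (f g : ℍ[ℝ] →ₗ[ℝ] ℝ) : ℍ[ℝ] →ₗ[ℝ] ℂ where
  toFun x := ⟨f x, g x⟩
  map_add' x y := by apply Complex.ext <;> simp
  map_smul' c x := by apply Complex.ext <;> simp

def quaternionI : ℍ[ℝ] →ₗ[ℝ] ℝ where
  toFun x := x.imI
  map_add' _ _ := rfl
  map_smul' _ _ := rfl

def quaternionJ : ℍ[ℝ] →ₗ[ℝ] ℝ where
  toFun x := x.imJ
  map_add' _ _ := rfl
  map_smul' _ _ := rfl

def quaternionK : ℍ[ℝ] →ₗ[ℝ] ℝ where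
  toFun x := x.imK
  map_add' _ _ := rfl
  map_smul' _ _ := rfl

theorem quaternionI_apply (x : ℍ[ℝ]) : quaternionI x = x.imI := rfl
theorem quaternionJ_apply (x : ℍ[ℝ]) : quaternionJ x = x.imJ := rfl
theorem quaternionK_apply (x : ℍ[ℝ]) : quaternionK x = x.imK := rfl

/-- The entries of the `2 × 2` complex matrix of a quaternion. -/
def quatEntry : Fin 4 → (ℍ[ℝ] →ₗ[ℝ] ℂ) :=
  ![complexPart quaternionRe quaternionJ, complexPart (-quaternionI) quaternionK,
    complexPart quaternionI quaternionK, complexPart quaternionRe (-quaternionJ)]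

theorem quatEntry_zero (x : ℍ[ℝ]) : quatEntry 0 x = ⟨x.re, x.imJ⟩ := rfl
theorem quatEntry_one (x : ℍ[ℝ]) : quatEntry 1 x = ⟨-x.imI, x.imK⟩ := rfl
theorem quatEntry_two (x : ℍ[ℝ]) : quatEntry 2 x = ⟨x.imI, x.imK⟩ := rfl
theorem quatEntry_three (x : ℍ[ℝ]) : quatEntry 3 x = ⟨x.re, -x.imJ⟩ := rfl

/-- A quaternion is written a + i b with a, b in ℝ + ℝ j. The four entries are the matrix of left
multiplication on the right vector space ℍ over ℝ + ℝ j, with j read as the complex unit. -/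
theorem quatEntry_mul (x y : ℍ[ℝ]) :
    quatEntry 0 (x * y) = quatEntry 0 x * quatEntry 0 y + quatEntry 1 x * quatEntry 2 y ∧
    quatEntry 1 (x * y) = quatEntry 0 x * quatEntry 1 y + quatEntry 1 x * quatEntry 3 y ∧
    quatEntry 2 (x * y) = quatEntry 2 x * quatEntry 0 y + quatEntry 3 x * quatEntry 2 y ∧
    quatEntry 3 (x * y) = quatEntry 2 x * quatEntry 1 y + quatEntry 3 x * quatEntry 3 y := by
  simp only [quatEntry_zero, quatEntry_one, quatEntry_two, quatEntry_three]
  refine ⟨?_, ?_, ?_, ?_⟩ <;> apply Complex.ext <;> simp <;> ring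

/-- The homomorphism `M(r; ℍ) → M(2r; ℂ)`. -/
def quaternionBlocks (r : ℕ) :
    Matrix (Fin r) (Fin r) ℍ[ℝ] →ₐ[ℝ] Matrix (Fin r ⊕ Fin r) (Fin r ⊕ Fin r) ℂ :=
  AlgHom.ofLinearMap
    { toFun := fun M => Matrix.fromBlocks (M.map (quatEntry 0)) (M.map (quatEntry 1))
        (M.map (quatEntry 2)) (M.map (quatEntry 3))
      map_add' := fun M N => by ext (i | i) (j | j) <;> simp
      map_smul' := fun c M => by ext (i | i) (j | j) <;> simp }
    (by
      ext (i | i) (j | j) <;>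
        simp [Matrix.one_apply, apply_ite (quatEntry 0), apply_ite (quatEntry 1),
          apply_ite (quatEntry 2), apply_ite (quatEntry 3)] <;>
        intros <;> apply Complex.ext <;>
        simp [quatEntry_zero, quatEntry_one, quatEntry_two, quatEntry_three] <;>
        split_ifs <;> rfl)
    (fun M N => by
      change Matrix.fromBlocks _ _ _ _ = Matrix.fromBlocks _ _ _ _ * Matrix.fromBlocks _ _ _ _
      rw [Matrix.fromBlocks_multiply]
      congr 1 <;> ext i j <;>
        simp only [Matrix.map_apply, Matrix.add_apply, Matrix.mul_apply, map_sum,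
          ← Finset.sum_add_distrib] <;> refine Finset.sum_congr rfl fun a _ => ?_
      exacts [(quatEntry_mul _ _).1, (quatEntry_mul _ _).2.1, (quatEntry_mul _ _).2.2.1,
        (quatEntry_mul _ _).2.2.2])

theorem quaternionBlocks_apply (M : Matrix (Fin r) (Fin r) ℍ[ℝ]) : quaternionBlocks r M =
    Matrix.fromBlocks (M.map (quatEntry 0)) (M.map (quatEntry 1))
        (M.map (quatEntry 2)) (M.map (quatEntry 3)) := rfl

/-- The quaternion with complex coordinates `(a, b)`. -/
def ofComplexPair (a b : ℂ) : ℍ[ℝ] := quat a.re b.re a.im b.im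

theorem quatEntry_ofComplexPair (a b : ℂ) :
    quatEntry 0 (ofComplexPair a b) = a ∧ quatEntry 2 (ofComplexPair a b) = b := ⟨rfl, rfl⟩

theorem ofComplexPair_quatEntry (x : ℍ[ℝ]) :
    ofComplexPair (quatEntry 0 x) (quatEntry 2 x) = x := rfl

theorem quatEntry_injective {x y : ℍ[ℝ]} (h0 : quatEntry 0 x = quatEntry 0 y)
    (h2 : quatEntry 2 x = quatEntry 2 y) : x = y := by
  rw [← ofComplexPair_quatEntry x, h0, h2, ofComplexPair_quatEntry]

/-- `M(2r; ℂ)` as an extension of `M(r; ℍ)`. -/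
def quaternionExtension : CentralExtension ℂ ℍ[ℝ] r ℓ fun k => Fin k where
  toAlgHom := ((blockEquiv e : _ ≃ₐ[ℝ] Matrix (Fin ℓ) (Fin ℓ) ℂ) : _ →ₐ[ℝ] _).comp
    (quaternionBlocks r)
  J := Matrix.diagonal fun _ => Complex.I
  J_sq := by
    rw [Matrix.diagonal_mul_diagonal, Complex.I_mul_I, ← Matrix.diagonal_one, Matrix.diagonal_neg]
  commute M := by
    ext i j
    rw [Matrix.mul_diagonal, Matrix.diagonal_mul, mul_comm]
  surj X := by
    obtain ⟨Y, rfl⟩ := (blockEquiv e : _ ≃ₐ[ℝ] Matrix (Fin ℓ) (Fin ℓ) ℂ).surjective X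
    obtain ⟨P, Q, R, S, rfl⟩ : ∃ P Q R S, Y = Matrix.fromBlocks P Q R S :=
      ⟨_, _, _, _, (Matrix.fromBlocks_toBlocks Y).symm⟩
    -- The entries solve the real linear equations that express M(2; ℂ) as ℍ plus ℍ times the scalar
    -- i.
    let a : Matrix (Fin r) (Fin r) ℍ[ℝ] := Matrix.of fun i j =>
      quat (((P i j).re + (S i j).re) / 2) (((R i j).re - (Q i j).re) / 2)
        (((P i j).im - (S i j).im) / 2) (((Q i j).im + (R i j).im) / 2)
    let b : Matrix (Fin r) (Fin r) ℍ[ℝ] := Matrix.of fun i j =>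
      quat (((P i j).im + (S i j).im) / 2) (((R i j).im - (Q i j).im) / 2)
        (((S i j).re - (P i j).re) / 2) (-((Q i j).re + (R i j).re) / 2)
    refine ⟨a, b, ?_⟩
    have hJ : (Matrix.diagonal fun _ => Complex.I : Matrix (Fin ℓ) (Fin ℓ) ℂ)
        = blockEquiv e (Matrix.diagonal fun _ => Complex.I) := by
      ext i j
      simp [blockEquiv, Matrix.reindexAlgEquiv_apply, Matrix.diagonal_apply]
    rw [hJ, AlgHom.comp_apply, AlgHom.comp_apply]
    change _ = blockEquiv e (quaternionBlocks r a) + blockEquiv e (quaternionBlocks r b) * _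
    rw [← map_mul, ← map_add]
    congr 1
    rw [quaternionBlocks_apply, quaternionBlocks_apply]
    ext (i | i) (j | j) <;> rw [Matrix.add_apply, Matrix.mul_diagonal] <;> apply Complex.ext <;>
      simp [a, b, quatEntry_zero, quatEntry_one, quatEntry_two, quatEntry_three] <;> ring
  finrank_eq := by
    have hℓ : ℓ = r + r := by simpa using (Fintype.card_congr e).symm
    rw [Module.finrank_matrix, Module.finrank_matrix, Complex.finrank_real_complex,
      Quaternion.finrank_eq_four, Fintype.card_fin, Fintype.card_fin, hℓ]
    ring
  -- In these coordinates the complex unit is right multiplication by j, the j in the definition of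
  -- 𝔰𝔬^*.
  c k := Matrix.diagonal fun _ => quat 0 0 1 0
  c_star k := by
    rw [Matrix.diagonal_conjTranspose, Matrix.diagonal_neg]
    congr 1
    ext i <;> simp
  equiv k :=
    { toFun := fun n => Matrix.of fun i j => ofComplexPair (n (e (.inl i)) j) (n (e (.inr i)) j)
      invFun := fun w => Matrix.of fun i j =>
        Sum.elim (fun a => quatEntry 0 (w a j)) (fun a => quatEntry 2 (w a j)) (e.symm i)
      map_add' := fun u v => by ext i j <;> simp [ofComplexPair]
      map_smul' := fun c u => by ext i j <;> simp [ofComplexPair]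
      left_inv := fun n => by
        ext1 i j
        obtain ⟨a | a, rfl⟩ := e.surjective i <;>
          simp [quatEntry_ofComplexPair]
      right_inv := fun w => by
        ext1 i j
        simp [ofComplexPair_quatEntry] }
  equiv_mul k M n := by
    ext1 i j
    have h := blockEquiv_mul_apply e (M.map (quatEntry 0)) (M.map (quatEntry 1))
        (M.map (quatEntry 2)) (M.map (quatEntry 3)) n i j
    let N : Matrix (Fin ℓ) (Fin k) ℂ := blockEquiv e (Matrix.fromBlocks (M.map (quatEntry 0))
      (M.map (quatEntry 1)) (M.map (quatEntry 2)) (M.map (quatEntry 3))) * n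
    change ofComplexPair (N (e (.inl i)) j) (N (e (.inr i)) j)
      = ∑ a, M i a * ofComplexPair (n (e (.inl a)) j) (n (e (.inr a)) j)
    apply quatEntry_injective
    · rw [(quatEntry_ofComplexPair _ _).1, map_sum]
      refine h.1.trans ?_
      rw [← Finset.sum_add_distrib]
      exact Finset.sum_congr rfl fun a _ => (quatEntry_mul (M i a)
        (ofComplexPair (n (e (.inl a)) j) (n (e (.inr a)) j))).1.symm
    · rw [(quatEntry_ofComplexPair _ _).2, map_sum]
      refine h.2.trans ?_
      rw [← Finset.sum_add_distrib]
      exact Finset.sum_congr rfl fun a _ => (quatEntry_mul (M i a)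
        (ofComplexPair (n (e (.inl a)) j) (n (e (.inr a)) j))).2.2.1.symm
  equiv_J k n := by
    ext1 i j
    rw [Matrix.mul_diagonal]
    change ofComplexPair ((Matrix.diagonal (fun _ => Complex.I) * n : Matrix (Fin ℓ) (Fin k) ℂ) _ j)
      ((Matrix.diagonal (fun _ => Complex.I) * n : Matrix (Fin ℓ) (Fin k) ℂ) _ j)
      = ofComplexPair (n _ j) (n _ j) * quat 0 0 1 0
    rw [Matrix.diagonal_mul, Matrix.diagonal_mul]
    ext <;> simp [ofComplexPair]

end QuaternionColumns

/-! ### Interchanged half-spin representations -/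

section Swapped

variable {p q : ℕ} {K : Type*} [Ring K] [StarRing K] [Algebra ℝ K] [StarModule ℝ K]
  {re : K →ₗ[ℝ] ℝ} (hre : IsRealPart re) {r ℓ : ℕ}
  (hr : 0 < r) (e : Fin r ⊕ Fin r ≃ Fin ℓ)

include hre hr e

/-- R⁺ becomes the block diagonal matrices and the generator the interchange of the two halves;
together they fill M(2r; 𝕂). -/
theorem exists_extension_swap [Module.Finite ℝ K] (hpq : 1 ≤ p + q)
    {E' : REven p q ≃ₐ[ℝ] (Fin 2 → Matrix (Fin r) (Fin r) K)} (hE' : IsStarIso E') (i₀ : Fin p ⊕ Fin q)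
    (hswap : ∀ s s' : REven p q, (s' : R p q) * gen p q i₀ = gen p q i₀ * s →
        E' s' 0 = E' s 1 ∧ E' s' 1 = E' s 0) :
    ∃ E : R p q ≃ₐ[ℝ] (Fin 1 → Matrix (Fin ℓ) (Fin ℓ) K), ∀ (m : ℕ) (ρ : SymRep p q m)
      (k : Fin 1 → ℕ), ρ.HasMultiplicities E k →
      ∀ π : soPQ p q × Matrix (Fin (k 0)) (Fin (k 0)) K →ₗ⁅ℝ⁆
        Module.End ℝ (Matrix (Fin r) (Fin (k 0)) K × Matrix (Fin r) (Fin (k 0)) K),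
      (∀ A x u, π (A, x) u
        = (spinRep E' 0 A * u.1 + u.1 * xᴴ, spinRep E' 1 A * u.2 - u.2 * x)) → ρ.ActsAs π := by
  have hy : IsOddElement (gen p q i₀) 1 := isOddElement_gen i₀
  let δ : (Fin 2 → Matrix (Fin r) (Fin r) K) →ₐ[ℝ] Matrix (Fin r ⊕ Fin r) (Fin r ⊕ Fin r) K :=
    AlgHom.ofLinearMap
      { toFun := fun D => Matrix.fromBlocks (D 0) 0 0 (D 1)
        map_add' := fun M N => by ext (i | i) (j | j) <;> simp
        map_smul' := fun c M => by ext (i | i) (j | j) <;> simp }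
      (by simp)
      (fun M N => by simp [Matrix.fromBlocks_multiply])
  have hδ : ∀ D, δ D = Matrix.fromBlocks (D 0) 0 0 (D 1) := fun _ => rfl
  let f : (Fin 2 → Matrix (Fin r) (Fin r) K) →ₐ[ℝ] (Fin 1 → Matrix (Fin ℓ) (Fin ℓ) K) :=
    AlgHom.pi fun _ => ((blockEquiv e : _ ≃ₐ[ℝ] Matrix (Fin ℓ) (Fin ℓ) K) : _ →ₐ[ℝ] _).comp δ
  have hf : ∀ D i, f D i = blockEquiv e (Matrix.fromBlocks (D 0) 0 0 (D 1)) := fun _ _ => rfl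
  obtain ⟨E, h1, h2⟩ := exists_extension hpq E' hy f
    (fun _ => blockEquiv e (Matrix.fromBlocks 0 1 1 0))
    (by
      ext1 i
      rw [Pi.mul_apply, ← map_mul, Matrix.fromBlocks_multiply, one_smul]
      simp)
    (fun s s' h => by
      ext1 i
      rw [Pi.mul_apply, Pi.mul_apply, hf, hf, ← map_mul, ← map_mul, Matrix.fromBlocks_multiply,
        Matrix.fromBlocks_multiply, (hswap s s' h).1, (hswap s s' h).2]
      simp)
    (fun X => by
      obtain ⟨Y, hY⟩ := (blockEquiv e : _ ≃ₐ[ℝ] Matrix (Fin ℓ) (Fin ℓ) K).surjective (X 0)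
      obtain ⟨P, Q, R, S, rfl⟩ : ∃ P Q R S, Y = Matrix.fromBlocks P Q R S :=
        ⟨_, _, _, _, (Matrix.fromBlocks_toBlocks Y).symm⟩
      refine ⟨![P, S], ![Q, R], ?_⟩
      ext1 i
      rw [Subsingleton.elim i 0, ← hY, Pi.add_apply, Pi.mul_apply, hf, hf, ← map_mul, ← map_add,
        Matrix.fromBlocks_multiply, Matrix.fromBlocks_add]
      simp)
    (by
      have hℓ : ℓ = r + r := by simpa using (Fintype.card_congr e).symm
      simp only [Module.finrank_pi_fintype, Finset.sum_const, Finset.card_univ, Fintype.card_fin,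
        smul_eq_mul, Module.finrank_matrix, hℓ]
      ring)
  refine ⟨E, fun m ρ k hk π hπ => ?_⟩
  let Θ := (piFinOne fun i => Matrix (Fin ℓ) (Fin (k i)) K).trans (rowsEquiv e (Fin (k 0)))
  have hΘ : ∀ n, Θ n = rowsEquiv e (Fin (k 0)) (n 0) := fun _ => rfl
  refine ρ.actsAs_swapped_blocks hk hre hr i₀ hy rfl hE' Θ (fun s n => ?_) (fun n => ?_) π hπ
  · rw [hΘ, hΘ, h1, hf, rowsEquiv_mul]
    simp
  · rw [hΘ, hΘ, h2, rowsEquiv_mul]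
    simp

end Swapped

/-! ### Conjugation on complex spin representations -/

section Conjugation

variable {r ℓ : ℕ}

/-- The homomorphism `M(r; ℂ) → M(2r; ℝ)`. -/
def complexBlocks (r : ℕ) :
    Matrix (Fin r) (Fin r) ℂ →ₐ[ℝ] Matrix (Fin r ⊕ Fin r) (Fin r ⊕ Fin r) ℝ :=
  AlgHom.ofLinearMap
    { toFun := fun M => Matrix.fromBlocks (M.map Complex.re) (-M.map Complex.im)
        (M.map Complex.im) (M.map Complex.re)
      map_add' := fun M N => by ext (i | i) (j | j) <;> simp; ring
      map_smul' := fun c M => by ext (i | i) (j | j) <;> simp }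
    (by ext (i | i) (j | j) <;> simp [Matrix.one_apply] <;> split_ifs <;> simp)
    (fun M N => by
      change Matrix.fromBlocks _ _ _ _ = Matrix.fromBlocks _ _ _ _ * Matrix.fromBlocks _ _ _ _
      rw [Matrix.fromBlocks_multiply, map_re_mul, map_im_mul]
      congr 1
      · noncomm_ring
      · noncomm_ring
      · exact add_comm _ _
      · noncomm_ring)

theorem complexBlocks_apply (M : Matrix (Fin r) (Fin r) ℂ) : complexBlocks r M =
    Matrix.fromBlocks (M.map Complex.re) (-M.map Complex.im) (M.map Complex.im)
      (M.map Complex.re) := rfl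

theorem matrix_complex_ext {n κ : Type*} {u v : Matrix n κ ℂ}
    (h : u.map Complex.re = v.map Complex.re) (h' : u.map Complex.im = v.map Complex.im) :
    u = v := by
  ext i j
  exact Complex.ext (congrFun (congrFun h i) j) (congrFun (congrFun h' i) j)

/-- Pairs of real matrices as complex matrices. -/
def reImEquiv (n κ : Type*) : (Matrix n κ ℝ × Matrix n κ ℝ) ≃ₗ[ℝ] Matrix n κ ℂ where
  toFun u := Matrix.of fun i j => ⟨u.1 i j, u.2 i j⟩
  invFun w := (w.map Complex.re, w.map Complex.im)
  map_add' u v := by ext i j; apply Complex.ext <;> simp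
  map_smul' c u := by ext i j; apply Complex.ext <;> simp
  left_inv u := rfl
  right_inv w := rfl

theorem reImEquiv_re {n κ : Type*} (u : Matrix n κ ℝ × Matrix n κ ℝ) :
    (reImEquiv n κ u).map Complex.re = u.1 := rfl

theorem reImEquiv_im {n κ : Type*} (u : Matrix n κ ℝ × Matrix n κ ℝ) :
    (reImEquiv n κ u).map Complex.im = u.2 := rfl

variable (e : Fin r ⊕ Fin r ≃ Fin ℓ) {κ : Type*}

theorem reImEquiv_complexBlocks (M : Matrix (Fin r) (Fin r) ℂ) (n : Matrix (Fin ℓ) κ ℝ) :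
    reImEquiv (Fin r) κ (rowsEquiv e κ (blockEquiv e (complexBlocks r M) * n))
      = M * reImEquiv (Fin r) κ (rowsEquiv e κ n) := by
  apply matrix_complex_ext
  · rw [reImEquiv_re, complexBlocks_apply, rowsEquiv_mul, map_re_mul, reImEquiv_re, reImEquiv_im,
      Matrix.neg_mul, sub_eq_add_neg]
  · rw [reImEquiv_im, complexBlocks_apply, rowsEquiv_mul, map_im_mul, reImEquiv_re, reImEquiv_im]
    exact add_comm _ _

theorem reImEquiv_conj (n : Matrix (Fin ℓ) κ ℝ) :
    reImEquiv (Fin r) κ (rowsEquiv e κ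
        ((blockEquiv e (Matrix.fromBlocks 1 0 0 (-1)) : Matrix (Fin ℓ) (Fin ℓ) ℝ) * n))
      = (reImEquiv (Fin r) κ (rowsEquiv e κ n)).map (starRingEnd ℂ) := by
  rw [rowsEquiv_mul]
  have e1 : ∀ w : Matrix (Fin r) κ ℂ,
      (w.map (starRingEnd ℂ)).map Complex.re = w.map Complex.re := fun w => by ext; simp
  have e2 : ∀ w : Matrix (Fin r) κ ℂ,
      (w.map (starRingEnd ℂ)).map Complex.im = -w.map Complex.im := fun w => by ext; simp
  apply matrix_complex_ext
  · rw [e1, reImEquiv_re, reImEquiv_re]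
    simp
  · rw [e2, reImEquiv_im, reImEquiv_im]
    simp

/-- Complex conjugation of the entries turns the sesquilinear-looking equation into a bilinear one,
because φ is conjugation and G is real. The transpose is there because `tensor` acts by w ↦ w ᵗX. -/
theorem mem_bilinearLie_iff [Fintype κ] [DecidableEq κ] (G b : Matrix κ κ ℂ)
    (hG : G.map (starRingEnd ℂ) = G) :
    bᵀ ∈ bilinearLie G ↔ G * bᴴ + b.map (Complex.conjAe : ℂ →ₐ[ℝ] ℂ) * G = 0 := by
  have e1 : G * bᴴ + b.map (Complex.conjAe : ℂ →ₐ[ℝ] ℂ) * G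
      = (b * G + G * bᵀ).map (starRingEnd ℂ) := by
    rw [Matrix.map_add _ (map_add _), Matrix.map_mul, Matrix.map_mul, hG, add_comm]
    rfl
  rw [e1]
  change bᵀᵀ * G + G * bᵀ = 0 ↔ _
  rw [Matrix.transpose_transpose]
  constructor
  · intro h
    rw [h]; simp
  · intro h
    have := congrArg (fun N => N.map (starRingEnd ℂ)) h
    simpa [Matrix.map_map, Function.comp_def] using this

variable {p q : ℕ} (hr : 0 < r)

include hr e

/-- An antilinear y of square 1 is a real structure on ℂ^r, and with M(r; ℂ) it generates all real
endomorphisms of ℂ^r. On W it is plain conjugation, c = 1, which gives 𝔰𝔬(k, ℂ). -/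
theorem exists_extension_conj_pos (hpq : 1 ≤ p + q) (i₀ : Fin p ⊕ Fin q)
    {E' : REven p q ≃ₐ[ℝ] (Fin 1 → Matrix (Fin r) (Fin r) ℂ)} (hE' : IsStarIso E') {y : R p q}
    (hy : IsOddElement y 1)
    (hconj : ∀ s s' : REven p q, (s' : R p q) * y = y * s →
        E' s' 0 = (E' s 0).map (starRingEnd ℂ)) :
    ∃ E : R p q ≃ₐ[ℝ] (Fin 1 → Matrix (Fin ℓ) (Fin ℓ) ℝ), ∀ (m : ℕ) (ρ : SymRep p q m)
      (k : Fin 1 → ℕ), ρ.HasMultiplicities E k →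
      ρ.ActsAs (tensor (spinRep E' 0) (std (soC (k 0)))) := by
  let f : (Fin 1 → Matrix (Fin r) (Fin r) ℂ) →ₐ[ℝ] (Fin 1 → Matrix (Fin ℓ) (Fin ℓ) ℝ) :=
    AlgHom.pi fun _ => (((blockEquiv e : _ ≃ₐ[ℝ] Matrix (Fin ℓ) (Fin ℓ) ℝ) : _ →ₐ[ℝ] _).comp
      (complexBlocks r)).comp (Pi.evalAlgHom ℝ _ 0)
  have hf : ∀ D i, f D i = blockEquiv e (complexBlocks r (D 0)) := fun _ _ => rfl
  obtain ⟨E, h1, h2⟩ := exists_extension hpq E' hy f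
    (fun _ => blockEquiv e (Matrix.fromBlocks 1 0 0 (-1)))
    (by
      ext1 i
      rw [Pi.mul_apply, ← map_mul, Matrix.fromBlocks_multiply, one_smul]
      simp)
    (fun s s' h => by
      have e1 : ((E' s 0).map (starRingEnd ℂ)).map Complex.re = (E' s 0).map Complex.re := by
        ext; simp
      have e2 : ((E' s 0).map (starRingEnd ℂ)).map Complex.im = -(E' s 0).map Complex.im := by
        ext; simp
      ext1 i
      rw [Pi.mul_apply, Pi.mul_apply, hf, hf, complexBlocks_apply, complexBlocks_apply, ← map_mul,
        ← map_mul, Matrix.fromBlocks_multiply, Matrix.fromBlocks_multiply, hconj s s' h, e1, e2]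
      simp)
    (fun X => by
      obtain ⟨Y, hY⟩ := (blockEquiv e : _ ≃ₐ[ℝ] Matrix (Fin ℓ) (Fin ℓ) ℝ).surjective (X 0)
      obtain ⟨P, Q, R, S, rfl⟩ : ∃ P Q R S, Y = Matrix.fromBlocks P Q R S :=
        ⟨_, _, _, _, (Matrix.fromBlocks_toBlocks Y).symm⟩
      -- The complex-linear and antilinear parts of a real-linear map.
      refine ⟨fun _ => Matrix.of fun i j => ⟨(P i j + S i j) / 2, (R i j - Q i j) / 2⟩,
        fun _ => Matrix.of fun i j => ⟨(P i j - S i j) / 2, (R i j + Q i j) / 2⟩, ?_⟩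
      ext1 i
      rw [Subsingleton.elim i 0, ← hY, Pi.add_apply, Pi.mul_apply, hf, hf, complexBlocks_apply,
        complexBlocks_apply, ← map_mul, ← map_add, Matrix.fromBlocks_multiply,
        Matrix.fromBlocks_add]
      congr 1
      ext (i | i) (j | j) <;> simp <;> ring)
    (by
      have hℓ : ℓ = r + r := by simpa using (Fintype.card_congr e).symm
      simp only [Module.finrank_pi_fintype, Finset.sum_const, Finset.card_univ, Fintype.card_fin,
        smul_eq_mul, Module.finrank_matrix, hℓ, Complex.finrank_real_complex, Module.finrank_self]
      ring)
  refine ⟨E, fun m ρ k hk => ?_⟩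
  let Θ : ((i : Fin 1) → Matrix (Fin ℓ) (Fin (k i)) ℝ) ≃ₗ[ℝ] Matrix (Fin r) (Fin (k 0)) ℂ :=
    ((piFinOne fun i => Matrix (Fin ℓ) (Fin (k i)) ℝ).trans (rowsEquiv e (Fin (k 0)))).trans
      (reImEquiv _ _)
  have hΘ : ∀ n, Θ n = reImEquiv _ _ (rowsEquiv e (Fin (k 0)) (n 0)) := fun _ => rfl
  refine ρ.actsAs_one_block hk isRealPart_complex hr i₀ hy hE' (Complex.conjAe : ℂ →ₐ[ℝ] ℂ)
    (fun x => Complex.conj_conj x) (fun x => Complex.conj_re x) (fun x => rfl) 1 ?_ Θ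
    (fun s n => ?_) (fun n => ?_) _ (fun x => (x.1)ᵀ) (fun A x u => rfl) (by simp) ?_ ?_
  · rw [Matrix.conjTranspose_one, one_smul]
    exact Matrix.map_one _ (map_zero _) (map_one _)
  · rw [hΘ, hΘ, h1, hf, reImEquiv_complexBlocks]
  · rw [hΘ, hΘ, h2, reImEquiv_conj, Matrix.mul_one]
    rfl
  · intro x hx
    exact Subtype.ext (Matrix.transpose_eq_zero.1 hx)
  · intro b
    rw [← mem_bilinearLie_iff _ _ (Matrix.map_one _ (map_zero _) (map_one _))]
    exact ⟨fun h => ⟨⟨bᵀ, h⟩, Matrix.transpose_transpose b⟩, by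
      rintro ⟨x, rfl⟩
      rw [Matrix.transpose_transpose]
      exact x.2⟩

omit hr e in
theorem map_neg_one (κ : Type*) [DecidableEq κ] :
    (-1 : Matrix κ κ ℂ).map (starRingEnd ℂ) = -1 := by
  ext i j
  by_cases h : i = j <;> simp [h]

omit hr e in
/-- The complex coordinates of a quaternionic matrix `w₁ + w₂ j`. -/
def complexColsEquiv (n κ : Type*) : Matrix n κ ℍ[ℝ] ≃ₗ[ℝ] Matrix n (κ ⊕ κ) ℂ where
  toFun w := Matrix.fromCols (w.map fun x => ⟨x.re, x.imI⟩) (w.map fun x => ⟨x.imJ, x.imK⟩)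
  invFun w := Matrix.of fun i j =>
    quat (w i (.inl j)).re (w i (.inl j)).im (w i (.inr j)).re (w i (.inr j)).im
  map_add' u v := by ext i (j | j) <;> apply Complex.ext <;> simp
  map_smul' c u := by ext i (j | j) <;> apply Complex.ext <;> simp
  left_inv u := rfl
  right_inv w := by ext i (j | j) <;> rfl

omit hr e in
theorem complexColsEquiv_mul (n κ : Type*) [Fintype n] (M : Matrix n n ℂ) (w : Matrix n κ ℍ[ℝ]) :
    complexColsEquiv n κ (M.map Quaternion.ofComplex * w) = M * complexColsEquiv n κ w := by
  ext i (j | j)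
  · change complexPart quaternionRe quaternionI ((M.map Quaternion.ofComplex * w) i j)
      = ∑ a, M i a * complexPart quaternionRe quaternionI (w a j)
    rw [Matrix.mul_apply, map_sum]
    refine Finset.sum_congr rfl fun a _ => Complex.ext ?_ ?_ <;>
      simp [complexPart, quaternionRe_apply, quaternionI_apply, quaternionJ_apply, quaternionK_apply]
  · change complexPart quaternionJ quaternionK ((M.map Quaternion.ofComplex * w) i j)
      = ∑ a, M i a * complexPart quaternionJ quaternionK (w a j)
    rw [Matrix.mul_apply, map_sum]
    refine Finset.sum_congr rfl fun a _ => Complex.ext ?_ ?_ <;>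
      simp [complexPart, quaternionRe_apply, quaternionI_apply, quaternionJ_apply, quaternionK_apply]

-- With w = w₁ + w₂ j one has j w = -w̄₂ + w̄₁ j, conjugation followed by a symplectic matrix.
omit hr e in
theorem complexColsEquiv_J (n κ : Type*) [Fintype n] [DecidableEq n] [Fintype κ] [DecidableEq κ]
    (w : Matrix n κ ℍ[ℝ]) :
    complexColsEquiv n κ ((Matrix.diagonal fun _ => quat 0 0 1 0 : Matrix n n ℍ[ℝ]) * w)
      = (complexColsEquiv n κ w).map (starRingEnd ℂ)
          * (Matrix.fromBlocks 0 1 (-1) 0 : Matrix (κ ⊕ κ) (κ ⊕ κ) ℂ) := by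
  have h : ∀ w, complexColsEquiv n κ w
      = Matrix.fromCols (w.map fun x => ⟨x.re, x.imI⟩) (w.map fun x => ⟨x.imJ, x.imK⟩) :=
    fun _ => rfl
  rw [h, h]
  have h' : (Matrix.fromCols (w.map fun x => (⟨x.re, x.imI⟩ : ℂ)) (w.map fun x => ⟨x.imJ, x.imK⟩)).map
      (starRingEnd ℂ) = Matrix.fromCols (w.map fun x => ⟨x.re, -x.imI⟩)
        (w.map fun x => ⟨x.imJ, -x.imK⟩) := by
    ext i (j | j) <;> rfl
  rw [h', Matrix.fromCols_mul_fromBlocks]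
  ext i (j | j) <;>
    simp only [Matrix.fromCols_apply_inl, Matrix.fromCols_apply_inr, Matrix.map_apply, Matrix.diagonal_mul] <;>
    apply Complex.ext <;> simp

-- An antilinear y of square -1 acts as the quaternion j, so M(r; ℂ) is enlarged to M(r; ℍ). On
-- complex coordinates c is symplectic, which gives 𝔰𝔭(k, ℂ).
omit e in
theorem exists_extension_conj_neg (hpq : 1 ≤ p + q) (i₀ : Fin p ⊕ Fin q)
    {E' : REven p q ≃ₐ[ℝ] (Fin 1 → Matrix (Fin r) (Fin r) ℂ)} (hE' : IsStarIso E') {y : R p q}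
    (hy : IsOddElement y (-1))
    (hconj : ∀ s s' : REven p q, (s' : R p q) * y = y * s →
        E' s' 0 = (E' s 0).map (starRingEnd ℂ)) :
    ∃ E : R p q ≃ₐ[ℝ] (Fin 1 → Matrix (Fin r) (Fin r) ℍ[ℝ]), ∀ (m : ℕ) (ρ : SymRep p q m)
      (k : Fin 1 → ℕ), ρ.HasMultiplicities E k →
      ρ.ActsAs (tensor (spinRep E' 0) (std (spC (k 0)))) := by
  let f : (Fin 1 → Matrix (Fin r) (Fin r) ℂ) →ₐ[ℝ] (Fin 1 → Matrix (Fin r) (Fin r) ℍ[ℝ]) :=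
    AlgHom.pi fun _ => Quaternion.ofComplex.mapMatrix.comp (Pi.evalAlgHom ℝ _ 0)
  have hf : ∀ D i, f D i = (D 0).map Quaternion.ofComplex := fun _ _ => rfl
  obtain ⟨E, h1, h2⟩ := exists_extension hpq E' hy f
    (fun _ => Matrix.diagonal fun _ => quat 0 0 1 0)
    (by
      ext1 i
      rw [Pi.mul_apply, Matrix.diagonal_mul_diagonal, Pi.smul_apply, Pi.one_apply, neg_smul,
        one_smul, ← Matrix.diagonal_one, Matrix.diagonal_neg]
      congr 1
      ext <;> simp)
    (fun s s' h => by
      ext1 i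
      rw [Pi.mul_apply, Pi.mul_apply, hf, hf, hconj s s' h]
      ext1 a b
      rw [Matrix.mul_diagonal, Matrix.diagonal_mul]
      ext <;> simp)
    (fun X => by
      refine ⟨fun _ => (X 0).map fun x => ⟨x.re, x.imI⟩, fun _ => (X 0).map fun x => ⟨x.imJ, x.imK⟩,
        ?_⟩
      ext1 i
      rw [Subsingleton.elim i 0, Pi.add_apply, Pi.mul_apply, hf, hf]
      ext1 a b
      rw [Matrix.add_apply, Matrix.mul_diagonal]
      ext <;> simp)
    (by
      simp only [Module.finrank_pi_fintype, Finset.sum_const, Finset.card_univ, Fintype.card_fin,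
        smul_eq_mul, Module.finrank_matrix, Complex.finrank_real_complex, Quaternion.finrank_eq_four]
      ring)
  refine ⟨E, fun m ρ k hk => ?_⟩
  let Θ : ((i : Fin 1) → Matrix (Fin r) (Fin (k i)) ℍ[ℝ]) ≃ₗ[ℝ]
      Matrix (Fin r) (Fin (k 0) ⊕ Fin (k 0)) ℂ :=
    (piFinOne fun i => Matrix (Fin r) (Fin (k i)) ℍ[ℝ]).trans (complexColsEquiv _ _)
  have hΘ : ∀ n, Θ n = complexColsEquiv _ _ (n 0) := fun _ => rfl
  refine ρ.actsAs_one_block hk isRealPart_complex hr i₀ hy hE' (Complex.conjAe : ℂ →ₐ[ℝ] ℂ)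
    (fun x => Complex.conj_conj x) (fun x => Complex.conj_re x) (fun x => rfl)
    (Matrix.fromBlocks 0 1 (-1) 0) ?_ Θ
    (fun s n => ?_) (fun n => ?_) _ (fun x => (x.1)ᵀ) (fun A x u => rfl) (by simp) ?_ ?_
  · rw [Matrix.fromBlocks_conjTranspose, Matrix.fromBlocks_map]
    simp [Matrix.fromBlocks_smul, Matrix.fromBlocks_neg, map_neg_one]
  · rw [hΘ, hΘ, h1, hf]
    exact complexColsEquiv_mul _ _ _ _
  · rw [hΘ, hΘ, h2]
    exact complexColsEquiv_J _ _ _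
  · intro x hx
    exact Subtype.ext (Matrix.transpose_eq_zero.1 hx)
  · intro b
    have hJ : (Matrix.fromBlocks 0 1 (-1) 0 : Matrix (Fin (k 0) ⊕ Fin (k 0)) _ ℂ)
        = -Matrix.J (Fin (k 0)) ℂ := by
      simp [Matrix.J, Matrix.fromBlocks_neg]
    rw [hJ, Matrix.neg_mul, Matrix.mul_neg, ← neg_add, neg_eq_zero, ← mem_bilinearLie_iff _ _
      (by rw [Matrix.J, Matrix.fromBlocks_map]; simp [map_neg_one])]
    exact ⟨fun h => ⟨⟨bᵀ, h⟩, Matrix.transpose_transpose b⟩, by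
      rintro ⟨x, rfl⟩
      rw [Matrix.transpose_transpose]
      exact x.2⟩

end Conjugation

/-! ### Membership in the classical Lie algebras -/

section Membership

/-- The condition on right multiplications is the defining equation of the Lie algebra for the
transposed matrix, as the action is w ↦ w ᵗX. -/
theorem skewAdjoint_iff {n : Type*} [Fintype n] [DecidableEq n] (J b : Matrix n n ℝ) :
    J * bᴴ + b * J = 0 ↔ ∃ x : skewAdjointMatricesLieSubalgebra J, (x.1)ᵀ = b := by
  have key : ∀ x : Matrix n n ℝ, x ∈ skewAdjointMatricesLieSubalgebra J ↔ xᵀ * J = J * -x :=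
    fun x => (mem_skewAdjointMatricesLieSubalgebra _ _).trans (mem_skewAdjointMatricesSubmodule _ _)
  have h : J * bᴴ + b * J = 0 ↔ bᵀ ∈ skewAdjointMatricesLieSubalgebra J := by
    rw [key, Matrix.transpose_transpose, Matrix.mul_neg, eq_neg_iff_add_eq_zero, add_comm,
      Matrix.conjTranspose_eq_transpose_of_trivial]
  rw [h]
  exact ⟨fun h => ⟨⟨bᵀ, h⟩, Matrix.transpose_transpose b⟩, by
    rintro ⟨x, rfl⟩
    rw [Matrix.transpose_transpose]
    exact x.2⟩

theorem sesquilinearLie_iff {n : Type*} [Fintype n] [DecidableEq n] {K : Type*} [Ring K] [StarRing K]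
    [Algebra ℝ K] [StarModule ℝ K] (G b : Matrix n n K) :
    G * bᴴ + b * G = 0 ↔ ∃ x : sesquilinearLie G, (x.1)ᴴ = b := by
  have h : G * bᴴ + b * G = 0 ↔ bᴴ ∈ sesquilinearLie G := by
    change _ ↔ bᴴᴴ * G + G * bᴴ = 0
    rw [Matrix.conjTranspose_conjTranspose, add_comm]
  rw [h]
  exact ⟨fun h => ⟨⟨bᴴ, h⟩, Matrix.conjTranspose_conjTranspose b⟩, by
    rintro ⟨x, rfl⟩
    rw [Matrix.conjTranspose_conjTranspose]
    exact x.2⟩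

/-- Over ℂ the tensor product uses the plain transpose while 𝔲 is defined by the conjugate
transpose; transposing the whole equation reconciles them, G being symmetric. -/
theorem sesquilinearLie_transpose_iff {n : Type*} [Fintype n] [DecidableEq n] (G b : Matrix n n ℂ)
    (hG : Gᵀ = G) : G * bᴴ + b * G = 0 ↔ ∃ x : sesquilinearLie G, (x.1)ᵀ = b := by
  have h : G * bᴴ + b * G = 0 ↔ bᵀ ∈ sesquilinearLie G := by
    change _ ↔ bᵀᴴ * G + G * bᵀ = 0
    have e : bᵀᴴ * G + G * bᵀ = (G * bᴴ + b * G)ᵀ := by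
      rw [Matrix.transpose_add, Matrix.transpose_mul, Matrix.transpose_mul, hG]
      rfl
    rw [e, Matrix.transpose_eq_zero]
  rw [h]
  exact ⟨fun h => ⟨⟨bᵀ, h⟩, Matrix.transpose_transpose b⟩, by
    rintro ⟨x, rfl⟩
    rw [Matrix.transpose_transpose]
    exact x.2⟩

theorem soPQ_iff (k₁ k₂ : ℕ) (b : Matrix (Fin k₁ ⊕ Fin k₂) (Fin k₁ ⊕ Fin k₂) ℝ) :
    diagPM k₁ k₂ ℝ * bᴴ + b * diagPM k₁ k₂ ℝ = 0 ↔ ∃ x : soPQ k₁ k₂, (x.1)ᵀ = b :=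
  skewAdjoint_iff _ b

theorem uPQ_iff (k₁ k₂ : ℕ) (b : Matrix (Fin k₁ ⊕ Fin k₂) (Fin k₁ ⊕ Fin k₂) ℂ) :
    diagPM k₁ k₂ ℂ * bᴴ + b * diagPM k₁ k₂ ℂ = 0 ↔ ∃ x : uPQ k₁ k₂, (x.1)ᵀ = b :=
  sesquilinearLie_transpose_iff _ b (Matrix.diagonal_transpose _)

theorem spPQ_iff (k₁ k₂ : ℕ) (b : Matrix (Fin k₁ ⊕ Fin k₂) (Fin k₁ ⊕ Fin k₂) ℍ[ℝ]) :
    diagPM k₁ k₂ ℍ[ℝ] * bᴴ + b * diagPM k₁ k₂ ℍ[ℝ] = 0 ↔ ∃ x : spPQ k₁ k₂, (x.1)ᴴ = b :=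
  sesquilinearLie_iff _ b

theorem spR_iff (r k : ℕ) (b : Matrix (Fin k ⊕ Fin k) (Fin k ⊕ Fin k) ℝ) :
    (complexExtension r).c k * bᴴ + b * (complexExtension r).c k = 0
      ↔ ∃ x : spR k, (x.1)ᵀ = b := by
  have hJ : (complexExtension r).c k = -Matrix.J (Fin k) ℝ := by
    simp [complexExtension, Matrix.J, Matrix.fromBlocks_neg]
  rw [hJ, Matrix.neg_mul, Matrix.mul_neg, ← neg_add, neg_eq_zero]
  exact skewAdjoint_iff _ b

theorem soStar_iff {r ℓ : ℕ} (e : Fin r ⊕ Fin r ≃ Fin ℓ) (k : ℕ) (b : Matrix (Fin k) (Fin k) ℍ[ℝ]) :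
    (quaternionExtension e).c k * bᴴ + b * (quaternionExtension e).c k = 0
      ↔ ∃ x : soStar k, (x.1)ᴴ = b :=
  sesquilinearLie_iff _ b

theorem prod_iff {L L' M M' : Type*} {P : M → Prop} {P' : M' → Prop} {f : L → M} {f' : L' → M'}
    (h : ∀ b, P b ↔ ∃ x, f x = b) (h' : ∀ b, P' b ↔ ∃ x, f' x = b) (b : M) (b' : M') :
    P b ∧ P' b' ↔ ∃ x : L × L', f x.1 = b ∧ f' x.2 = b' := by
  rw [h, h']
  exact ⟨fun ⟨⟨x, hx⟩, ⟨x', hx'⟩⟩ => ⟨(x, x'), hx, hx'⟩,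
    fun ⟨x, hx, hx'⟩ => ⟨⟨x.1, hx⟩, ⟨x.2, hx'⟩⟩⟩

theorem transpose_coe_injective {n : Type*} [Fintype n] [DecidableEq n] {K : Type*} [Ring K]
    [Algebra ℝ K] {𝔰 : LieSubalgebra ℝ (Matrix n n K)} (x : 𝔰) (h : (x.1)ᵀ = 0) : x = 0 :=
  Subtype.ext (Matrix.transpose_eq_zero.1 h)

theorem conjTranspose_coe_injective {n : Type*} [Fintype n] [DecidableEq n] {K : Type*} [Ring K]
    [StarRing K] [Algebra ℝ K] {𝔰 : LieSubalgebra ℝ (Matrix n n K)} (x : 𝔰) (h : (x.1)ᴴ = 0) :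
    x = 0 :=
  Subtype.ext (Matrix.conjTranspose_eq_zero.1 h)

end Membership

/-! ### The rows of the table -/

section Table

variable {p q : ℕ}

theorem nonempty_index (hpq : 1 ≤ p + q) : Nonempty (Fin p ⊕ Fin q) := by
  rcases p with _ | p
  · exact ⟨Sum.inr ⟨0, by omega⟩⟩
  · exact ⟨Sum.inl 0⟩

theorem nonempty_double (m : ℕ) : Nonempty (Fin (2 ^ m) ⊕ Fin (2 ^ m) ≃ Fin (2 ^ (m + 1))) :=
  ⟨finSumFinEquiv.trans (finCongr (by rw [pow_succ, mul_two]))⟩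

theorem exists_model_soC {m : ℕ} (hm : p + q = 2 * m + 2) (hp : Even p) (hq : Even q)
    (hn : (p + q) % 8 = 2) :
    ∃ (E : R p q ≃ₐ[ℝ] (Fin 1 → Matrix (Fin (2 ^ (m + 1))) (Fin (2 ^ (m + 1))) ℝ))
      (E' : REven p q ≃ₐ[ℝ] (Fin 1 → Matrix (Fin (2 ^ m)) (Fin (2 ^ m)) ℂ)),
      ∀ (m : ℕ) (ρ : SymRep p q m), ∃ k : Fin 1 → ℕ, ρ.HasMultiplicities E k ∧
        ρ.ActsAs (tensor (spinRep E' 0) (std (soC (k 0)))) := by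
  obtain ⟨i₀⟩ := nonempty_index (p := p) (q := q) (by omega)
  obtain ⟨e⟩ := nonempty_double m
  obtain ⟨y, E', hy, hE', hc⟩ := exists_starIso_conj_pos hp hq hn hm
  obtain ⟨E, hE⟩ := exists_extension_conj_pos e (by positivity) (by omega) i₀ hE' hy hc
  refine ⟨E, E', fun m ρ => ?_⟩
  obtain ⟨k, hk⟩ := ρ.exists_multiplicities (by positivity) E
  exact ⟨k, hk, hE m ρ k hk⟩

theorem exists_model_spC {m : ℕ} (hm : p + q = 2 * m + 2) (hp : Even p) (hq : Even q)
    (hn : (p + q) % 8 = 6) :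
    ∃ (E : R p q ≃ₐ[ℝ] (Fin 1 → Matrix (Fin (2 ^ m)) (Fin (2 ^ m)) ℍ[ℝ]))
      (E' : REven p q ≃ₐ[ℝ] (Fin 1 → Matrix (Fin (2 ^ m)) (Fin (2 ^ m)) ℂ)),
      ∀ (m : ℕ) (ρ : SymRep p q m), ∃ k : Fin 1 → ℕ, ρ.HasMultiplicities E k ∧
        ρ.ActsAs (tensor (spinRep E' 0) (std (spC (k 0)))) := by
  obtain ⟨i₀⟩ := nonempty_index (p := p) (q := q) (by omega)
  obtain ⟨y, E', hy, hE', hc⟩ := exists_starIso_conj_neg hp hq hn hm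
  obtain ⟨E, hE⟩ := exists_extension_conj_neg (by positivity) (by omega) i₀ hE' hy hc
  refine ⟨E, E', fun m ρ => ?_⟩
  obtain ⟨k, hk⟩ := ρ.exists_multiplicities (by positivity) E
  exact ⟨k, hk, hE m ρ k hk⟩

theorem exists_model_spR {m : ℕ} (hm : p + q = 2 * m + 1)
    (h : p % 8 = (q + 1) % 8 ∨ (p + 1) % 8 = q % 8) (h4 : p % 4 = 3 ∨ q % 4 = 3) :
    ∃ (E : R p q ≃ₐ[ℝ] (Fin 1 → Matrix (Fin (2 ^ m)) (Fin (2 ^ m)) ℂ))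
      (E' : REven p q ≃ₐ[ℝ] (Fin 1 → Matrix (Fin (2 ^ m)) (Fin (2 ^ m)) ℝ)),
      ∀ (m : ℕ) (ρ : SymRep p q m), ∃ k : Fin 1 → ℕ, ρ.HasMultiplicities E k ∧
        ρ.ActsAs (tensor (spinRep E' 0) (std (spR (k 0)))) := by
  obtain ⟨i₀⟩ := nonempty_index (p := p) (q := q) (by omega)
  obtain ⟨E', hE'⟩ := exists_starIso_real hm h
  obtain ⟨z, hz, hzo⟩ := exists_central_neg h4
  obtain ⟨E, hES, hEz⟩ := (complexExtension (2 ^ m)).exists_extension (by omega) E' hz hzo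
  refine ⟨E, E', fun _ ρ => ?_⟩
  obtain ⟨k, hk⟩ := ρ.exists_multiplicities (by positivity) E
  exact ⟨k, hk, (complexExtension (2 ^ m)).actsAs ρ isRealPart_real (by positivity) i₀ hzo hk hE'
    hES hEz _ (fun x => (x.1)ᵀ) (fun _ _ _ => rfl) Matrix.transpose_zero transpose_coe_injective
    (spR_iff _ _)⟩

theorem exists_model_soStar {m : ℕ} (hm : p + q = 2 * m + 3)
    (h : p % 8 = (q + 3) % 8 ∨ (p + 3) % 8 = q % 8) (h4 : p % 4 = 3 ∨ q % 4 = 3) :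
    ∃ (E : R p q ≃ₐ[ℝ] (Fin 1 → Matrix (Fin (2 ^ (m + 1))) (Fin (2 ^ (m + 1))) ℂ))
      (E' : REven p q ≃ₐ[ℝ] (Fin 1 → Matrix (Fin (2 ^ m)) (Fin (2 ^ m)) ℍ[ℝ])),
      ∀ (m : ℕ) (ρ : SymRep p q m), ∃ k : Fin 1 → ℕ, ρ.HasMultiplicities E k ∧
        ρ.ActsAs (tensorH (spinRep E' 0) (std (soStar (k 0)))) := by
  obtain ⟨i₀⟩ := nonempty_index (p := p) (q := q) (by omega)
  obtain ⟨e⟩ := nonempty_double m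
  obtain ⟨E', hE'⟩ := exists_starIso_quaternion hm h
  obtain ⟨z, hz, hzo⟩ := exists_central_neg h4
  obtain ⟨E, hES, hEz⟩ := (quaternionExtension e).exists_extension (by omega) E' hz hzo
  refine ⟨E, E', fun _ ρ => ?_⟩
  obtain ⟨k, hk⟩ := ρ.exists_multiplicities (by positivity) E
  exact ⟨k, hk, (quaternionExtension e).actsAs ρ isRealPart_quaternion (by positivity) i₀ hzo hk hE'
    hES hEz _ (fun x => (x.1)ᴴ) (fun _ _ _ => rfl) Matrix.conjTranspose_zero
    conjTranspose_coe_injective (soStar_iff e _)⟩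

theorem exists_model_glR {m : ℕ} (hm : p + q = 2 * m + 2) (hp : Even p) (hq : Even q)
    (h : p % 8 = q % 8) :
    ∃ (E : R p q ≃ₐ[ℝ] (Fin 1 → Matrix (Fin (2 ^ (m + 1))) (Fin (2 ^ (m + 1))) ℝ))
      (E' : REven p q ≃ₐ[ℝ] (Fin 2 → Matrix (Fin (2 ^ m)) (Fin (2 ^ m)) ℝ)),
      ∀ (m : ℕ) (ρ : SymRep p q m), ∃ k : Fin 1 → ℕ, ρ.HasMultiplicities E k ∧
        ρ.ActsAs (dsum
          (tensor (spinRep E' 0) (LieHom.id : _ →ₗ⁅ℝ⁆ Matrix (Fin (k 0)) (Fin (k 0)) ℝ))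
          (tensor (spinRep E' 1) (dualStd (k 0) ℝ))) := by
  obtain ⟨i₀⟩ := nonempty_index (p := p) (q := q) (by omega)
  obtain ⟨e⟩ := nonempty_double m
  obtain ⟨E₀, hE₀⟩ := exists_starIso_real_two hm h
  obtain ⟨E', hE', hswap⟩ := exists_starIso_swap hp hq (by grind) i₀ hE₀
  obtain ⟨E, hE⟩ := exists_extension_swap isRealPart_real (by positivity) e (by omega) hE' i₀ hswap
  refine ⟨E, E', fun m ρ => ?_⟩
  obtain ⟨k, hk⟩ := ρ.exists_multiplicities (by positivity) E
  refine ⟨k, hk, hE m ρ k hk _ fun A x u => Prod.ext rfl ?_⟩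
  -- The transpose in `tensor` undoes the one in the dual, so the second block is acted on by -x.
  change spinRep E' 1 A * u.2 + u.2 * (-xᴴ)ᵀ = _
  rw [Matrix.conjTranspose_eq_transpose_of_trivial, Matrix.transpose_neg,
    Matrix.transpose_transpose, Matrix.mul_neg, ← sub_eq_add_neg]

theorem exists_model_glH {m : ℕ} (hm : p + q = 2 * m + 4) (hp : Even p) (hq : Even q)
    (h : p % 8 = (q + 4) % 8) :
    ∃ (E : R p q ≃ₐ[ℝ] (Fin 1 → Matrix (Fin (2 ^ (m + 1))) (Fin (2 ^ (m + 1))) ℍ[ℝ]))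
      (E' : REven p q ≃ₐ[ℝ] (Fin 2 → Matrix (Fin (2 ^ m)) (Fin (2 ^ m)) ℍ[ℝ])),
      ∀ (m : ℕ) (ρ : SymRep p q m), ∃ k : Fin 1 → ℕ, ρ.HasMultiplicities E k ∧
        ρ.ActsAs (dsum
          (tensorH (spinRep E' 0) (LieHom.id : _ →ₗ⁅ℝ⁆ Matrix (Fin (k 0)) (Fin (k 0)) ℍ[ℝ]))
          (tensorH (spinRep E' 1) (dualStd (k 0) ℍ[ℝ]))) := by
  obtain ⟨i₀⟩ := nonempty_index (p := p) (q := q) (by omega)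
  obtain ⟨e⟩ := nonempty_double m
  obtain ⟨E₀, hE₀⟩ := exists_starIso_quaternion_two hm h
  obtain ⟨E', hE', hswap⟩ := exists_starIso_swap hp hq (by grind) i₀ hE₀
  obtain ⟨E, hE⟩ :=
    exists_extension_swap isRealPart_quaternion (by positivity) e (by omega) hE' i₀ hswap
  refine ⟨E, E', fun m ρ => ?_⟩
  obtain ⟨k, hk⟩ := ρ.exists_multiplicities (by positivity) E
  refine ⟨k, hk, hE m ρ k hk _ fun A x u => Prod.ext rfl ?_⟩
  change spinRep E' 1 A * u.2 + u.2 * (-xᴴ)ᴴ = _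
  rw [Matrix.conjTranspose_neg, Matrix.conjTranspose_conjTranspose, Matrix.mul_neg,
    ← sub_eq_add_neg]

theorem exists_extension_pos_one {K : Type*} [Ring K] [StarRing K] [Algebra ℝ K]
    [Module.Finite ℝ K] (hpq : 1 ≤ p + q) {r : ℕ}
    (E' : REven p q ≃ₐ[ℝ] (Fin 1 → Matrix (Fin r) (Fin r) K)) {z : R p q}
    (hz : ∀ a, Commute z a) (hzo : IsOddElement z 1) :
    ∃ E : R p q ≃ₐ[ℝ] (Fin 2 → Matrix (Fin r) (Fin r) K),
      (∀ (s : REven p q) i, E s i = E' s 0) ∧ E z 0 = 1 ∧ E z 1 = -1 := by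
  obtain ⟨E, h1, h2⟩ := exists_extension_pos hpq E' hz hzo (fun _ : Fin 2 => 0) ![1, -1]
    (fun _ => 0) (fun _ => 1) (by intro i; fin_cases i <;> simp) rfl
  exact ⟨E, h1, by simp [h2], by simp [h2]⟩

theorem exists_extension_pos_two {K : Type*} [Ring K] [StarRing K] [Algebra ℝ K]
    [Module.Finite ℝ K] (hpq : 1 ≤ p + q) {r : ℕ}
    (E' : REven p q ≃ₐ[ℝ] (Fin 2 → Matrix (Fin r) (Fin r) K)) {z : R p q}
    (hz : ∀ a, Commute z a) (hzo : IsOddElement z 1) :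
    ∃ E : R p q ≃ₐ[ℝ] (Fin 4 → Matrix (Fin r) (Fin r) K),
      (∀ (s : REven p q) i, E s i = E' s (![0, 0, 1, 1] i)) ∧
        E z 0 = 1 ∧ E z 1 = -1 ∧ E z 2 = 1 ∧ E z 3 = -1 := by
  obtain ⟨E, h1, h2⟩ := exists_extension_pos hpq E' hz hzo ![0, 0, 1, 1] ![1, -1, 1, -1]
    ![0, 2] ![1, 3] (by intro i; fin_cases i <;> simp) rfl
  exact ⟨E, h1, by simp [h2], by simp [h2], by simp [h2], by simp [h2]⟩

theorem restrictsTo_one {K : Type*} [Ring K] [Algebra ℝ K] {d d' r : ℕ}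
    {E : R p q ≃ₐ[ℝ] (Fin d → Matrix (Fin r) (Fin r) K)}
    {E' : REven p q ≃ₐ[ℝ] (Fin d' → Matrix (Fin r) (Fin r) K)} {i : Fin d} {j : Fin d'}
    (h : ∀ s : REven p q, E s i = E' s j) : RestrictsTo E E' i 1 j :=
  ⟨columnEquiv (Fin r) K, fun a v => by rw [columnEquiv_mulVec, h]⟩

theorem exists_model_soPQ {m : ℕ} (hm : p + q = 2 * m + 1)
    (h : p % 8 = (q + 1) % 8 ∨ (p + 1) % 8 = q % 8) (h4 : p % 4 = 1 ∨ q % 4 = 1) :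
    ∃ (E : R p q ≃ₐ[ℝ] (Fin 2 → Matrix (Fin (2 ^ m)) (Fin (2 ^ m)) ℝ))
      (E' : REven p q ≃ₐ[ℝ] (Fin 1 → Matrix (Fin (2 ^ m)) (Fin (2 ^ m)) ℝ)),
      ∀ (m : ℕ) (ρ : SymRep p q m), ∃ k : Fin 2 → ℕ, ρ.HasMultiplicities E k ∧
        ρ.ActsAs (tensor (spinRep E' 0) (std (soPQ (k 0) (k 1)))) := by
  obtain ⟨i₀⟩ := nonempty_index (p := p) (q := q) (by omega)
  obtain ⟨E', hE'⟩ := exists_starIso_real hm h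
  obtain ⟨z, hz, hzo⟩ := exists_central_pos h4
  obtain ⟨E, hES, hz0, hz1⟩ := exists_extension_pos_one (by omega) E' hz hzo
  refine ⟨E, E', fun _ ρ => ?_⟩
  obtain ⟨k, hk⟩ := ρ.exists_multiplicities (by positivity) E
  exact ⟨k, hk, ρ.actsAs_extension_pos isRealPart_real (by positivity) i₀ hzo hk hE' hES hz0 hz1
    _ (fun x => (x.1)ᵀ) (fun _ _ _ => rfl) Matrix.transpose_zero transpose_coe_injective
    (soPQ_iff _ _)⟩

theorem exists_model_uPQ {m : ℕ} (hm : p + q = 2 * m + 2)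
    (h : p % 8 = (q + 2) % 8 ∨ (p + 2) % 8 = q % 8) (h4 : p % 4 = 1 ∨ q % 4 = 1) :
    ∃ (E : R p q ≃ₐ[ℝ] (Fin 2 → Matrix (Fin (2 ^ m)) (Fin (2 ^ m)) ℂ))
      (E' : REven p q ≃ₐ[ℝ] (Fin 1 → Matrix (Fin (2 ^ m)) (Fin (2 ^ m)) ℂ)),
      ∀ (m : ℕ) (ρ : SymRep p q m), ∃ k : Fin 2 → ℕ, ρ.HasMultiplicities E k ∧
        ρ.ActsAs (tensor (spinRep E' 0) (std (uPQ (k 0) (k 1)))) := by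
  obtain ⟨i₀⟩ := nonempty_index (p := p) (q := q) (by omega)
  obtain ⟨E', hE'⟩ := exists_starIso_complex hm h
  obtain ⟨z, hz, hzo⟩ := exists_central_pos h4
  obtain ⟨E, hES, hz0, hz1⟩ := exists_extension_pos_one (by omega) E' hz hzo
  refine ⟨E, E', fun _ ρ => ?_⟩
  obtain ⟨k, hk⟩ := ρ.exists_multiplicities (by positivity) E
  exact ⟨k, hk, ρ.actsAs_extension_pos isRealPart_complex (by positivity) i₀ hzo hk hE' hES hz0 hz1
    _ (fun x => (x.1)ᵀ) (fun _ _ _ => rfl) Matrix.transpose_zero transpose_coe_injective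
    (uPQ_iff _ _)⟩

theorem exists_model_spPQ {m : ℕ} (hm : p + q = 2 * m + 3)
    (h : p % 8 = (q + 3) % 8 ∨ (p + 3) % 8 = q % 8) (h4 : p % 4 = 1 ∨ q % 4 = 1) :
    ∃ (E : R p q ≃ₐ[ℝ] (Fin 2 → Matrix (Fin (2 ^ m)) (Fin (2 ^ m)) ℍ[ℝ]))
      (E' : REven p q ≃ₐ[ℝ] (Fin 1 → Matrix (Fin (2 ^ m)) (Fin (2 ^ m)) ℍ[ℝ])),
      ∀ (m : ℕ) (ρ : SymRep p q m), ∃ k : Fin 2 → ℕ, ρ.HasMultiplicities E k ∧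
        ρ.ActsAs (tensorH (spinRep E' 0) (std (spPQ (k 0) (k 1)))) := by
  obtain ⟨i₀⟩ := nonempty_index (p := p) (q := q) (by omega)
  obtain ⟨E', hE'⟩ := exists_starIso_quaternion hm h
  obtain ⟨z, hz, hzo⟩ := exists_central_pos h4
  obtain ⟨E, hES, hz0, hz1⟩ := exists_extension_pos_one (by omega) E' hz hzo
  refine ⟨E, E', fun _ ρ => ?_⟩
  obtain ⟨k, hk⟩ := ρ.exists_multiplicities (by positivity) E
  exact ⟨k, hk, ρ.actsAs_extension_pos isRealPart_quaternion (by positivity) i₀ hzo hk hE' hES hz0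
    hz1 _ (fun x => (x.1)ᴴ) (fun _ _ _ => rfl) Matrix.conjTranspose_zero conjTranspose_coe_injective
    (spPQ_iff _ _)⟩

theorem exists_model_spR_spR {m : ℕ} (hm : p + q = 2 * m + 2) (h : p % 8 = q % 8)
    (h4 : p % 4 = 3 ∨ q % 4 = 3) :
    ∃ (E : R p q ≃ₐ[ℝ] (Fin 2 → Matrix (Fin (2 ^ m)) (Fin (2 ^ m)) ℂ))
      (E' : REven p q ≃ₐ[ℝ] (Fin 2 → Matrix (Fin (2 ^ m)) (Fin (2 ^ m)) ℝ)),
      RestrictsTo E E' 0 2 0 ∧ RestrictsTo E E' 1 2 1 ∧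
      ∀ (m : ℕ) (ρ : SymRep p q m), ∃ k : Fin 2 → ℕ, ρ.HasMultiplicities E k ∧
        ρ.ActsAs (dsum
          (tensor (spinRep E' 0) ((std (spR (k 0))).comp (LieHom.fst ℝ (spR (k 0)) (spR (k 1)))))
          (tensor (spinRep E' 1)
            ((std (spR (k 1))).comp (LieHom.snd ℝ (spR (k 0)) (spR (k 1)))))) := by
  obtain ⟨i₀⟩ := nonempty_index (p := p) (q := q) (by omega)
  obtain ⟨E', hE'⟩ := exists_starIso_real_two hm h
  obtain ⟨z, hz, hzo⟩ := exists_central_neg h4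
  let C := complexExtension (2 ^ m)
  obtain ⟨E, hES, hEz⟩ := C.exists_extension (by omega) E' hz hzo
  refine ⟨E, E', C.restrictsTo hES finSumFinEquiv 0, C.restrictsTo hES finSumFinEquiv 1,
    fun _ ρ => ?_⟩
  obtain ⟨k, hk⟩ := ρ.exists_multiplicities (by positivity) E
  exact ⟨k, hk, C.actsAs_two ρ isRealPart_real (by positivity) i₀ hzo hk hE' hES hEz _
    (fun x => (x.1.1)ᵀ) (fun x => (x.2.1)ᵀ) (fun _ _ _ => rfl) Matrix.transpose_zero
    Matrix.transpose_zero
    (fun x h h' => Prod.ext (transpose_coe_injective _ h) (transpose_coe_injective _ h'))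
    (prod_iff (spR_iff _ _) (spR_iff _ _))⟩

theorem exists_model_soStar_soStar {m : ℕ} (hm : p + q = 2 * m + 4) (h : p % 8 = (q + 4) % 8)
    (h4 : p % 4 = 3 ∨ q % 4 = 3) :
    ∃ (E : R p q ≃ₐ[ℝ] (Fin 2 → Matrix (Fin (2 ^ (m + 1))) (Fin (2 ^ (m + 1))) ℂ))
      (E' : REven p q ≃ₐ[ℝ] (Fin 2 → Matrix (Fin (2 ^ m)) (Fin (2 ^ m)) ℍ[ℝ])),
      RestrictsTo E E' 0 1 0 ∧ RestrictsTo E E' 1 1 1 ∧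
      ∀ (m : ℕ) (ρ : SymRep p q m), ∃ k : Fin 2 → ℕ, ρ.HasMultiplicities E k ∧
        ρ.ActsAs (dsum
          (tensorH (spinRep E' 0)
            ((std (soStar (k 0))).comp (LieHom.fst ℝ (soStar (k 0)) (soStar (k 1)))))
          (tensorH (spinRep E' 1)
            ((std (soStar (k 1))).comp (LieHom.snd ℝ (soStar (k 0)) (soStar (k 1)))))) := by
  obtain ⟨i₀⟩ := nonempty_index (p := p) (q := q) (by omega)
  obtain ⟨e⟩ := nonempty_double m
  obtain ⟨E', hE'⟩ := exists_starIso_quaternion_two hm h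
  obtain ⟨z, hz, hzo⟩ := exists_central_neg h4
  let C := quaternionExtension e
  obtain ⟨E, hES, hEz⟩ := C.exists_extension (by omega) E' hz hzo
  refine ⟨E, E', C.restrictsTo hES (Equiv.refl _) 0, C.restrictsTo hES (Equiv.refl _) 1,
    fun _ ρ => ?_⟩
  obtain ⟨k, hk⟩ := ρ.exists_multiplicities (by positivity) E
  exact ⟨k, hk, C.actsAs_two ρ isRealPart_quaternion (by positivity) i₀ hzo hk hE' hES hEz _
    (fun x => (x.1.1)ᴴ) (fun x => (x.2.1)ᴴ) (fun _ _ _ => rfl) Matrix.conjTranspose_zero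
    Matrix.conjTranspose_zero
    (fun x h h' => Prod.ext (conjTranspose_coe_injective _ h) (conjTranspose_coe_injective _ h'))
    (prod_iff (soStar_iff e _) (soStar_iff e _))⟩

theorem exists_model_soPQ_soPQ {m : ℕ} (hm : p + q = 2 * m + 2) (h : p % 8 = q % 8)
    (h4 : p % 4 = 1 ∨ q % 4 = 1) :
    ∃ (E : R p q ≃ₐ[ℝ] (Fin 4 → Matrix (Fin (2 ^ m)) (Fin (2 ^ m)) ℝ))
      (E' : REven p q ≃ₐ[ℝ] (Fin 2 → Matrix (Fin (2 ^ m)) (Fin (2 ^ m)) ℝ)),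
      RestrictsTo E E' 0 1 0 ∧ RestrictsTo E E' 1 1 0 ∧ RestrictsTo E E' 2 1 1 ∧
      RestrictsTo E E' 3 1 1 ∧
      ∀ (m : ℕ) (ρ : SymRep p q m), ∃ k : Fin 4 → ℕ, ρ.HasMultiplicities E k ∧
        ρ.ActsAs (dsum
          (tensor (spinRep E' 0) ((std (soPQ (k 0) (k 1))).comp
            (LieHom.fst ℝ (soPQ (k 0) (k 1)) (soPQ (k 2) (k 3)))))
          (tensor (spinRep E' 1) ((std (soPQ (k 2) (k 3))).comp
            (LieHom.snd ℝ (soPQ (k 0) (k 1)) (soPQ (k 2) (k 3)))))) := by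
  obtain ⟨i₀⟩ := nonempty_index (p := p) (q := q) (by omega)
  obtain ⟨E', hE'⟩ := exists_starIso_real_two hm h
  obtain ⟨z, hz, hzo⟩ := exists_central_pos h4
  obtain ⟨E, hES, hz0, hz1, hz2, hz3⟩ := exists_extension_pos_two (by omega) E' hz hzo
  refine ⟨E, E', restrictsTo_one fun s => hES s 0, restrictsTo_one fun s => hES s 1,
    restrictsTo_one fun s => hES s 2, restrictsTo_one fun s => hES s 3, fun _ ρ => ?_⟩
  obtain ⟨k, hk⟩ := ρ.exists_multiplicities (by positivity) E
  exact ⟨k, hk, ρ.actsAs_extension_pos_two isRealPart_real (by positivity) i₀ hzo hk hE'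
    (fun s => hES s 0) (fun s => hES s 1) (fun s => hES s 2) (fun s => hES s 3) hz0 hz1 hz2 hz3 _
    (fun x => (x.1.1)ᵀ) (fun x => (x.2.1)ᵀ) (fun _ _ _ => rfl) Matrix.transpose_zero
    Matrix.transpose_zero
    (fun x h h' => Prod.ext (transpose_coe_injective _ h) (transpose_coe_injective _ h'))
    (prod_iff (soPQ_iff _ _) (soPQ_iff _ _))⟩

theorem exists_model_spPQ_spPQ {m : ℕ} (hm : p + q = 2 * m + 4) (h : p % 8 = (q + 4) % 8)
    (h4 : p % 4 = 1 ∨ q % 4 = 1) :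
    ∃ (E : R p q ≃ₐ[ℝ] (Fin 4 → Matrix (Fin (2 ^ m)) (Fin (2 ^ m)) ℍ[ℝ]))
      (E' : REven p q ≃ₐ[ℝ] (Fin 2 → Matrix (Fin (2 ^ m)) (Fin (2 ^ m)) ℍ[ℝ])),
      RestrictsTo E E' 0 1 0 ∧ RestrictsTo E E' 1 1 0 ∧ RestrictsTo E E' 2 1 1 ∧
      RestrictsTo E E' 3 1 1 ∧
      ∀ (m : ℕ) (ρ : SymRep p q m), ∃ k : Fin 4 → ℕ, ρ.HasMultiplicities E k ∧
        ρ.ActsAs (dsum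
          (tensorH (spinRep E' 0) ((std (spPQ (k 0) (k 1))).comp
            (LieHom.fst ℝ (spPQ (k 0) (k 1)) (spPQ (k 2) (k 3)))))
          (tensorH (spinRep E' 1) ((std (spPQ (k 2) (k 3))).comp
            (LieHom.snd ℝ (spPQ (k 0) (k 1)) (spPQ (k 2) (k 3)))))) := by
  obtain ⟨i₀⟩ := nonempty_index (p := p) (q := q) (by omega)
  obtain ⟨E', hE'⟩ := exists_starIso_quaternion_two hm h
  obtain ⟨z, hz, hzo⟩ := exists_central_pos h4
  obtain ⟨E, hES, hz0, hz1, hz2, hz3⟩ := exists_extension_pos_two (by omega) E' hz hzo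
  refine ⟨E, E', restrictsTo_one fun s => hES s 0, restrictsTo_one fun s => hES s 1,
    restrictsTo_one fun s => hES s 2, restrictsTo_one fun s => hES s 3, fun _ ρ => ?_⟩
  obtain ⟨k, hk⟩ := ρ.exists_multiplicities (by positivity) E
  exact ⟨k, hk, ρ.actsAs_extension_pos_two isRealPart_quaternion (by positivity) i₀ hzo hk hE'
    (fun s => hES s 0) (fun s => hES s 1) (fun s => hES s 2) (fun s => hES s 3) hz0 hz1 hz2 hz3 _
    (fun x => (x.1.1)ᴴ) (fun x => (x.2.1)ᴴ) (fun _ _ _ => rfl) Matrix.conjTranspose_zero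
    Matrix.conjTranspose_zero
    (fun x h h' => Prod.ext (conjTranspose_coe_injective _ h) (conjTranspose_coe_injective _ h'))
    (prod_iff (spPQ_iff _ _) (spPQ_iff _ _))⟩

end Table

end CliffordQuartic

end

/-! ### The table: from residues modulo 8 to congruences and exponents. -/

theorem theorem3p5 (p q : ℕ) (hpq : 1 ≤ p + q) :
    (s(p % 8, q % 8) ∈ ({s(0, 2), s(4, 6)} : Set (Sym2 ℕ)) →
      ∃ (E : R p q ≃ₐ[ℝ] (Fin 1 → Matrix (Fin (2 ^ ((p + q) / 2))) (Fin (2 ^ ((p + q) / 2))) ℝ))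
        (E' : REven p q ≃ₐ[ℝ] (Fin 1 → Matrix (Fin (2 ^ ((p + q) / 2 - 1))) (Fin (2 ^ ((p + q) / 2 - 1))) ℂ)),
        ∀ (m : ℕ) (ρ : SymRep p q m), ∃ k : Fin 1 → ℕ, ρ.HasMultiplicities E k ∧
          ρ.ActsAs (tensor (spinRep E' 0) (std (soC (k 0))))) ∧
    (s(p % 8, q % 8) ∈ ({s(0, 7), s(2, 3), s(3, 4), s(6, 7)} : Set (Sym2 ℕ)) →
      ∃ (E : R p q ≃ₐ[ℝ] (Fin 1 → Matrix (Fin (2 ^ ((p + q - 1) / 2))) (Fin (2 ^ ((p + q - 1) / 2))) ℂ))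
        (E' : REven p q ≃ₐ[ℝ] (Fin 1 → Matrix (Fin (2 ^ ((p + q - 1) / 2))) (Fin (2 ^ ((p + q - 1) / 2))) ℝ)),
        ∀ (m : ℕ) (ρ : SymRep p q m), ∃ k : Fin 1 → ℕ, ρ.HasMultiplicities E k ∧
          ρ.ActsAs (tensor (spinRep E' 0) (std (spR (k 0))))) ∧
    (s(p % 8, q % 8) ∈ ({s(0, 3), s(2, 7), s(3, 6), s(4, 7)} : Set (Sym2 ℕ)) →
      ∃ (E : R p q ≃ₐ[ℝ] (Fin 1 → Matrix (Fin (2 ^ ((p + q - 1) / 2))) (Fin (2 ^ ((p + q - 1) / 2))) ℂ))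
        (E' : REven p q ≃ₐ[ℝ] (Fin 1 → Matrix (Fin (2 ^ ((p + q - 1) / 2 - 1))) (Fin (2 ^ ((p + q - 1) / 2 - 1))) ℍ[ℝ])),
        ∀ (m : ℕ) (ρ : SymRep p q m), ∃ k : Fin 1 → ℕ, ρ.HasMultiplicities E k ∧
          ρ.ActsAs (tensorH (spinRep E' 0) (std (soStar (k 0))))) ∧
    (s(p % 8, q % 8) ∈ ({s(0, 6), s(2, 4)} : Set (Sym2 ℕ)) →
      ∃ (E : R p q ≃ₐ[ℝ] (Fin 1 → Matrix (Fin (2 ^ ((p + q) / 2 - 1))) (Fin (2 ^ ((p + q) / 2 - 1))) ℍ[ℝ]))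
        (E' : REven p q ≃ₐ[ℝ] (Fin 1 → Matrix (Fin (2 ^ ((p + q) / 2 - 1))) (Fin (2 ^ ((p + q) / 2 - 1))) ℂ)),
        ∀ (m : ℕ) (ρ : SymRep p q m), ∃ k : Fin 1 → ℕ, ρ.HasMultiplicities E k ∧
          ρ.ActsAs (tensor (spinRep E' 0) (std (spC (k 0))))) ∧
    (s(p % 8, q % 8) ∈ ({s(0, 0), s(2, 2), s(4, 4), s(6, 6)} : Set (Sym2 ℕ)) →
      ∃ (E : R p q ≃ₐ[ℝ] (Fin 1 → Matrix (Fin (2 ^ ((p + q) / 2))) (Fin (2 ^ ((p + q) / 2))) ℝ))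
        (E' : REven p q ≃ₐ[ℝ] (Fin 2 → Matrix (Fin (2 ^ ((p + q) / 2 - 1))) (Fin (2 ^ ((p + q) / 2 - 1))) ℝ)),
        ∀ (m : ℕ) (ρ : SymRep p q m), ∃ k : Fin 1 → ℕ, ρ.HasMultiplicities E k ∧
          ρ.ActsAs (dsum (tensor (spinRep E' 0) (LieHom.id : _ →ₗ⁅ℝ⁆ Matrix (Fin (k 0)) (Fin (k 0)) ℝ))
            (tensor (spinRep E' 1) (dualStd (k 0) ℝ)))) ∧
    (s(p % 8, q % 8) ∈ ({s(0, 4), s(2, 6)} : Set (Sym2 ℕ)) →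
      ∃ (E : R p q ≃ₐ[ℝ] (Fin 1 → Matrix (Fin (2 ^ ((p + q) / 2 - 1))) (Fin (2 ^ ((p + q) / 2 - 1))) ℍ[ℝ]))
        (E' : REven p q ≃ₐ[ℝ] (Fin 2 → Matrix (Fin (2 ^ ((p + q) / 2 - 2))) (Fin (2 ^ ((p + q) / 2 - 2))) ℍ[ℝ])),
        ∀ (m : ℕ) (ρ : SymRep p q m), ∃ k : Fin 1 → ℕ, ρ.HasMultiplicities E k ∧
          ρ.ActsAs (dsum (tensorH (spinRep E' 0) (LieHom.id : _ →ₗ⁅ℝ⁆ Matrix (Fin (k 0)) (Fin (k 0)) ℍ[ℝ]))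
            (tensorH (spinRep E' 1) (dualStd (k 0) ℍ[ℝ])))) ∧
    (s(p % 8, q % 8) ∈ ({s(0, 1), s(1, 2), s(4, 5), s(5, 6)} : Set (Sym2 ℕ)) →
      ∃ (E : R p q ≃ₐ[ℝ] (Fin 2 → Matrix (Fin (2 ^ ((p + q - 1) / 2))) (Fin (2 ^ ((p + q - 1) / 2))) ℝ))
        (E' : REven p q ≃ₐ[ℝ] (Fin 1 → Matrix (Fin (2 ^ ((p + q - 1) / 2))) (Fin (2 ^ ((p + q - 1) / 2))) ℝ)),
        ∀ (m : ℕ) (ρ : SymRep p q m), ∃ k : Fin 2 → ℕ, ρ.HasMultiplicities E k ∧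
          ρ.ActsAs (tensor (spinRep E' 0) (std (soPQ (k 0) (k 1))))) ∧
    (s(p % 8, q % 8) ∈ ({s(1, 3), s(1, 7), s(3, 5), s(5, 7)} : Set (Sym2 ℕ)) →
      ∃ (E : R p q ≃ₐ[ℝ] (Fin 2 → Matrix (Fin (2 ^ ((p + q) / 2 - 1))) (Fin (2 ^ ((p + q) / 2 - 1))) ℂ))
        (E' : REven p q ≃ₐ[ℝ] (Fin 1 → Matrix (Fin (2 ^ ((p + q) / 2 - 1))) (Fin (2 ^ ((p + q) / 2 - 1))) ℂ)),
        ∀ (m : ℕ) (ρ : SymRep p q m), ∃ k : Fin 2 → ℕ, ρ.HasMultiplicities E k ∧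
          ρ.ActsAs (tensor (spinRep E' 0) (std (uPQ (k 0) (k 1))))) ∧
    (s(p % 8, q % 8) ∈ ({s(0, 5), s(1, 4), s(1, 6), s(2, 5)} : Set (Sym2 ℕ)) →
      ∃ (E : R p q ≃ₐ[ℝ] (Fin 2 → Matrix (Fin (2 ^ ((p + q - 3) / 2))) (Fin (2 ^ ((p + q - 3) / 2))) ℍ[ℝ]))
        (E' : REven p q ≃ₐ[ℝ] (Fin 1 → Matrix (Fin (2 ^ ((p + q - 3) / 2))) (Fin (2 ^ ((p + q - 3) / 2))) ℍ[ℝ])),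
        ∀ (m : ℕ) (ρ : SymRep p q m), ∃ k : Fin 2 → ℕ, ρ.HasMultiplicities E k ∧
          ρ.ActsAs (tensorH (spinRep E' 0) (std (spPQ (k 0) (k 1))))) ∧
    (s(p % 8, q % 8) ∈ ({s(3, 3), s(7, 7)} : Set (Sym2 ℕ)) →
      ∃ (E : R p q ≃ₐ[ℝ] (Fin 2 → Matrix (Fin (2 ^ ((p + q) / 2 - 1))) (Fin (2 ^ ((p + q) / 2 - 1))) ℂ))
        (E' : REven p q ≃ₐ[ℝ] (Fin 2 → Matrix (Fin (2 ^ ((p + q) / 2 - 1))) (Fin (2 ^ ((p + q) / 2 - 1))) ℝ)),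
        RestrictsTo E E' 0 2 0 ∧ RestrictsTo E E' 1 2 1 ∧
        ∀ (m : ℕ) (ρ : SymRep p q m), ∃ k : Fin 2 → ℕ, ρ.HasMultiplicities E k ∧
          ρ.ActsAs (dsum
            (tensor (spinRep E' 0) ((std (spR (k 0))).comp (LieHom.fst ℝ (spR (k 0)) (spR (k 1)))))
            (tensor (spinRep E' 1) ((std (spR (k 1))).comp (LieHom.snd ℝ (spR (k 0)) (spR (k 1))))))) ∧
    (s(p % 8, q % 8) ∈ ({s(3, 7)} : Set (Sym2 ℕ)) →
      ∃ (E : R p q ≃ₐ[ℝ] (Fin 2 → Matrix (Fin (2 ^ ((p + q) / 2 - 1))) (Fin (2 ^ ((p + q) / 2 - 1))) ℂ))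
        (E' : REven p q ≃ₐ[ℝ] (Fin 2 → Matrix (Fin (2 ^ ((p + q) / 2 - 2))) (Fin (2 ^ ((p + q) / 2 - 2))) ℍ[ℝ])),
        RestrictsTo E E' 0 1 0 ∧ RestrictsTo E E' 1 1 1 ∧
        ∀ (m : ℕ) (ρ : SymRep p q m), ∃ k : Fin 2 → ℕ, ρ.HasMultiplicities E k ∧
          ρ.ActsAs (dsum
            (tensorH (spinRep E' 0) ((std (soStar (k 0))).comp (LieHom.fst ℝ (soStar (k 0)) (soStar (k 1)))))
            (tensorH (spinRep E' 1) ((std (soStar (k 1))).comp (LieHom.snd ℝ (soStar (k 0)) (soStar (k 1))))))) ∧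
    (s(p % 8, q % 8) ∈ ({s(1, 1), s(5, 5)} : Set (Sym2 ℕ)) →
      ∃ (E : R p q ≃ₐ[ℝ] (Fin 4 → Matrix (Fin (2 ^ ((p + q) / 2 - 1))) (Fin (2 ^ ((p + q) / 2 - 1))) ℝ))
        (E' : REven p q ≃ₐ[ℝ] (Fin 2 → Matrix (Fin (2 ^ ((p + q) / 2 - 1))) (Fin (2 ^ ((p + q) / 2 - 1))) ℝ)),
        RestrictsTo E E' 0 1 0 ∧ RestrictsTo E E' 1 1 0 ∧ RestrictsTo E E' 2 1 1 ∧ RestrictsTo E E' 3 1 1 ∧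
        ∀ (m : ℕ) (ρ : SymRep p q m), ∃ k : Fin 4 → ℕ, ρ.HasMultiplicities E k ∧
          ρ.ActsAs (dsum
            (tensor (spinRep E' 0) ((std (soPQ (k 0) (k 1))).comp (LieHom.fst ℝ (soPQ (k 0) (k 1)) (soPQ (k 2) (k 3)))))
            (tensor (spinRep E' 1) ((std (soPQ (k 2) (k 3))).comp (LieHom.snd ℝ (soPQ (k 0) (k 1)) (soPQ (k 2) (k 3))))))) ∧
    (s(p % 8, q % 8) ∈ ({s(1, 5)} : Set (Sym2 ℕ)) →
      ∃ (E : R p q ≃ₐ[ℝ] (Fin 4 → Matrix (Fin (2 ^ ((p + q) / 2 - 2))) (Fin (2 ^ ((p + q) / 2 - 2))) ℍ[ℝ]))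
        (E' : REven p q ≃ₐ[ℝ] (Fin 2 → Matrix (Fin (2 ^ ((p + q) / 2 - 2))) (Fin (2 ^ ((p + q) / 2 - 2))) ℍ[ℝ])),
        RestrictsTo E E' 0 1 0 ∧ RestrictsTo E E' 1 1 0 ∧ RestrictsTo E E' 2 1 1 ∧ RestrictsTo E E' 3 1 1 ∧
        ∀ (m : ℕ) (ρ : SymRep p q m), ∃ k : Fin 4 → ℕ, ρ.HasMultiplicities E k ∧
          ρ.ActsAs (dsum
            (tensorH (spinRep E' 0) ((std (spPQ (k 0) (k 1))).comp (LieHom.fst ℝ (spPQ (k 0) (k 1)) (spPQ (k 2) (k 3)))))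
            (tensorH (spinRep E' 1) ((std (spPQ (k 2) (k 3))).comp (LieHom.snd ℝ (spPQ (k 0) (k 1)) (spPQ (k 2) (k 3))))))) := by
  refine ⟨fun h => ?_, fun h => ?_, fun h => ?_, fun h => ?_, fun h => ?_, fun h => ?_, fun h => ?_,
    fun h => ?_, fun h => ?_, fun h => ?_, fun h => ?_, fun h => ?_, fun h => ?_⟩
  · simp only [Set.mem_insert_iff, Set.mem_singleton_iff, Sym2.eq_iff] at h
    -- Here ℓ = 2r; the residues force p + q ≥ 2, so the subtraction is not truncated.
    rw [show (p + q) / 2 = (p + q) / 2 - 1 + 1 by omega]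
    exact exists_model_soC (by omega) (Nat.even_iff.2 (by omega)) (Nat.even_iff.2 (by omega)) (by omega)
  · simp only [Set.mem_insert_iff, Set.mem_singleton_iff, Sym2.eq_iff] at h
    exact exists_model_spR (by omega) (by omega) (by omega)
  · simp only [Set.mem_insert_iff, Set.mem_singleton_iff, Sym2.eq_iff] at h
    rw [show (p + q - 1) / 2 = (p + q - 1) / 2 - 1 + 1 by omega]
    exact exists_model_soStar (by omega) (by omega) (by omega)
  · simp only [Set.mem_insert_iff, Set.mem_singleton_iff, Sym2.eq_iff] at h
    exact exists_model_spC (by omega) (Nat.even_iff.2 (by omega)) (Nat.even_iff.2 (by omega)) (by omega)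
  · simp only [Set.mem_insert_iff, Set.mem_singleton_iff, Sym2.eq_iff] at h
    -- The residues (0, 0) alone allow p = q = 0, which `hpq` excludes.
    rw [show (p + q) / 2 = (p + q) / 2 - 1 + 1 by omega]
    exact exists_model_glR (by omega) (Nat.even_iff.2 (by omega)) (Nat.even_iff.2 (by omega)) (by omega)
  · simp only [Set.mem_insert_iff, Set.mem_singleton_iff, Sym2.eq_iff] at h
    rw [show (p + q) / 2 - 1 = (p + q) / 2 - 2 + 1 by omega]
    exact exists_model_glH (by omega) (Nat.even_iff.2 (by omega)) (Nat.even_iff.2 (by omega)) (by omega)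
  · simp only [Set.mem_insert_iff, Set.mem_singleton_iff, Sym2.eq_iff] at h
    exact exists_model_soPQ (by omega) (by omega) (by omega)
  · simp only [Set.mem_insert_iff, Set.mem_singleton_iff, Sym2.eq_iff] at h
    exact exists_model_uPQ (by omega) (by omega) (by omega)
  · simp only [Set.mem_insert_iff, Set.mem_singleton_iff, Sym2.eq_iff] at h
    exact exists_model_spPQ (by omega) (by omega) (by omega)
  · simp only [Set.mem_insert_iff, Set.mem_singleton_iff, Sym2.eq_iff] at h
    exact exists_model_spR_spR (by omega) (by omega) (by omega)
  · simp only [Set.mem_singleton_iff, Sym2.eq_iff] at h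
    rw [show (p + q) / 2 - 1 = (p + q) / 2 - 2 + 1 by omega]
    exact exists_model_soStar_soStar (by omega) (by omega) (by omega)
  · simp only [Set.mem_insert_iff, Set.mem_singleton_iff, Sym2.eq_iff] at h
    exact exists_model_soPQ_soPQ (by omega) (by omega) (by omega)
  · simp only [Set.mem_singleton_iff, Sym2.eq_iff] at h
    exact exists_model_spPQ_spPQ (by omega) (by omega) (by omega)
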